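/- Let $p$ be a prime and let $G$ be a group (regarded as a discrete topological group) or a pro-$p$ group. Write $\mathbb N=\{1,2,\dots\}$. Let $\gamma_1(G)=G$ and let $\gamma_{n+1}(G)$ be the closure of $[\gamma_n(G),G]$; let $D_n(G)$ be the set of all $g\in G$ such that, for every open normal subgroup $U$ of $G$, the element $1-gU$ lies in the $n$-th power of the augmentation ideal of $\mathbb F_p[G/U]$ (for an abstract group $G$ these are the lower central series and the dimension subgroups $D_n(G)=\{g : 1-g\in\omega_{\mathbb F_p}(G)^n\}$). Let $$\operatorname{gr}^{M}(G)=\bigoplus_{n\ge 1}\gamma_n(G)/\gamma_{n+1}(G),\qquad \operatorname{gr}^{Z,p}(G)=\bigoplus_{n\ge 1}D_n(G)/D_{n+1}(G)$$ be the Lie ring, respectively the restricted $\mathbb F_p$-Lie algebra, with bracket induced by the group commutator and, for the second one, with $p$-map induced by $x\mapsto x^p$, $D_n(G)\to D_{pn}(G)$. For an $\mathbb F_p$-Lie algebra $L$ let $\iota: L\to L^{[p]}$ be its restrictification, i.e. $L\mapsto L^{[p]}$ is the left adjoint of the forgetful functor from restricted $\mathbb F_p$-Lie algebras to $\mathbb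 F_p$-Lie algebras, with unit $\iota$; if $L=\bigoplus_{n} L_n$ is graded, let $L^{[p]}_n$ be the sum, over all $i\ge 1$, $j\ge 0$ with $ip^j=n$, of the $\mathbb F_p$-spans of $\{\iota(a)^{[p]^j} : a\in L_i\}$. Then $(\operatorname{gr}^{M}(G)\otimes\mathbb F_p)^{[p]}$ and $\operatorname{gr}^{Z,p}(G)$ are $\mathbb N$-graded restricted $\mathbb F_p$-Lie algebras (each is the direct sum of its homogeneous components $R_n$, with $[R_m,R_n]\subseteq R_{m+n}$ and $(R_n)^{[p]}\subseteq R_{pn}$), and both are $1$-generated, i.e. generated as restricted Lie algebras by their components of degree $1$; for pro-$p$ groups this means topological generation, with respect to the quotient topologies of $\gamma_n(G)/\gamma_{n+1}(G)$ and $D_n(G)/D_{n+1}(G)$. (For abstract groups it is generation in the algebraic sense.) There is a homomorphism of $\mathbb F_p$-Lie algebras $$\theta_G:\operatorname{gr}^{M}(G)\otimes\mathbb F_p\to\operatorname{gr}^{Z,p}(G),\qquad x\gamma_{n+1}(G)\otimes 1\mapsto xD_{n+1}(G)\quad (x\in\gamma_n(G)),$$ and the homomorphism of restricted $\mathbb F_p$-Lie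 algebras $$\hat\theta_G:(\operatorname{gr}^{M}(G)\otimes\mathbb F_p)^{[p]}\to\operatorname{gr}^{Z,p}(G)$$ that corresponds to $\theta_G$ under the adjunction (the unique one with $\hat\theta_G\circ\iota=\theta_G$) preserves degrees and is surjective. It is natural in $G$: for every (continuous) homomorphism $f:G\to H$ the homomorphisms that $f$ induces on both sides commute with $\hat\theta_G$ and $\hat\theta_H$. -/

import Mathlib

namespace MagnusZassenhaus

/-- `lieCoeff x y n k` is the coefficient of `t ^ k` in `ad (t x + y) ^ n (x)`. -/
def lieCoeff {L : Type*} [Zero L] [Add L] [Bracket L L] (x y : L) : ℕ → ℕ → L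
  | 0, 0 => x
  | 0, _ + 1 => 0
  | n + 1, 0 => ⁅y, lieCoeff x y n 0⁆
  | n + 1, k + 1 => ⁅x, lieCoeff x y n k⁆ + ⁅y, lieCoeff x y n (k + 1)⁆

/-- The coefficient `k s_k(x, y)` of `t ^ (k - 1)` in `ad (t x + y) ^ (p - 1) (x)`, `1 ≤ k ≤ p - 1`. -/
def jacobsonS {L : Type*} [Zero L] [Add L] [Bracket L L] (p k : ℕ) (x y : L) : L :=
  lieCoeff x y (p - 1) (k - 1)

/-- Restricted Lie algebras in the sense of Jacobson: Lie algebras with a `p`-map `x ↦ x^[p]` such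
that `(c x)^[p] = c^p x^[p]`, `(x + y)^[p] = x^[p] + y^[p] + ∑ s_k(x, y)` and
`ad (x^[p]) = (ad x)^p`. -/
class RestrictedLieAlgebra (p : ℕ) (K : Type*) (L : Type*) [Field K] [LieRing L]
    [LieAlgebra K L] where
  pmap : L → L
  pmap_smul : ∀ (c : K) (x : L), pmap (c • x) = c ^ p • pmap x
  pmap_add : ∀ x y : L, pmap (x + y) =
    pmap x + pmap y + ∑ k ∈ Finset.Icc 1 (p - 1), (k : K)⁻¹ • jacobsonS p k x y
  pmap_lie : ∀ x y : L, ⁅pmap x, y⁆ = (fun z => ⁅x, z⁆)^[p] y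

section Jacobson

open Polynomial

theorem lieCoeff_map {L M : Type*} [LieRing L] [LieRing M] (f : L →+ M)
    (hf : ∀ x y, f ⁅x, y⁆ = ⁅f x, f y⁆) (x y : L) :
    ∀ n k, f (lieCoeff x y n k) = lieCoeff (f x) (f y) n k
  | 0, 0 => rfl
  | 0, _ + 1 => map_zero f
  | n + 1, 0 => by simp only [lieCoeff, hf, lieCoeff_map f hf x y n]
  | n + 1, k + 1 => by simp only [lieCoeff, map_add, hf, lieCoeff_map f hf x y n]

theorem choose_prime_sub_one {R : Type*} [Ring R] (p : ℕ) [hp : Fact p.Prime] (h0 : (p : R) = 0)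
    (j : ℕ) (hj : j ≤ p - 1) : (-1 : R) ^ j * ((p - 1).choose j : R) = 1 := by
  induction j with
  | zero => simp
  | succ j ih =>
    have ih := ih (by omega)
    have h1 : (p - 1).choose j + (p - 1).choose (j + 1) = p.choose (j + 1) := by
      have : p = (p - 1) + 1 := (Nat.succ_pred_prime hp.out).symm
      conv_rhs => rw [this]
      rw [Nat.choose_succ_succ]
    have h2 : ((p.choose (j + 1) : ℕ) : R) = 0 := by
      obtain ⟨c, hc⟩ := hp.out.dvd_choose_self (Nat.succ_ne_zero j) (by have := hp.out.pos; omega)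
      rw [hc, Nat.cast_mul, h0, zero_mul]
    rw [← h1, Nat.cast_add] at h2
    rw [eq_neg_of_add_eq_zero_right h2, pow_succ]
    simpa using ih

theorem sub_pow_prime_sub_one {R : Type*} [Ring R] (p : ℕ) [hp : Fact p.Prime] (h0 : (p : R) = 0)
    {x y : R} (h : Commute x y) :
    (x - y) ^ (p - 1) = ∑ i ∈ Finset.range p, x ^ i * y ^ (p - 1 - i) := by
  rw [sub_eq_add_neg, (h.neg_right).add_pow, Nat.sub_add_cancel hp.out.one_le]
  refine Finset.sum_congr rfl fun i hi => ?_
  have hi' : i < p := Finset.mem_range.1 hi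
  rw [← Nat.choose_symm (by omega : i ≤ p - 1), neg_pow, mul_assoc, mul_assoc]
  congr 1
  rw [(Nat.cast_commute _ _).symm.eq, ← mul_assoc, ← (Nat.cast_commute _ _).eq,
    (Nat.cast_commute _ _).eq, choose_prime_sub_one p h0 _ (by omega), one_mul]

variable {A : Type*} [Ring A]

attribute [local instance] LieRing.ofAssociativeRing

theorem coeff_ad (a b : A) (n k : ℕ) :
    ((fun z : A[X] => (C a * X + C b) * z - z * (C a * X + C b))^[n] (C a)).coeff k =
      lieCoeff a b n k := by
  induction n generalizing k with
  | zero => cases k <;> simp [lieCoeff, coeff_C]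
  | succ n ih =>
    rw [Function.iterate_succ_apply']
    set w := (fun z : A[X] => (C a * X + C b) * z - z * (C a * X + C b))^[n] (C a)
    have e : (C a * X + C b) * w - w * (C a * X + C b) =
        (C a * w - w * C a) * X + (C b * w - w * C b) := by
      rw [add_mul, mul_add, mul_assoc (C a), X_mul, ← mul_assoc, ← mul_assoc, sub_mul]
      abel
    show ((C a * X + C b) * w - w * (C a * X + C b)).coeff k = _
    rw [e]
    cases k with
    | zero => simp [lieCoeff, ← ih, LieRing.of_associative_ring_bracket]
    | succ k => simp [lieCoeff, ← ih, LieRing.of_associative_ring_bracket]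

theorem derivative_pow_eq (u : A[X]) (n : ℕ) :
    derivative (u ^ n) = ∑ i ∈ Finset.range n, u ^ i * derivative u * u ^ (n - 1 - i) := by
  induction n with
  | zero => simp
  | succ n ih =>
    rw [pow_succ, derivative_mul, ih, Finset.sum_range_succ, Finset.sum_mul]
    simp only [add_tsub_cancel_right, Nat.sub_self, pow_zero, mul_one]
    congr 1
    refine Finset.sum_congr rfl fun i hi => ?_
    have : n - i = n - 1 - i + 1 := by have := Finset.mem_range.1 hi; omega
    simp only [this, pow_succ, mul_assoc]

theorem iterate_ad (u z : A) (n : ℕ) :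
    (fun z : A => u * z - z * u)^[n] z =
      ((LinearMap.mulLeft ℤ u - LinearMap.mulRight ℤ u) ^ n) z := by
  rw [Module.End.pow_apply]
  rfl

theorem iterate_ad_prime (p : ℕ) [hp : Fact p.Prime] (h0 : (p : A) = 0) (u z : A) :
    (fun z : A => u * z - z * u)^[p] z = u ^ p * z - z * u ^ p := by
  have hE : (p : Module.End ℤ A) = 0 := by
    ext z
    have : ((p : Module.End ℤ A)) z = (p : A) * z := by
      rw [Module.End.natCast_apply, nsmul_eq_mul]
    rw [this, h0, zero_mul, LinearMap.zero_apply]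
  rw [iterate_ad]
  have hc := LinearMap.commute_mulLeft_right (R := ℤ) u u
  rw [← Nat.sub_add_cancel hp.out.one_le, pow_succ, sub_pow_prime_sub_one p hE hc,
    Nat.sub_add_cancel hp.out.one_le]
  have : (∑ i ∈ Finset.range p, LinearMap.mulLeft ℤ u ^ i * LinearMap.mulRight ℤ u ^ (p - 1 - i)) *
      (LinearMap.mulLeft ℤ u - LinearMap.mulRight ℤ u) =
      LinearMap.mulLeft ℤ u ^ p - LinearMap.mulRight ℤ u ^ p := hc.geom_sum₂_mul p
  rw [this, LinearMap.pow_mulLeft, LinearMap.pow_mulRight]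
  rfl

theorem iterate_ad_prime_sub_one (p : ℕ) [hp : Fact p.Prime] (h0 : (p : A) = 0) (u z : A) :
    (fun z : A => u * z - z * u)^[p - 1] z =
      ∑ i ∈ Finset.range p, u ^ i * z * u ^ (p - 1 - i) := by
  have hE : (p : Module.End ℤ A) = 0 := by
    ext z
    have : ((p : Module.End ℤ A)) z = (p : A) * z := by
      rw [Module.End.natCast_apply, nsmul_eq_mul]
    rw [this, h0, zero_mul, LinearMap.zero_apply]
  rw [iterate_ad, sub_pow_prime_sub_one p hE (LinearMap.commute_mulLeft_right (R := ℤ) u u),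
    LinearMap.sum_apply]
  refine Finset.sum_congr rfl fun i _ => ?_
  rw [LinearMap.pow_mulLeft, LinearMap.pow_mulRight]
  simp [mul_assoc]

/-- Jacobson's formula in an associative algebra of characteristic `p`. -/
theorem add_pow_prime (p : ℕ) [hp : Fact p.Prime] (K : Type*) [Field K] [CharP K p]
    [Algebra K A] (a b : A) :
    (a + b) ^ p =
      a ^ p + b ^ p + ∑ k ∈ Finset.Icc 1 (p - 1), (k : K)⁻¹ • jacobsonS p k a b := by
  have h0 : (p : A) = 0 := by
    rw [← map_natCast (algebraMap K A), CharP.cast_eq_zero, map_zero]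
  have h0' : (p : A[X]) = 0 := by
    rw [← map_natCast (C : A →+* A[X]), h0, map_zero]
  set u : A[X] := C a * X + C b with hu
  have hd : derivative u = C a := by simp [hu]
  have hder : derivative (u ^ p) = (fun z : A[X] => u * z - z * u)^[p - 1] (C a) := by
    rw [derivative_pow_eq, iterate_ad_prime_sub_one p h0', hd]
  have hmid : ∀ k ∈ Finset.Icc 1 (p - 1),
      (u ^ p).coeff k = (k : K)⁻¹ • jacobsonS p k a b := by
    intro k hk
    obtain ⟨h1, h2⟩ := Finset.mem_Icc.1 hk
    have hp1 := hp.out.one_lt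
    have h3 := congrArg (fun f => coeff f (k - 1)) hder
    simp only [coeff_derivative] at h3
    rw [hu, coeff_ad, ← hu, Nat.sub_add_cancel h1] at h3
    have h4 : ((k - 1 : ℕ) : A) + 1 = algebraMap K A (k : K) := by
      rw [map_natCast, ← Nat.cast_succ, Nat.succ_eq_add_one, Nat.sub_add_cancel h1]
    have hk0 : (k : K) ≠ 0 := by
      intro h
      have := (CharP.cast_eq_zero_iff K p k).1 h
      have := Nat.le_of_dvd (by omega) this
      omega
    rw [h4, ← Algebra.commutes, ← Algebra.smul_def] at h3
    rw [jacobsonS, ← h3, smul_smul, inv_mul_cancel₀ hk0, one_smul]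
  have hdeg : (u ^ p).natDegree < p + 1 := by
    have h1 : u.natDegree ≤ 1 := by rw [hu]; exact natDegree_linear_le
    have h2 := natDegree_pow_le_of_le p h1
    omega
  have htop : (u ^ p).coeff p = a ^ p := by
    have h1 : u.natDegree ≤ 1 := by rw [hu]; exact natDegree_linear_le
    have := coeff_pow_of_natDegree_le (m := p) h1
    rw [mul_one] at this
    rw [this]; simp [hu]
  have hbot : (u ^ p).coeff 0 = b ^ p := by
    rw [← constantCoeff_apply, map_pow]; simp [hu]
  have heval : (u ^ p).eval 1 = (a + b) ^ p := by
    have : (u ^ p).eval 1 = (u.eval 1) ^ p := by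
      exact map_pow (eval₂RingHom' (RingHom.id A) (1 : A) fun _ => Commute.one_right _) u p
    rw [this]; simp [hu]
  rw [← heval, eval_eq_sum_range' hdeg]
  simp only [one_pow, mul_one]
  rw [Finset.sum_range_succ, htop, Finset.range_eq_Ico,
    Finset.sum_eq_sum_Ico_succ_bot hp.out.pos, hbot]
  have hI : Finset.Ico (0 + 1) p = Finset.Icc 1 (p - 1) := by
    ext k; simp only [Finset.mem_Ico, Finset.mem_Icc]; have := hp.out.pos; omega
  rw [hI, Finset.sum_congr rfl hmid]
  abel

end Jacobson

/-- The `p`-map `x ↦ x^[p]`. -/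
def pPow (p : ℕ) (K : Type*) {L : Type*} [Field K] [LieRing L] [LieAlgebra K L]
    [RestrictedLieAlgebra p K L] (x : L) : L :=
  RestrictedLieAlgebra.pmap p K x

/-- Homomorphisms of restricted Lie algebras. -/
structure RestrictedLieHom (p : ℕ) (K : Type*) (L M : Type*) [Field K]
    [LieRing L] [LieAlgebra K L] [RestrictedLieAlgebra p K L]
    [LieRing M] [LieAlgebra K M] [RestrictedLieAlgebra p K M] extends L →ₗ⁅K⁆ M where
  map_pPow' : ∀ x : L, toFun (pPow p K x) = pPow p K (toFun x)

section RestrictedLieHom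

variable {p : ℕ} {K L M N : Type*} [Field K]
  [LieRing L] [LieAlgebra K L] [RestrictedLieAlgebra p K L]
  [LieRing M] [LieAlgebra K M] [RestrictedLieAlgebra p K M]
  [LieRing N] [LieAlgebra K N] [RestrictedLieAlgebra p K N]

instance : CoeFun (RestrictedLieHom p K L M) fun _ => L → M := ⟨fun f => f.toLieHom⟩

theorem RestrictedLieHom.ext {f g : RestrictedLieHom p K L M} (h : ∀ x, f x = g x) : f = g := by
  obtain ⟨f, hf⟩ := f
  obtain ⟨g, hg⟩ := g
  have : f = g := LieHom.ext h
  subst this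
  rfl

theorem RestrictedLieHom.map_pPow (f : RestrictedLieHom p K L M) (x : L) :
    f (pPow p K x) = pPow p K (f x) := f.map_pPow' x

theorem RestrictedLieHom.map_add (f : RestrictedLieHom p K L M) (x y : L) :
    f (x + y) = f x + f y := _root_.map_add f.toLieHom x y

theorem RestrictedLieHom.map_smul (f : RestrictedLieHom p K L M) (c : K) (x : L) :
    f (c • x) = c • f x := _root_.map_smul f.toLieHom c x

theorem RestrictedLieHom.map_lie (f : RestrictedLieHom p K L M) (x y : L) :
    f ⁅x, y⁆ = ⁅f x, f y⁆ := LieHom.map_lie f.toLieHom x y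

/-- Composition of homomorphisms of restricted Lie algebras. -/
def RestrictedLieHom.comp (g : RestrictedLieHom p K M N) (f : RestrictedLieHom p K L M) :
    RestrictedLieHom p K L N where
  toLieHom := g.toLieHom.comp f.toLieHom
  map_pPow' x := by
    show g (f (pPow p K x)) = pPow p K (g (f x))
    rw [f.map_pPow, g.map_pPow]

end RestrictedLieHom

theorem pPow_smul (p : ℕ) {K L : Type*} [Field K] [LieRing L] [LieAlgebra K L]
    [RestrictedLieAlgebra p K L] (c : K) (x : L) : pPow p K (c • x) = c ^ p • pPow p K x :=
  RestrictedLieAlgebra.pmap_smul c x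

theorem pPow_add (p : ℕ) {K L : Type*} [Field K] [LieRing L] [LieAlgebra K L]
    [RestrictedLieAlgebra p K L] (x y : L) : pPow p K (x + y) =
      pPow p K x + pPow p K y + ∑ k ∈ Finset.Icc 1 (p - 1), (k : K)⁻¹ • jacobsonS p k x y :=
  RestrictedLieAlgebra.pmap_add x y

theorem pPow_lie (p : ℕ) {K L : Type*} [Field K] [LieRing L] [LieAlgebra K L]
    [RestrictedLieAlgebra p K L] (x y : L) : ⁅pPow p K x, y⁆ = (fun z => ⁅x, z⁆)^[p] y :=
  RestrictedLieAlgebra.pmap_lie x y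

section OfInjective

attribute [local instance] LieRing.ofAssociativeRing

/-- Jacobson's criterion: a Lie algebra that embeds into an associative algebra of characteristic
`p`, with image closed under `p`-th powers, is restricted. -/
@[reducible]
def RestrictedLieAlgebra.ofInjective (p : ℕ) [Fact p.Prime] (K : Type*) [Field K] [CharP K p]
    {L A : Type*} [LieRing L] [LieAlgebra K L] [Ring A] [Algebra K A] (E : L →ₗ⁅K⁆ A)
    (hE : Function.Injective E) (P : L → L) (hP : ∀ x, E (P x) = E x ^ p) :
    RestrictedLieAlgebra p K L where
  pmap := P
  pmap_smul c x := hE (by rw [hP, map_smul, map_smul, hP, smul_pow])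
  pmap_add x y := hE (by
    have hs : ∀ k, E (jacobsonS p k x y) = jacobsonS p k (E x) (E y) := fun k =>
      lieCoeff_map (E : L →ₗ[K] A).toAddMonoidHom (fun x y => LieHom.map_lie E x y) x y _ _
    rw [hP, map_add, add_pow_prime p K, map_add, map_add, hP, hP, map_sum]
    simp only [map_smul, hs])
  pmap_lie x y := hE (by
    have h0 : (p : A) = 0 := by
      rw [← map_natCast (algebraMap K A), CharP.cast_eq_zero, map_zero]
    have hit : ∀ n, E ((fun z => ⁅x, z⁆)^[n] y) = (fun z : A => E x * z - z * E x)^[n] (E y) := by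
      intro n
      induction n with
      | zero => rfl
      | succ n ih =>
        rw [Function.iterate_succ_apply', Function.iterate_succ_apply', LieHom.map_lie, ih,
          LieRing.of_associative_ring_bracket]
    rw [hit, iterate_ad_prime p h0, LieHom.map_lie, hP, LieRing.of_associative_ring_bracket])

end OfInjective

/-! ### The left adjoint of the forgetful functor from restricted Lie algebras to Lie algebras -/

namespace Restrictification

/-- Formal expressions in elements of `L` and the operations of a restricted Lie algebra. -/
inductive Pre (K : Type*) (L : Type*)
  | of : L → Pre K L
  | zero : Pre K L
  | add : Pre K L → Pre K L → Pre K L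
  | smul : K → Pre K L → Pre K L
  | lie : Pre K L → Pre K L → Pre K L
  | pPow : Pre K L → Pre K L

namespace Pre

variable {K L : Type*}

instance : Zero (Pre K L) := ⟨zero⟩
instance : Add (Pre K L) := ⟨add⟩
instance : SMul K (Pre K L) := ⟨smul⟩
instance : Bracket (Pre K L) (Pre K L) := ⟨lie⟩

/-- The expression `∑_{k=1}^{m} s_k(x, y)`. -/
def sumS [Field K] (p : ℕ) (x y : Pre K L) : ℕ → Pre K L
  | 0 => 0
  | m + 1 => sumS p x y m + ((m + 1 : ℕ) : K)⁻¹ • jacobsonS p (m + 1) x y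

end Pre

/-- The smallest congruence that makes the formal expressions a restricted Lie algebra and
`L → Pre K L` a homomorphism of Lie algebras. -/
inductive Rel (p : ℕ) (K : Type*) (L : Type*) [Field K] [LieRing L] [LieAlgebra K L] :
    Pre K L → Pre K L → Prop
  | refl (a : Pre K L) : Rel p K L a a
  | symm {a b : Pre K L} : Rel p K L a b → Rel p K L b a
  | trans {a b c : Pre K L} : Rel p K L a b → Rel p K L b c → Rel p K L a c
  | add_congr {a b c d : Pre K L} : Rel p K L a b → Rel p K L c d → Rel p K L (a + c) (b + d)
  | smul_congr (r : K) {a b : Pre K L} : Rel p K L a b → Rel p K L (r • a) (r • b)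
  | lie_congr {a b c d : Pre K L} : Rel p K L a b → Rel p K L c d → Rel p K L ⁅a, c⁆ ⁅b, d⁆
  | pPow_congr {a b : Pre K L} : Rel p K L a b → Rel p K L a.pPow b.pPow
  | add_assoc (a b c : Pre K L) : Rel p K L (a + b + c) (a + (b + c))
  | add_comm (a b : Pre K L) : Rel p K L (a + b) (b + a)
  | zero_add (a : Pre K L) : Rel p K L (0 + a) a
  | neg_add_cancel (a : Pre K L) : Rel p K L ((-1 : K) • a + a) 0
  | one_smul (a : Pre K L) : Rel p K L ((1 : K) • a) a
  | mul_smul (r s : K) (a : Pre K L) : Rel p K L ((r * s) • a) (r • s • a)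
  | smul_add (r : K) (a b : Pre K L) : Rel p K L (r • (a + b)) (r • a + r • b)
  | add_smul (r s : K) (a : Pre K L) : Rel p K L ((r + s) • a) (r • a + s • a)
  | add_lie (a b c : Pre K L) : Rel p K L ⁅a + b, c⁆ (⁅a, c⁆ + ⁅b, c⁆)
  | lie_add (a b c : Pre K L) : Rel p K L ⁅a, b + c⁆ (⁅a, b⁆ + ⁅a, c⁆)
  | lie_smul (r : K) (a b : Pre K L) : Rel p K L ⁅a, r • b⁆ (r • ⁅a, b⁆)
  | lie_self (a : Pre K L) : Rel p K L ⁅a, a⁆ 0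
  | leibniz_lie (a b c : Pre K L) : Rel p K L ⁅a, ⁅b, c⁆⁆ (⁅⁅a, b⁆, c⁆ + ⁅b, ⁅a, c⁆⁆)
  | pPow_smul (r : K) (a : Pre K L) : Rel p K L (r • a).pPow (r ^ p • a.pPow)
  | pPow_add (a b : Pre K L) : Rel p K L (a + b).pPow (a.pPow + b.pPow + Pre.sumS p a b (p - 1))
  | pPow_lie (a b : Pre K L) : Rel p K L ⁅a.pPow, b⁆ ((fun c => ⁅a, c⁆)^[p] b)
  | of_add (x y : L) : Rel p K L (Pre.of (x + y)) (Pre.of x + Pre.of y)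
  | of_smul (r : K) (x : L) : Rel p K L (Pre.of (r • x)) (r • Pre.of x)
  | of_lie (x y : L) : Rel p K L (Pre.of ⁅x, y⁆) ⁅(Pre.of x : Pre K L), (Pre.of y : Pre K L)⁆

end Restrictification

/-- The restrictification `L^[p]` of a Lie algebra `L`: the restricted Lie algebra freely generated
by the Lie algebra `L`. -/
def Restrictification (p : ℕ) (K : Type*) (L : Type*) [Field K] [LieRing L] [LieAlgebra K L] :=
  Quot (Restrictification.Rel p K L)

namespace Restrictification

variable {p : ℕ} {K L : Type*} [Field K] [LieRing L] [LieAlgebra K L]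

variable (p) in
/-- The class of a formal expression. -/
def mk (a : Pre K L) : Restrictification p K L := Quot.mk _ a

instance : Zero (Restrictification p K L) := ⟨mk p 0⟩
instance : Add (Restrictification p K L) :=
  ⟨Quot.map₂ (· + ·) (fun _ _ _ h => .add_congr (.refl _) h) fun _ _ _ h => .add_congr h (.refl _)⟩
instance : SMul K (Restrictification p K L) :=
  ⟨fun r => Quot.map (r • ·) fun _ _ h => .smul_congr r h⟩
instance : Bracket (Restrictification p K L) (Restrictification p K L) :=
  ⟨Quot.map₂ (fun a b => ⁅a, b⁆) (fun _ _ _ h => .lie_congr (.refl _) h)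
    fun _ _ _ h => .lie_congr h (.refl _)⟩

instance : Neg (Restrictification p K L) := ⟨fun a => (-1 : K) • a⟩

instance : AddCommGroup (Restrictification p K L) where
  add_assoc := by rintro ⟨a⟩ ⟨b⟩ ⟨c⟩; exact Quot.sound (.add_assoc a b c)
  add_comm := by rintro ⟨a⟩ ⟨b⟩; exact Quot.sound (.add_comm a b)
  zero_add := by rintro ⟨a⟩; exact Quot.sound (.zero_add a)
  add_zero := by rintro ⟨a⟩; exact Quot.sound (.trans (.add_comm a 0) (.zero_add a))
  neg_add_cancel := by rintro ⟨a⟩; exact Quot.sound (.neg_add_cancel a)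
  nsmul := nsmulRec
  zsmul := zsmulRec

instance : Module K (Restrictification p K L) where
  one_smul := by rintro ⟨a⟩; exact Quot.sound (.one_smul a)
  mul_smul := by rintro r s ⟨a⟩; exact Quot.sound (.mul_smul r s a)
  smul_add := by rintro r ⟨a⟩ ⟨b⟩; exact Quot.sound (.smul_add r a b)
  add_smul := by rintro r s ⟨a⟩; exact Quot.sound (.add_smul r s a)
  smul_zero r := by
    have h : r • (0 : Restrictification p K L) + r • 0 = r • 0 := by
      have : r • ((0 : Restrictification p K L) + 0) = r • 0 + r • 0 :=
        Quot.sound (.smul_add r 0 0)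
      rw [← this, add_zero]
    simpa using h
  zero_smul a := by
    have h : (0 : K) • a + (0 : K) • a = (0 : K) • a := by
      have : ((0 : K) + 0) • a = (0 : K) • a + (0 : K) • a := by
        induction a using Quot.ind with
        | mk a => exact Quot.sound (.add_smul 0 0 a)
      rw [← this, add_zero]
    simpa using h

instance : LieRing (Restrictification p K L) where
  add_lie := by rintro ⟨a⟩ ⟨b⟩ ⟨c⟩; exact Quot.sound (.add_lie a b c)
  lie_add := by rintro ⟨a⟩ ⟨b⟩ ⟨c⟩; exact Quot.sound (.lie_add a b c)
  lie_self := by rintro ⟨a⟩; exact Quot.sound (.lie_self a)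
  leibniz_lie := by rintro ⟨a⟩ ⟨b⟩ ⟨c⟩; exact Quot.sound (.leibniz_lie a b c)

instance : LieAlgebra K (Restrictification p K L) where
  lie_smul := by rintro r ⟨a⟩ ⟨b⟩; exact Quot.sound (.lie_smul r a b)

theorem mk_lieCoeff (a b : Pre K L) : ∀ n k,
    mk p (lieCoeff a b n k) = lieCoeff (mk p a) (mk p b) n k
  | 0, 0 => rfl
  | 0, _ + 1 => rfl
  | n + 1, 0 => by
    show ⁅mk p b, mk p (lieCoeff a b n 0)⁆ = _
    rw [mk_lieCoeff a b n]; rfl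
  | n + 1, k + 1 => by
    show ⁅mk p a, mk p (lieCoeff a b n k)⁆ + ⁅mk p b, mk p (lieCoeff a b n (k + 1))⁆ = _
    rw [mk_lieCoeff a b n, mk_lieCoeff a b n]; rfl

theorem mk_sumS (a b : Pre K L) (m : ℕ) :
    mk p (Pre.sumS p a b m) =
      ∑ k ∈ Finset.Icc 1 m, (k : K)⁻¹ • jacobsonS p k (mk p a) (mk p b) := by
  induction m with
  | zero => rfl
  | succ m ih =>
    rw [Finset.sum_Icc_succ_top (by omega), ← ih]
    show mk p (Pre.sumS p a b m) + ((m + 1 : ℕ) : K)⁻¹ • mk p (jacobsonS p (m + 1) a b) = _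
    rw [jacobsonS, mk_lieCoeff]
    rfl

theorem mk_iterate (a b : Pre K L) (n : ℕ) :
    mk p ((fun c => ⁅a, c⁆)^[n] b) = (fun c => ⁅mk p a, c⁆)^[n] (mk p b) := by
  induction n with
  | zero => rfl
  | succ n ih =>
    rw [Function.iterate_succ_apply', Function.iterate_succ_apply', ← ih]
    rfl

instance : RestrictedLieAlgebra p K (Restrictification p K L) where
  pmap := Quot.map Pre.pPow fun _ _ h => .pPow_congr h
  pmap_smul := by rintro r ⟨a⟩; exact Quot.sound (.pPow_smul r a)
  pmap_add := by
    rintro ⟨a⟩ ⟨b⟩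
    refine (Quot.sound (.pPow_add a b)).trans ?_
    show mk p a.pPow + mk p b.pPow + mk p (Pre.sumS p a b (p - 1)) = _
    rw [mk_sumS]
    rfl
  pmap_lie := by
    rintro ⟨a⟩ ⟨b⟩
    exact (Quot.sound (.pPow_lie a b)).trans (mk_iterate a b p)

variable (p K L) in
/-- The unit of the adjunction, `L → L^[p]`. -/
def ι : L →ₗ⁅K⁆ Restrictification p K L where
  toFun x := Quot.mk _ (.of x)
  map_add' x y := Quot.sound (.of_add x y)
  map_smul' r x := Quot.sound (.of_smul r x)
  map_lie' := Quot.sound (.of_lie _ _)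

section lift

variable {M : Type*} [LieRing M] [LieAlgebra K M] [RestrictedLieAlgebra p K M]

/-- The value of a formal expression in a restricted Lie algebra. -/
def eval (p : ℕ) {M : Type*} [LieRing M] [LieAlgebra K M] [RestrictedLieAlgebra p K M]
    (f : L →ₗ⁅K⁆ M) : Pre K L → M
  | .of x => f x
  | .zero => 0
  | .add a b => eval p f a + eval p f b
  | .smul r a => r • eval p f a
  | .lie a b => ⁅eval p f a, eval p f b⁆
  | .pPow a => pPow p K (eval p f a)

theorem eval_lieCoeff (f : L →ₗ⁅K⁆ M) (a b : Pre K L) : ∀ n k,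
    eval p f (lieCoeff a b n k) = lieCoeff (eval p f a) (eval p f b) n k
  | 0, 0 => rfl
  | 0, _ + 1 => rfl
  | n + 1, 0 => by
    show ⁅eval p f b, eval p f (lieCoeff a b n 0)⁆ = _
    rw [eval_lieCoeff f a b n]; rfl
  | n + 1, k + 1 => by
    show ⁅eval p f a, eval p f (lieCoeff a b n k)⁆ +
      ⁅eval p f b, eval p f (lieCoeff a b n (k + 1))⁆ = _
    rw [eval_lieCoeff f a b n, eval_lieCoeff f a b n]; rfl

theorem eval_sumS (f : L →ₗ⁅K⁆ M) (a b : Pre K L) (m : ℕ) :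
    eval p f (Pre.sumS p a b m) =
      ∑ k ∈ Finset.Icc 1 m, (k : K)⁻¹ • jacobsonS p k (eval p f a) (eval p f b) := by
  induction m with
  | zero => rfl
  | succ m ih =>
    rw [Finset.sum_Icc_succ_top (by omega), ← ih]
    show eval p f (Pre.sumS p a b m) + ((m + 1 : ℕ) : K)⁻¹ •
      eval p f (jacobsonS p (m + 1) a b) = _
    rw [jacobsonS, eval_lieCoeff]
    rfl

theorem eval_iterate (f : L →ₗ⁅K⁆ M) (a b : Pre K L) (n : ℕ) :
    eval p f ((fun c => ⁅a, c⁆)^[n] b) = (fun c => ⁅eval p f a, c⁆)^[n] (eval p f b) := by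
  induction n with
  | zero => rfl
  | succ n ih =>
    rw [Function.iterate_succ_apply', Function.iterate_succ_apply', ← ih]
    rfl

theorem eval_rel (f : L →ₗ⁅K⁆ M) {a b : Pre K L} (h : Rel p K L a b) :
    eval p f a = eval p f b := by
  induction h with
  | refl => rfl
  | symm _ ih => exact ih.symm
  | trans _ _ ih₁ ih₂ => exact ih₁.trans ih₂
  | add_congr _ _ ih₁ ih₂ => exact congrArg₂ (· + ·) ih₁ ih₂
  | smul_congr r _ ih => exact congrArg (r • ·) ih
  | lie_congr _ _ ih₁ ih₂ => exact congrArg₂ (fun x y => ⁅x, y⁆) ih₁ ih₂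
  | pPow_congr _ ih => exact congrArg (MagnusZassenhaus.pPow p K) ih
  | add_assoc a b c => exact _root_.add_assoc (eval p f a) (eval p f b) (eval p f c)
  | add_comm a b => exact _root_.add_comm (eval p f a) (eval p f b)
  | zero_add a => exact _root_.zero_add (eval p f a)
  | neg_add_cancel a =>
    show (-1 : K) • eval p f a + eval p f a = 0
    rw [neg_smul, _root_.one_smul, _root_.neg_add_cancel]
  | one_smul a => exact _root_.one_smul K (eval p f a)
  | mul_smul r s a => exact SemigroupAction.mul_smul r s (eval p f a)
  | smul_add r a b => exact _root_.smul_add r (eval p f a) (eval p f b)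
  | add_smul r s a => exact _root_.add_smul r s (eval p f a)
  | add_lie a b c => exact _root_.add_lie (eval p f a) (eval p f b) (eval p f c)
  | lie_add a b c => exact _root_.lie_add (eval p f a) (eval p f b) (eval p f c)
  | lie_smul r a b => exact _root_.lie_smul r (eval p f a) (eval p f b)
  | lie_self a => exact _root_.lie_self (eval p f a)
  | leibniz_lie a b c => exact _root_.leibniz_lie (eval p f a) (eval p f b) (eval p f c)
  | pPow_smul r a => exact MagnusZassenhaus.pPow_smul p r (eval p f a)
  | pPow_add a b =>
    show MagnusZassenhaus.pPow p K (eval p f a + eval p f b) =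
      MagnusZassenhaus.pPow p K (eval p f a) + MagnusZassenhaus.pPow p K (eval p f b) +
        eval p f (Pre.sumS p a b (p - 1))
    rw [eval_sumS, MagnusZassenhaus.pPow_add]
  | pPow_lie a b =>
    rw [eval_iterate]
    exact MagnusZassenhaus.pPow_lie p (eval p f a) (eval p f b)
  | of_add x y => exact map_add f x y
  | of_smul r x => exact map_smul f r x
  | of_lie x y => exact LieHom.map_lie f x y

/-- The homomorphism `L^[p] → M` of restricted Lie algebras that corresponds, under the adjunction,
to a homomorphism of Lie algebras `f : L → M`. -/
def lift (f : L →ₗ⁅K⁆ M) : RestrictedLieHom p K (Restrictification p K L) M where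
  toFun := Quot.lift (eval p f) fun _ _ h => eval_rel f h
  map_add' := by rintro ⟨a⟩ ⟨b⟩; rfl
  map_smul' := by rintro r ⟨a⟩; rfl
  map_lie' := by rintro ⟨a⟩ ⟨b⟩; rfl
  map_pPow' := by rintro ⟨a⟩; rfl

theorem lift_ι (f : L →ₗ⁅K⁆ M) (x : L) : lift f (ι p K L x) = f x := rfl

theorem hom_ext {f g : RestrictedLieHom p K (Restrictification p K L) M}
    (h : ∀ x, f (ι p K L x) = g (ι p K L x)) : f = g := by
  refine RestrictedLieHom.ext ?_
  rintro ⟨a⟩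
  induction a with
  | of x => exact h x
  | zero => exact (map_zero f.toLieHom).trans (map_zero g.toLieHom).symm
  | add a b ha hb =>
    refine (f.map_add (Quot.mk _ a) (Quot.mk _ b)).trans ?_
    rw [ha, hb]
    exact (g.map_add (Quot.mk _ a) (Quot.mk _ b)).symm
  | smul r a ha =>
    refine (f.map_smul r (Quot.mk _ a)).trans ?_
    rw [ha]
    exact (g.map_smul r (Quot.mk _ a)).symm
  | lie a b ha hb =>
    refine (f.map_lie (Quot.mk _ a) (Quot.mk _ b)).trans ?_
    rw [ha, hb]
    exact (g.map_lie (Quot.mk _ a) (Quot.mk _ b)).symm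
  | pPow a ha =>
    refine (f.map_pPow (Quot.mk _ a)).trans ?_
    rw [ha]
    exact (g.map_pPow (Quot.mk _ a)).symm

/-- The adjunction between the restrictification and the forgetful functor. -/
def liftEquiv : (L →ₗ⁅K⁆ M) ≃ RestrictedLieHom p K (Restrictification p K L) M where
  toFun := lift
  invFun g := g.toLieHom.comp (ι p K L)
  left_inv _ := rfl
  right_inv _ := hom_ext fun _ => rfl

end lift

/-- The restrictification as a functor. -/
def map (p : ℕ) {L' : Type*} [LieRing L'] [LieAlgebra K L'] (f : L →ₗ⁅K⁆ L') :
    RestrictedLieHom p K (Restrictification p K L) (Restrictification p K L') :=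
  lift ((ι p K L').comp f)

/-- The grading of `L^[p]` induced by a grading of `L`: the component of degree `n` is the sum over
all `i * p ^ j = n` of the subspaces spanned by the `p ^ j`-th powers of elements of degree `i`. -/
def grading (p : ℕ) (𝓛 : ℕ+ → Submodule K L) (n : ℕ+) : Submodule K (Restrictification p K L) :=
  Submodule.span K {z | ∃ (i : ℕ+) (j : ℕ) (a : L), (i : ℕ) * p ^ j = n ∧ a ∈ 𝓛 i ∧
    z = (pPow p K)^[j] (ι p K L a)}

end Restrictification

end MagnusZassenhaus

namespace MagnusZassenhaus

open scoped commutatorElement DirectSum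

/-- Strongly central series `G = Γ 1 ≥ Γ 2 ≥ ⋯`, `⁅Γ m, Γ n⁆ ≤ Γ (m + n)`, of subgroups of a group. -/
structure CentralSeries (G : Type*) [Group G] where
  /-- The terms of the series. -/
  toFun : ℕ+ → Subgroup G
  one_eq_top : toFun 1 = ⊤
  succ_le : ∀ n, toFun (n + 1) ≤ toFun n
  commutator_mem : ∀ {m n : ℕ+} {g h : G}, g ∈ toFun m → h ∈ toFun n → ⁅g, h⁆ ∈ toFun (m + n)

namespace CentralSeries

instance {G : Type*} [Group G] : CoeFun (CentralSeries G) fun _ => ℕ+ → Subgroup G := ⟨toFun⟩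

variable {G : Type*} [Group G] (Γ : CentralSeries G)

theorem antitone : Antitone Γ := by
  intro m n h
  induction n using PNat.recOn with
  | one => rw [le_antisymm h one_le]
  | succ n ih =>
    rcases h.eq_or_lt with h | h
    · rw [h]
    · exact (Γ.succ_le n).trans (ih (PNat.lt_add_one_iff.1 h))

theorem commutator_mem_succ {m n : ℕ+} {g h : G} (hg : g ∈ Γ m) (hh : h ∈ Γ n) :
    ⁅g, h⁆ ∈ Γ (n + 1) :=
  Γ.antitone (by rw [add_comm m n]; gcongr; exact one_le) (Γ.commutator_mem hg hh)

instance normal (n : ℕ+) : ((Γ (n + 1)).subgroupOf (Γ n)).Normal where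
  conj_mem x hx g := by
    rw [Subgroup.mem_subgroupOf] at hx ⊢
    have h1 : ((g * x * g⁻¹ : Γ n) : G) = ⁅(g : G), (x : G)⁆ * x := by
      simp [commutatorElement_def]
    rw [h1]
    exact mul_mem (Γ.commutator_mem_succ g.2 x.2) hx

/-- The group `Γ n / Γ (n + 1)`, written additively. -/
def Piece (n : ℕ+) : Type _ := Additive (Γ n ⧸ (Γ (n + 1)).subgroupOf (Γ n))

variable {Γ} in
/-- The class `g Γ (n + 1)` of `g ∈ Γ n`. -/
def Piece.mk {n : ℕ+} (g : Γ n) : Γ.Piece n := Additive.ofMul (QuotientGroup.mk g)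

instance (n : ℕ+) : AddGroup (Γ.Piece n) :=
  inferInstanceAs (AddGroup (Additive (Γ n ⧸ (Γ (n + 1)).subgroupOf (Γ n))))

variable {Γ} in
theorem Piece.mk_mul {n : ℕ+} (g h : Γ n) : Piece.mk (g * h) = Piece.mk g + Piece.mk h := rfl

variable {Γ} in
theorem Piece.mk_eq_mk {n : ℕ+} {g h : Γ n} :
    Piece.mk g = Piece.mk h ↔ (g : G)⁻¹ * h ∈ Γ (n + 1) := by
  refine (Additive.ofMul.injective.eq_iff.trans QuotientGroup.eq).trans ?_
  rw [Subgroup.mem_subgroupOf]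
  rfl

variable {Γ} in
theorem Piece.ind {n : ℕ+} {P : Γ.Piece n → Prop} (h : ∀ g, P (Piece.mk g)) (x) : P x :=
  QuotientGroup.induction_on (C := fun x => P (Additive.ofMul x)) x h

instance (n : ℕ+) : AddCommGroup (Γ.Piece n) where
  add_comm x y := by
    induction x using Piece.ind with | _ g
    induction y using Piece.ind with | _ h
    rw [← Piece.mk_mul, ← Piece.mk_mul, Piece.mk_eq_mk]
    have h1 : ((g * h : Γ n) : G)⁻¹ * (h * g : Γ n) = ⁅(h : G)⁻¹, (g : G)⁻¹⁆ := by
      simp [commutatorElement_def, mul_assoc]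
    rw [h1]
    exact Γ.commutator_mem_succ (inv_mem h.2) (inv_mem g.2)

/-- The quotient topology on `Γ n / Γ (n + 1)`. -/
instance [TopologicalSpace G] (n : ℕ+) : TopologicalSpace (Γ.Piece n) :=
  inferInstanceAs (TopologicalSpace (Γ n ⧸ (Γ (n + 1)).subgroupOf (Γ n)))

theorem conj_inv_mem {k n : ℕ+} {g h : G} (hg : g ∈ Γ k) (hh : h ∈ Γ n) :
    h⁻¹ * (g * h * g⁻¹) ∈ Γ (n + 1) := by
  have : h⁻¹ * (g * h * g⁻¹) = ⁅h⁻¹, g⁆ := by simp [commutatorElement_def, mul_assoc]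
  rw [this, ← commutatorElement_inv]
  exact inv_mem (Γ.commutator_mem_succ hg (inv_mem hh))

theorem Piece.mk_eq_zero {n : ℕ+} {g : Γ n} : (Piece.mk g : Γ.Piece n) = 0 ↔ (g : G) ∈ Γ (n + 1) := by
  have : (0 : Γ.Piece n) = Piece.mk 1 := rfl
  rw [this, eq_comm, Piece.mk_eq_mk]
  simp

variable {Γ} in
/-- The homomorphism on `Γ n / Γ (n + 1)` induced by a homomorphism on `Γ n`. -/
def Piece.lift {n : ℕ+} {A : Type*} [AddCommGroup A] (φ : Γ n → A)
    (hmul : ∀ g h, φ (g * h) = φ g + φ h) (hker : ∀ g : Γ n, (g : G) ∈ Γ (n + 1) → φ g = 0) :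
    Γ.Piece n →+ A :=
  MonoidHom.toAdditiveLeft (QuotientGroup.lift ((Γ (n + 1)).subgroupOf (Γ n))
    (MonoidHom.mk' (fun g => Multiplicative.ofAdd (φ g)) hmul) hker)

variable {Γ} in
theorem Piece.lift_mk {n : ℕ+} {A : Type*} [AddCommGroup A] (φ : Γ n → A) (hmul) (hker) (g : Γ n) :
    Piece.lift φ hmul hker (Piece.mk g) = φ g := rfl

/-- The commutator `(g Γ (m + 1), h Γ (n + 1)) ↦ ⁅g, h⁆ Γ (m + n + 1)`. -/
def pieceLie (m n : ℕ+) : Γ.Piece m →+ Γ.Piece n →+ Γ.Piece (m + n) :=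
  Piece.lift
    (fun g => Piece.lift
      (fun h => Piece.mk ⟨⁅(g : G), (h : G)⁆, Γ.commutator_mem g.2 h.2⟩)
      (fun h h' => by
        rw [← Piece.mk_mul, Piece.mk_eq_mk]
        have e := Γ.conj_inv_mem h.2 (Γ.commutator_mem g.2 h'.2)
        show ⁅(g : G), (h : G) * h'⁆⁻¹ * (⁅(g : G), (h : G)⁆ * ⁅(g : G), (h' : G)⁆) ∈ _
        rw [commutatorElement_mul_right_eq_mul_conj]
        convert inv_mem e using 1
        group)
      (fun h hh => by
        rw [Piece.mk_eq_zero]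
        have e := Γ.commutator_mem g.2 hh
        rwa [← add_assoc] at e))
    (fun g g' => by
      ext x
      induction x using Piece.ind with | _ h
      rw [AddMonoidHom.add_apply, Piece.lift_mk, Piece.lift_mk, Piece.lift_mk,
        ← Piece.mk_mul, Piece.mk_eq_mk]
      have hc := Γ.commutator_mem g'.2 h.2
      have ha := Γ.commutator_mem g.2 h.2
      have e := Γ.conj_inv_mem g.2 hc
      have e1 := Γ.commutator_mem_succ (inv_mem ha) (inv_mem e)
      show ⁅(g : G) * g', (h : G)⁆⁻¹ * (⁅(g : G), (h : G)⁆ * ⁅(g' : G), (h : G)⁆) ∈ _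
      rw [commutatorElement_mul_left_eq_conj_mul]
      convert mul_mem (mul_mem (Γ.succ_le _ e1) (inv_mem e))
        (Γ.commutator_mem_succ (inv_mem ha) (inv_mem hc)) using 1
      simp only [commutatorElement_def]
      group)
    (fun g hg => by
      ext x
      induction x using Piece.ind with | _ h
      rw [Piece.lift_mk, AddMonoidHom.zero_apply, Piece.mk_eq_zero, add_right_comm]
      exact Γ.commutator_mem hg h.2)

theorem pieceLie_mk {m n : ℕ+} (g : Γ m) (h : Γ n) :
    Γ.pieceLie m n (Piece.mk g) (Piece.mk h) =
      Piece.mk ⟨⁅(g : G), (h : G)⁆, Γ.commutator_mem g.2 h.2⟩ := rfl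

/-- The associated graded Lie ring `⨁ n, Γ n / Γ (n + 1)`. -/
def Gr : Type _ := ⨁ n : ℕ+, Γ.Piece n

instance : AddCommGroup Γ.Gr := inferInstanceAs (AddCommGroup (⨁ n : ℕ+, Γ.Piece n))

/-- The inclusion of the component of degree `n`. -/
def of (n : ℕ+) : Γ.Piece n →+ Γ.Gr := DirectSum.of Γ.Piece n

variable {Γ} in
@[elab_as_elim]
theorem Gr.ind {P : Γ.Gr → Prop} (x : Γ.Gr) (hof : ∀ (n : ℕ+) (g : Γ n), P (Γ.of n (Piece.mk g)))
    (h0 : P 0) (hadd : ∀ x y, P x → P y → P (x + y)) : P x :=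
  DirectSum.induction_on x h0
    (fun n x => Piece.ind (P := fun x => P (Γ.of n x)) (hof n) x) hadd

variable {Γ} in
theorem Gr.addHom_ext {A : Type*} [AddCommGroup A] {f f' : Γ.Gr →+ A}
    (h : ∀ (n : ℕ+) (g : Γ n), f (Γ.of n (Piece.mk g)) = f' (Γ.of n (Piece.mk g))) : f = f' := by
  ext x
  induction x using Gr.ind with
  | hof n g => exact h n g
  | h0 => rw [map_zero, map_zero]
  | hadd x y hx hy => rw [map_add, map_add, hx, hy]

/-- The homomorphism on `Gr` given by homomorphisms on the components. -/
def Gr.lift {A : Type*} [AddCommGroup A] (φ : ∀ n : ℕ+, Γ.Piece n →+ A) : Γ.Gr →+ A :=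
  DirectSum.toAddMonoid φ

theorem Gr.lift_of {A : Type*} [AddCommGroup A] (φ : ∀ n : ℕ+, Γ.Piece n →+ A) (n : ℕ+)
    (x : Γ.Piece n) : Gr.lift Γ φ (Γ.of n x) = φ n x :=
  DirectSum.toAddMonoid_of φ n x

/-- The bracket of `Gr`, as a biadditive map. -/
def lieHom : Γ.Gr →+ Γ.Gr →+ Γ.Gr :=
  Gr.lift Γ fun m => AddMonoidHom.flip <| Gr.lift Γ fun n =>
    AddMonoidHom.flip <| (Γ.of (m + n)).compHom.comp (Γ.pieceLie m n)

instance : Bracket Γ.Gr Γ.Gr := ⟨fun x y => Γ.lieHom x y⟩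

theorem of_lie_of {m n : ℕ+} (x : Γ.Piece m) (y : Γ.Piece n) :
    ⁅Γ.of m x, Γ.of n y⁆ = Γ.of (m + n) (Γ.pieceLie m n x y) := by
  show Γ.lieHom _ _ = _
  rw [lieHom, Gr.lift_of, AddMonoidHom.flip_apply, Gr.lift_of]
  rfl

/-- The class in degree `n` of an element of `Γ n`. -/
def cl (n : ℕ+) (g : G) (h : g ∈ Γ n) : Γ.Gr := Γ.of n (Piece.mk ⟨g, h⟩)

theorem lie_cl {m n : ℕ+} {g h : G} (hg : g ∈ Γ m) (hh : h ∈ Γ n) :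
    ⁅Γ.cl m g hg, Γ.cl n h hh⁆ = Γ.cl (m + n) ⁅g, h⁆ (Γ.commutator_mem hg hh) :=
  Γ.of_lie_of _ _

theorem cl_mul {n : ℕ+} {g h : G} (hg : g ∈ Γ n) (hh : h ∈ Γ n) :
    Γ.cl n (g * h) (mul_mem hg hh) = Γ.cl n g hg + Γ.cl n h hh := by
  rw [cl, cl, cl, ← map_add, ← Piece.mk_mul]
  rfl

theorem cl_one {n : ℕ+} : Γ.cl n 1 (one_mem _) = 0 := map_zero (Γ.of n)

theorem cl_inv {n : ℕ+} {g : G} (hg : g ∈ Γ n) : Γ.cl n g⁻¹ (inv_mem hg) = - Γ.cl n g hg := by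
  rw [eq_neg_iff_add_eq_zero, ← cl_mul]
  simp only [inv_mul_cancel, cl_one]

theorem cl_congr {m n : ℕ+} (e : m = n) {g h : G} (e' : g = h) (hg : g ∈ Γ m) (hh : h ∈ Γ n) :
    Γ.cl m g hg = Γ.cl n h hh := by
  subst e e'
  rfl

theorem cl_conj {k n : ℕ+} {g h : G} (hg : g ∈ Γ k) (hh : h ∈ Γ n) (h' : g * h * g⁻¹ ∈ Γ n) :
    Γ.cl n (g * h * g⁻¹) h' = Γ.cl n h hh := by
  refine congrArg _ ((Piece.mk_eq_mk.2 ?_).symm)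
  exact Γ.conj_inv_mem hg hh

theorem conj_mem {k n : ℕ+} {g h : G} (hg : g ∈ Γ k) (hh : h ∈ Γ n) : g * h * g⁻¹ ∈ Γ n := by
  simpa using mul_mem hh (Γ.succ_le _ (Γ.conj_inv_mem hg hh))

theorem Gr.zero_lie (x : Γ.Gr) : ⁅(0 : Γ.Gr), x⁆ = 0 := by
  show Γ.lieHom 0 x = 0; rw [map_zero]; rfl

theorem Gr.lie_zero (x : Γ.Gr) : ⁅x, (0 : Γ.Gr)⁆ = 0 := map_zero (Γ.lieHom x)

theorem Gr.add_lie (x y z : Γ.Gr) : ⁅x + y, z⁆ = ⁅x, z⁆ + ⁅y, z⁆ := by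
  show Γ.lieHom (x + y) z = _; rw [map_add]; rfl

theorem Gr.lie_add (x y z : Γ.Gr) : ⁅x, y + z⁆ = ⁅x, y⁆ + ⁅x, z⁆ := map_add (Γ.lieHom x) y z

theorem Gr.skew (x y : Γ.Gr) : ⁅x, y⁆ + ⁅y, x⁆ = 0 := by
  induction x using Gr.ind with
  | h0 => rw [Gr.zero_lie, Gr.lie_zero, add_zero]
  | hadd x x' hx hx' =>
    rw [Gr.add_lie, Gr.lie_add, add_add_add_comm, hx, hx', add_zero]
  | hof m g =>
    induction y using Gr.ind with
    | h0 => rw [Gr.zero_lie, Gr.lie_zero, add_zero]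
    | hadd y y' hy hy' =>
      rw [Gr.add_lie, Gr.lie_add, add_add_add_comm, hy, hy', add_zero]
    | hof n h =>
      obtain ⟨g, hg⟩ := g
      obtain ⟨h, hh⟩ := h
      show ⁅Γ.cl m g hg, Γ.cl n h hh⁆ + ⁅Γ.cl n h hh, Γ.cl m g hg⁆ = 0
      have e := Γ.cl_congr (add_comm n m) (commutatorElement_inv g h).symm
        (Γ.commutator_mem hh hg) (inv_mem (Γ.commutator_mem hg hh))
      rw [lie_cl, lie_cl, e, Γ.cl_inv (Γ.commutator_mem hg hh), add_neg_cancel]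

theorem Gr.lie_self (x : Γ.Gr) : ⁅x, x⁆ = 0 := by
  induction x using Gr.ind with
  | h0 => rw [Gr.zero_lie]
  | hadd x y hx hy =>
    rw [Gr.add_lie, Gr.lie_add, Gr.lie_add, hx, hy, zero_add, add_zero, Gr.skew]
  | hof m g =>
    obtain ⟨g, hg⟩ := g
    show ⁅Γ.cl m g hg, Γ.cl m g hg⁆ = 0
    rw [lie_cl, Γ.cl_congr rfl (commutatorElement_self g) _ (one_mem _), cl_one]

theorem cl_jacobi {m n k : ℕ+} {x y z : G} (hx : x ∈ Γ m) (hy : y ∈ Γ n) (hz : z ∈ Γ k) :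
    ⁅⁅Γ.cl m x hx, Γ.cl n y hy⁆, Γ.cl k z hz⁆ + ⁅⁅Γ.cl n y hy, Γ.cl k z hz⁆, Γ.cl m x hx⁆ +
      ⁅⁅Γ.cl k z hz, Γ.cl m x hx⁆, Γ.cl n y hy⁆ = 0 := by
  have e1 := Γ.cl_conj hy hz (Γ.conj_mem hy hz)
  have e2 := Γ.cl_conj hz hx (Γ.conj_mem hz hx)
  have e3 := Γ.cl_conj hx hy (Γ.conj_mem hx hy)
  have f1 : ⁅⁅Γ.cl m x hx, Γ.cl n y hy⁆, Γ.cl k z hz⁆ = Γ.cl (m + n + k)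
      ⁅⁅x, y⁆, y * z * y⁻¹⁆ (Γ.commutator_mem (Γ.commutator_mem hx hy) (Γ.conj_mem hy hz)) := by
    rw [← e1, lie_cl, lie_cl]
  have h2 : ⁅⁅y, z⁆, z * x * z⁻¹⁆ ∈ Γ (m + n + k) := by
    have := Γ.commutator_mem (Γ.commutator_mem hy hz) (Γ.conj_mem hz hx)
    rwa [add_comm, ← add_assoc] at this
  have h3 : ⁅⁅z, x⁆, x * y * x⁻¹⁆ ∈ Γ (m + n + k) := by
    have := Γ.commutator_mem (Γ.commutator_mem hz hx) (Γ.conj_mem hx hy)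
    rwa [add_assoc, add_comm] at this
  have f2 : ⁅⁅Γ.cl n y hy, Γ.cl k z hz⁆, Γ.cl m x hx⁆ = Γ.cl (m + n + k)
      ⁅⁅y, z⁆, z * x * z⁻¹⁆ h2 := by
    rw [← e2, lie_cl, lie_cl]
    exact Γ.cl_congr (by rw [add_comm, ← add_assoc]) rfl _ _
  have f3 : ⁅⁅Γ.cl k z hz, Γ.cl m x hx⁆, Γ.cl n y hy⁆ = Γ.cl (m + n + k)
      ⁅⁅z, x⁆, x * y * x⁻¹⁆ h3 := by
    rw [← e3, lie_cl, lie_cl]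
    exact Γ.cl_congr (by rw [add_assoc, add_comm]) rfl _ _
  rw [f1, f2, f3, ← cl_mul, ← cl_mul,
    Γ.cl_congr rfl (commutatorElement_commutatorElement_conj_mul x y z) _ (one_mem _), cl_one]

theorem Gr.jacobi (x y z : Γ.Gr) : ⁅⁅x, y⁆, z⁆ + ⁅⁅y, z⁆, x⁆ + ⁅⁅z, x⁆, y⁆ = 0 := by
  induction x using Gr.ind with
  | h0 => simp only [Gr.zero_lie, Gr.lie_zero, add_zero]
  | hadd x x' hx hx' =>
    have : ∀ a b c d e f : Γ.Gr, a + b + c = 0 → d + e + f = 0 →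
        (a + d) + (b + e) + (c + f) = 0 := fun a b c d e f h h' => by
      rw [← add_zero (0 : Γ.Gr)]; nth_rewrite 1 [← h]; rw [← h']; abel
    simp only [Gr.add_lie, Gr.lie_add]
    exact this _ _ _ _ _ _ hx hx'
  | hof m g =>
    induction y using Gr.ind with
    | h0 => simp only [Gr.zero_lie, Gr.lie_zero, add_zero]
    | hadd y y' hy hy' =>
      have : ∀ a b c d e f : Γ.Gr, a + b + c = 0 → d + e + f = 0 →
          (a + d) + (b + e) + (c + f) = 0 := fun a b c d e f h h' => by
        rw [← add_zero (0 : Γ.Gr)]; nth_rewrite 1 [← h]; rw [← h']; abel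
      simp only [Gr.add_lie, Gr.lie_add]
      exact this _ _ _ _ _ _ hy hy'
    | hof n h =>
      induction z using Gr.ind with
      | h0 => simp only [Gr.zero_lie, Gr.lie_zero, add_zero]
      | hadd z z' hz hz' =>
        have : ∀ a b c d e f : Γ.Gr, a + b + c = 0 → d + e + f = 0 →
            (a + d) + (b + e) + (c + f) = 0 := fun a b c d e f h h' => by
          rw [← add_zero (0 : Γ.Gr)]; nth_rewrite 1 [← h]; rw [← h']; abel
        simp only [Gr.add_lie, Gr.lie_add]
        exact this _ _ _ _ _ _ hz hz'
      | hof k l => exact Γ.cl_jacobi g.2 h.2 l.2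

instance : LieRing Γ.Gr where
  add_lie := Gr.add_lie Γ
  lie_add := Gr.lie_add Γ
  lie_self := Gr.lie_self Γ
  leibniz_lie x y z := by
    have h := Gr.jacobi Γ x y z
    have n1 : ∀ a b : Γ.Gr, ⁅a, b⁆ = -⁅b, a⁆ := fun a b =>
      eq_neg_of_add_eq_zero_left (Gr.skew Γ a b)
    have n2 : ∀ a b c : Γ.Gr, ⁅⁅a, b⁆, c⁆ = -⁅⁅b, a⁆, c⁆ := fun a b c => by
      rw [eq_neg_iff_add_eq_zero, ← Gr.add_lie, Gr.skew, Gr.zero_lie]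
    rw [n1 x ⁅y, z⁆, n1 y ⁅x, z⁆, n2 x z y, neg_neg]
    rw [← sub_eq_zero] at h ⊢
    rw [← neg_eq_zero, ← h]
    abel

theorem lie_of_mk {m n : ℕ+} (g : Γ m) (h : Γ n) : ⁅Γ.of m (Piece.mk g), Γ.of n (Piece.mk h)⁆ =
    Γ.of (m + n) (Piece.mk ⟨⁅(g : G), (h : G)⁆, Γ.commutator_mem g.2 h.2⟩) :=
  Γ.of_lie_of _ _

end CentralSeries
end MagnusZassenhaus

namespace MagnusZassenhaus

open scoped commutatorElement DirectSum

noncomputable section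

/-- The prime `p` as a positive integer. -/
def primePNat (p : ℕ) [hp : Fact p.Prime] : ℕ+ := ⟨p, hp.out.pos⟩

theorem coe_primePNat (p : ℕ) [Fact p.Prime] : (primePNat p : ℕ) = p := rfl

/-! ### The associated graded algebra of a filtered algebra -/

/-- A descending multiplicative filtration of a ring. -/
structure AlgFiltration (A : Type*) [Ring A] where
  /-- The terms of the filtration. -/
  toFun : ℕ → AddSubgroup A
  mem_zero : ∀ x, x ∈ toFun 0
  succ_le : ∀ n, toFun (n + 1) ≤ toFun n
  mul_mem : ∀ {m n x y}, x ∈ toFun m → y ∈ toFun n → x * y ∈ toFun (m + n)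

namespace AlgFiltration

instance {A : Type*} [Ring A] : CoeFun (AlgFiltration A) fun _ => ℕ → AddSubgroup A := ⟨toFun⟩

open Polynomial

variable {A : Type*} [Ring A] (J : AlgFiltration A) (K : Type*) [CommRing K] [Algebra K A]

/-- The Rees algebra `⨁ J n X ^ n`. -/
def rees : Subalgebra K A[X] where
  carrier := {f | ∀ n, f.coeff n ∈ J n}
  add_mem' hf hg n := by rw [coeff_add]; exact add_mem (hf n) (hg n)
  mul_mem' hf hg n := by
    rw [coeff_mul]
    refine sum_mem fun i hi => ?_
    rw [← Finset.HasAntidiagonal.mem_antidiagonal.1 hi]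
    exact J.mul_mem (hf _) (hg _)
  algebraMap_mem' r n := by
    rw [Polynomial.algebraMap_apply, coeff_C]
    split_ifs with h
    · subst h; exact J.mem_zero _
    · exact zero_mem _

/-- The ideal `⨁ J (n + 1) X ^ n` of the Rees algebra. -/
def reesIdeal : Ideal (J.rees K) where
  carrier := {f | ∀ n, (f : A[X]).coeff n ∈ J (n + 1)}
  add_mem' hf hg n := by
    rw [Subalgebra.coe_add, coeff_add]; exact add_mem (hf n) (hg n)
  zero_mem' n := by rw [Subalgebra.coe_zero, coeff_zero]; exact zero_mem _
  smul_mem' f g hg n := by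
    rw [smul_eq_mul, Subalgebra.coe_mul, coeff_mul]
    refine sum_mem fun i hi => ?_
    rw [← Finset.HasAntidiagonal.mem_antidiagonal.1 hi, add_assoc]
    exact J.mul_mem (f.2 _) (hg _)

instance : (J.reesIdeal K).IsTwoSided where
  mul_mem_of_left {f} g hf n := by
    rw [Subalgebra.coe_mul, coeff_mul]
    refine sum_mem fun i hi => ?_
    rw [← Finset.HasAntidiagonal.mem_antidiagonal.1 hi, add_right_comm]
    exact J.mul_mem (hf _) (g.2 _)

/-- The associated graded algebra `⨁ J n / J (n + 1)`. -/
abbrev GrAlg : Type _ := J.rees K ⧸ J.reesIdeal K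

/-- The class of `x ∈ J n` in degree `n`. -/
def symb (n : ℕ) (x : A) (hx : x ∈ J n) : J.GrAlg K :=
  Ideal.Quotient.mk _ ⟨monomial n x, fun m => by
    rw [coeff_monomial]
    split_ifs with h
    · rwa [← h]
    · exact zero_mem _⟩

theorem symb_add {n : ℕ} {x y : A} (hx : x ∈ J n) (hy : y ∈ J n) :
    J.symb K n (x + y) (add_mem hx hy) = J.symb K n x hx + J.symb K n y hy := by
  rw [symb, symb, symb, ← map_add]
  congr 1
  exact Subtype.ext (map_add (monomial n) x y)

theorem symb_mul {m n : ℕ} {x y : A} (hx : x ∈ J m) (hy : y ∈ J n) :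
    J.symb K m x hx * J.symb K n y hy = J.symb K (m + n) (x * y) (J.mul_mem hx hy) := by
  rw [symb, symb, symb, ← map_mul]
  congr 1
  exact Subtype.ext (monomial_mul_monomial m n x y)

theorem symb_congr {m n : ℕ} {x y : A} (h : m = n) (hx : x ∈ J m) (hy : y ∈ J n)
    (hxy : x - y ∈ J (n + 1)) : J.symb K m x hx = J.symb K n y hy := by
  subst h
  refine Ideal.Quotient.eq.2 fun k => ?_
  rw [Subalgebra.coe_sub, ← map_sub, coeff_monomial]
  split_ifs with h
  · rwa [← h]
  · exact zero_mem _

theorem symb_pow {m : ℕ} {x : A} (hx : x ∈ J m) (k : ℕ) (hk : x ^ k ∈ J (k * m)) :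
    J.symb K m x hx ^ k = J.symb K (k * m) (x ^ k) hk := by
  rw [symb, symb, ← map_pow]
  congr 1
  exact Subtype.ext ((monomial_pow m x k).trans (by rw [mul_comm]))

theorem pow_mem {m : ℕ} {x : A} (hx : x ∈ J m) (k : ℕ) : x ^ k ∈ J (k * m) := by
  induction k with
  | zero => rw [zero_mul]; exact J.mem_zero _
  | succ k ih => rw [pow_succ, Nat.succ_mul]; exact J.mul_mem ih hx

/-- The coefficient of degree `n`, in `A / J (n + 1)`. -/
def coeffHom (n : ℕ) : J.GrAlg K →+ A ⧸ J (n + 1) :=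
  QuotientAddGroup.lift (J.reesIdeal K).toAddSubgroup
    (((QuotientAddGroup.mk' (J (n + 1))).comp (lcoeff A n).toAddMonoidHom).comp
      (J.rees K).val.toRingHom.toAddMonoidHom)
    (fun _ hf => (QuotientAddGroup.eq_zero_iff _).2 (hf n))

theorem coeffHom_symb (n m : ℕ) (x : A) (hx : x ∈ J m) :
    J.coeffHom K n (J.symb K m x hx) = if m = n then (x : A ⧸ J (n + 1)) else 0 := by
  show ((QuotientAddGroup.mk' (J (n + 1))) ((monomial m x).coeff n)) = _
  rw [coeff_monomial]
  split_ifs <;> rfl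

end AlgFiltration

/-! ### Graded Lie rings of series defined by a filtered algebra -/

namespace CentralSeries

/-- The series `Γ` consists of the elements of `G` that are congruent to `1` modulo the terms of a
filtration of an algebra. -/
structure IsInduced {G A : Type*} [Group G] [Ring A] (Γ : CentralSeries G) (J : AlgFiltration A)
    (u : G →* A) : Prop where
  mem_iff : ∀ (n : ℕ+) (g : G), g ∈ Γ n ↔ u g - 1 ∈ J n

variable {G A : Type*} [Group G] [Ring A] {Γ : CentralSeries G} {J : AlgFiltration A}
    {u : G →* A}

section

variable (h : Γ.IsInduced J u) (K : Type*) [CommRing K] [Algebra K A]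

/-- The map `g Γ (n + 1) ↦ (g - 1) + J (n + 1)` in degree `n`. -/
def symbHom (n : ℕ+) : Γ.Piece n →+ J.GrAlg K :=
  Piece.lift (fun g => J.symb K n (u g - 1) ((h.mem_iff n g).1 g.2))
    (fun g g' => by
      rw [← J.symb_add]
      have e1 := (h.mem_iff n g).1 g.2
      have e2 := (h.mem_iff n g').1 g'.2
      refine J.symb_congr K rfl _ _ ?_
      have e : u (g * g' : Γ n) - 1 - ((u g - 1) + (u g' - 1)) = (u g - 1) * (u g' - 1) := by
        rw [Subgroup.coe_mul, map_mul]; noncomm_ring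
      rw [e]
      have e3 := J.mul_mem e1 e2
      have : ∀ k, J ((n : ℕ) + 1 + k) ≤ J ((n : ℕ) + 1) := fun k => by
        induction k with
        | zero => exact le_rfl
        | succ k ih => exact (J.succ_le _).trans ih
      have e4 := this ((n : ℕ) - 1)
      have e5 : (n : ℕ) + 1 + (n - 1) = n + n := by have := n.pos; omega
      rw [e5] at e4
      exact e4 e3)
    (fun g hg => by
      have e := J.symb_congr K (rfl : (n : ℕ) = n) ((h.mem_iff n g).1 g.2) (zero_mem _)
        (by rw [sub_zero]; exact (h.mem_iff (n + 1) g).1 hg)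
      rw [e]
      have e2 := J.symb_add K (n := n) (zero_mem _) (zero_mem _)
      simpa using e2)

/-- The embedding of `⨁ Γ n / Γ (n + 1)` into `⨁ J n / J (n + 1)`. -/
def embHom : Γ.Gr →+ J.GrAlg K := Gr.lift Γ (symbHom h K)

theorem embHom_of (n : ℕ+) (g : Γ n) : embHom h K (Γ.of n (Piece.mk g)) =
    J.symb K n (u g - 1) ((h.mem_iff n g).1 g.2) :=
  Gr.lift_of Γ _ n _

theorem embHom_injective : Function.Injective (embHom h K) := by
  rw [injective_iff_map_eq_zero]
  intro x hx
  refine DFinsupp.ext fun n => ?_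
  -- the coefficient in degree `n`
  let e : Γ.Piece n →+ A ⧸ J ((n : ℕ) + 1) := (J.coeffHom K n).comp (symbHom h K n)
  have he : ∀ y, e y = 0 → y = 0 := by
    intro y hy
    induction y using Piece.ind with | _ g
    have : (J.coeffHom K n) (J.symb K n (u g - 1) ((h.mem_iff n g).1 g.2)) = 0 := hy
    rw [J.coeffHom_symb, if_pos rfl, QuotientAddGroup.eq_zero_iff] at this
    exact (Piece.mk_eq_zero Γ).2 ((h.mem_iff (n + 1) g).2 this)
  have key : (J.coeffHom K n).comp (embHom h K) =
      e.comp (DFinsupp.evalAddMonoidHom n : (⨁ n : ℕ+, Γ.Piece n) →+ Γ.Piece n) := by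
    refine Gr.addHom_ext fun m g => ?_
    have h1 : (J.coeffHom K n).comp (embHom h K) (Γ.of m (Piece.mk g)) =
        J.coeffHom K n (symbHom h K m (Piece.mk g)) :=
      congrArg (J.coeffHom K n) (Gr.lift_of Γ _ m _)
    refine h1.trans ?_
    show _ = e ((DirectSum.of Γ.Piece m (Piece.mk g)) n)
    by_cases hmn : m = n
    · subst hmn
      rw [DirectSum.of_eq_same]
      rfl
    · rw [DirectSum.of_eq_of_ne _ _ _ (Ne.symm hmn), map_zero]
      refine (J.coeffHom_symb K n m _ ((h.mem_iff m g).1 g.2)).trans (if_neg fun h => hmn (PNat.coe_injective h))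
  refine he _ ?_
  have := DFunLike.congr_fun key x
  rw [AddMonoidHom.comp_apply, hx, map_zero] at this
  exact this.symm

theorem sub_one_pow_prime (p : ℕ) [Fact p.Prime] [CharP A p] (g : G) :
    (u g - 1) ^ p = u (g ^ p) - 1 := by
  rw [sub_pow_char_of_commute p (Commute.one_right (u g)), one_pow, map_pow]

theorem IsInduced.pow_mem (h : Γ.IsInduced J u) (p : ℕ) [hp : Fact p.Prime] [CharP A p] {n : ℕ+}
    {g : G} (hg : g ∈ Γ n) : g ^ p ∈ Γ (primePNat p * n) := by
  rw [h.mem_iff, ← sub_one_pow_prime p]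
  exact J.pow_mem ((h.mem_iff n g).1 hg) p

section

attribute [local instance] LieRing.ofAssociativeRing

theorem embHom_lie (x y : Γ.Gr) : embHom h K ⁅x, y⁆ = ⁅embHom h K x, embHom h K y⁆ := by
  induction x using Gr.ind with
  | h0 => rw [Gr.zero_lie, map_zero, zero_lie]
  | hadd x x' hx hx' => rw [Gr.add_lie, map_add, map_add, add_lie, hx, hx']
  | hof m g =>
    induction y using Gr.ind with
    | h0 => rw [Gr.lie_zero, map_zero, lie_zero]
    | hadd y y' hy hy' => rw [Gr.lie_add, map_add, map_add, lie_add, hy, hy']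
    | hof n g' =>
      have e1 := (h.mem_iff m g).1 g.2
      have e2 := (h.mem_iff n g').1 g'.2
      have e3 := (h.mem_iff _ _).1 (Γ.commutator_mem g.2 g'.2)
      have e4 := J.mul_mem e2 e1
      rw [add_comm] at e4
      rw [lie_of_mk, embHom_of, embHom_of, embHom_of, LieRing.of_associative_ring_bracket,
        eq_sub_iff_add_eq, J.symb_mul, J.symb_mul,
        J.symb_congr K (add_comm (n : ℕ) m) (J.mul_mem e2 e1) e4 (by rw [sub_self]; exact zero_mem _)]
      refine (J.symb_add K e3 e4).symm.trans (J.symb_congr K rfl _ _ ?_)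
      have e5 : u ⁅(g : G), (g' : G)⁆ * (u g' * u g) = u g * u g' := by
        rw [← map_mul, ← map_mul, ← map_mul]
        congr 1
        simp [commutatorElement_def]
      have e6 : u ⁅(g : G), (g' : G)⁆ - 1 + (u g' - 1) * (u g - 1) - (u g - 1) * (u g' - 1) =
          - ((u ⁅(g : G), (g' : G)⁆ - 1) * (u (g' * g) - 1)) := by
        have e7 : ∀ a b c : A, (c - 1) * (b * a - 1) = c * (b * a) - c - b * a + 1 := by
          intro a b c; noncomm_ring
        rw [map_mul, e7, e5]
        noncomm_ring
      rw [e6]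
      refine neg_mem (J.mul_mem e3 ((h.mem_iff 1 _).1 ?_))
      rw [Γ.one_eq_top]
      exact Subgroup.mem_top _

end

theorem embHom_pow (p : ℕ) [hp : Fact p.Prime] [CharP A p] {n : ℕ+} (g : Γ n) :
    embHom h K (Γ.of n (Piece.mk g)) ^ p =
      embHom h K (Γ.of (primePNat p * n) (Piece.mk ⟨(g : G) ^ p, h.pow_mem p g.2⟩)) := by
  have e := J.pow_mem ((h.mem_iff n g).1 g.2) p
  rw [embHom_of, embHom_of, J.symb_pow K _ _ e]
  refine J.symb_congr K rfl _ _ ?_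
  rw [sub_one_pow_prime p, sub_self]
  exact zero_mem _

end

section Restricted

theorem IsInduced.nsmul_eq_zero {Γ : CentralSeries G} (h : Γ.IsInduced J u) (p : ℕ)
    [hp : Fact p.Prime] [CharP A p] (x : Γ.Gr) : p • x = 0 := by
  induction x using Gr.ind with
  | h0 => rw [smul_zero]
  | hadd x y hx hy => rw [smul_add, hx, hy, add_zero]
  | hof n g =>
    have : ∀ k : ℕ, k • (Piece.mk g : Γ.Piece n) = Piece.mk (g ^ k) := fun k => by
      induction k with
      | zero => rw [zero_smul, pow_zero]; rfl
      | succ k ih => rw [succ_nsmul, ih, pow_succ, Piece.mk_mul]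
    rw [← map_nsmul, this, (Piece.mk_eq_zero Γ).2, map_zero]
    refine Γ.antitone ?_ (h.pow_mem p g.2)
    have h2 := hp.out.two_le
    have h3 := n.pos
    rw [← PNat.coe_le_coe, PNat.mul_coe, PNat.add_coe, coe_primePNat, PNat.one_coe]
    nlinarith

/-- The `𝔽_p`-vector space structure of `Gr`. -/
@[reducible]
def IsInduced.module (h : Γ.IsInduced J u) (p : ℕ) [Fact p.Prime] [CharP A p] :
    Module (ZMod p) Γ.Gr := AddCommGroup.zmodModule (h.nsmul_eq_zero p)

attribute [local instance] LieRing.ofAssociativeRing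

/-- The `𝔽_p`-Lie algebra structure of `Gr`. -/
@[reducible]
def lieAlgebraOfModule (p : ℕ) [Module (ZMod p) Γ.Gr] : LieAlgebra (ZMod p) Γ.Gr where
  lie_smul c x y := ZMod.map_smul (Γ.lieHom x) c y

variable (h : Γ.IsInduced J u) (p : ℕ) [hp : Fact p.Prime] [CharP A p] [Algebra (ZMod p) A]
  [LieAlgebra (ZMod p) Γ.Gr]

theorem IsInduced.exists_pow (x : Γ.Gr) :
    ∃ y, embHom h (ZMod p) y = embHom h (ZMod p) x ^ p := by
  induction x using Gr.ind with
  | h0 => exact ⟨0, by rw [map_zero, zero_pow hp.out.ne_zero]⟩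
  | hof n g => exact ⟨_, (embHom_pow h (ZMod p) p g).symm⟩
  | hadd x y hx hy =>
    obtain ⟨x', hx⟩ := hx
    obtain ⟨y', hy⟩ := hy
    refine ⟨x' + y' + ∑ k ∈ Finset.Icc 1 (p - 1), (k : ZMod p)⁻¹ • jacobsonS p k x y, ?_⟩
    rw [map_add, map_add, map_add (embHom h (ZMod p)) x y, add_pow_prime p (ZMod p), hx, hy, map_sum]
    refine congrArg _ (Finset.sum_congr rfl fun k _ => ?_)
    rw [ZMod.map_smul]
    exact congrArg _ (lieCoeff_map (embHom h (ZMod p)) (embHom_lie h (ZMod p)) x y _ _)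

/-- The restricted `𝔽_p`-Lie algebra structure of `Gr`: the `p`-map is the restriction of the
`p`-th power map of `⨁ J n / J (n + 1)`. -/
@[reducible]
def IsInduced.restricted :
    RestrictedLieAlgebra p (ZMod p) Γ.Gr :=
  RestrictedLieAlgebra.ofInjective p (ZMod p)
    { (embHom h (ZMod p)).toZModLinearMap p with map_lie' := embHom_lie h (ZMod p) _ _ }
    (embHom_injective h (ZMod p)) (fun x => (h.exists_pow p x).choose)
    (fun x => (h.exists_pow p x).choose_spec)

end Restricted

end CentralSeries

end
end MagnusZassenhaus

namespace MagnusZassenhaus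

open scoped commutatorElement DirectSum TensorProduct

noncomputable section

/-! ### Maps of associated graded Lie rings -/

namespace CentralSeries

variable {G H : Type*} [Group G] [Group H] (Γ : CentralSeries G) (Δ : CentralSeries H)

/-- The map `Γ n / Γ (n + 1) → Δ n / Δ (n + 1)` induced by a homomorphism of groups. -/
def pieceMap (f : G →* H) (hf : ∀ n, ∀ g ∈ Γ n, f g ∈ Δ n) (n : ℕ+) : Γ.Piece n →+ Δ.Piece n :=
  Piece.lift (fun g => Piece.mk ⟨f g, hf n g g.2⟩)
    (fun g h => by
      rw [← Piece.mk_mul]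
      exact congrArg _ (Subtype.ext (map_mul f _ _)))
    (fun g hg => (Piece.mk_eq_zero Δ).2 (hf _ _ hg))

/-- The homomorphism of graded Lie rings `g Γ (n + 1) ↦ f(g) Δ (n + 1)` induced by a homomorphism
of groups `f`. -/
def grMap (f : G →* H) (hf : ∀ n, ∀ g ∈ Γ n, f g ∈ Δ n) : Γ.Gr →ₗ⁅ℤ⁆ Δ.Gr :=
  let φ : Γ.Gr →+ Δ.Gr := Gr.lift Γ fun n => (Δ.of n).comp (pieceMap Γ Δ f hf n)
  have hφ : ∀ (n : ℕ+) (g : Γ n), φ (Γ.of n (Piece.mk g)) = Δ.of n (Piece.mk ⟨f g, hf n g g.2⟩) :=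
    fun n _ => Gr.lift_of Γ _ n _
  { φ.toIntLinearMap with
    map_lie' := by
      intro x y
      show φ ⁅x, y⁆ = ⁅φ x, φ y⁆
      induction x using Gr.ind with
      | h0 => rw [zero_lie, map_zero, zero_lie]
      | hadd x x' hx hx' => rw [add_lie, map_add, map_add, add_lie, hx, hx']
      | hof m g =>
        induction y using Gr.ind with
        | h0 => rw [lie_zero, map_zero, lie_zero]
        | hadd y y' hy hy' => rw [lie_add, map_add, map_add, lie_add, hy, hy']
        | hof n g' =>
          rw [lie_of_mk, hφ, hφ, hφ, lie_of_mk]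
          exact congrArg _ (congrArg _ (Subtype.ext (map_commutatorElement f _ _))) }

theorem grMap_of (f : G →* H) (hf : ∀ n, ∀ g ∈ Γ n, f g ∈ Δ n) (n : ℕ+) (g : Γ n) :
    grMap Γ Δ f hf (Γ.of n (Piece.mk g)) = Δ.of n (Piece.mk ⟨f g, hf n g g.2⟩) :=
  Gr.lift_of Γ _ n _

end CentralSeries

/-! ### The lower central series and the Magnus Lie ring -/

section LowerCentralSeries

variable (G : Type*) [Group G] [TopologicalSpace G] [IsTopologicalGroup G]

/-- The lower central series in the category of topological groups, indexed from `0`: every term is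
the closure of the commutator subgroup of the previous term and `G`. -/
def closedLowerCentralSeries : ℕ → Subgroup G
  | 0 => ⊤
  | n + 1 => (⁅closedLowerCentralSeries n, (⊤ : Subgroup G)⁆).topologicalClosure

/-- For discrete groups this is the usual lower central series. -/
theorem closedLowerCentralSeries_eq [DiscreteTopology G] (n : ℕ) :
    closedLowerCentralSeries G n = (⊤ : Subgroup G).lowerCentralSeries n := by
  induction n with
  | zero => rfl
  | succ n ih =>
    rw [closedLowerCentralSeries, ih, Subgroup.lowerCentralSeries_succ]
    exact SetLike.coe_injective (closure_discrete _)

instance closedLowerCentralSeries_normal (n : ℕ) : (closedLowerCentralSeries G n).Normal := by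
  induction n with
  | zero => exact inferInstanceAs (⊤ : Subgroup G).Normal
  | succ n ih => exact Subgroup.is_normal_topologicalClosure _

variable {G}

theorem commutator_commutator_le {Q : Type*} [Group Q] {A B C N : Subgroup Q} [N.Normal] (h1 : ⁅⁅B, C⁆, A⁆ ≤ N)
    (h2 : ⁅⁅C, A⁆, B⁆ ≤ N) : ⁅⁅A, B⁆, C⁆ ≤ N := by
  have key : ∀ X : Subgroup Q, X ≤ N ↔ X.map (QuotientGroup.mk' N) = ⊥ := fun X => by
    rw [Subgroup.map_eq_bot_iff, QuotientGroup.ker_mk']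
  rw [key, Subgroup.map_commutator, Subgroup.map_commutator] at *
  exact Subgroup.commutator_commutator_eq_bot_of_rotate h1 h2

theorem closedLowerCentralSeries_commutator (m n : ℕ) :
    ⁅closedLowerCentralSeries G n, closedLowerCentralSeries G m⁆ ≤
      closedLowerCentralSeries G (m + n + 1) := by
  induction n generalizing m with
  | zero =>
    rw [Subgroup.commutator_comm]
    exact Subgroup.le_topologicalClosure _
  | succ n ih =>
    have hN : IsClosed (closedLowerCentralSeries G (m + (n + 1) + 1) : Set G) :=
      Subgroup.isClosed_topologicalClosure _
    have h0 : ⁅⁅closedLowerCentralSeries G n, (⊤ : Subgroup G)⁆, closedLowerCentralSeries G m⁆ ≤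
        closedLowerCentralSeries G (m + (n + 1) + 1) := by
      refine commutator_commutator_le ?_ ?_
      · rw [Subgroup.commutator_comm]
        refine (Subgroup.commutator_mono le_rfl ?_).trans
          ((ih (m + 1)).trans (le_of_eq (by congr 1; omega)))
        rw [Subgroup.commutator_comm]
        exact Subgroup.le_topologicalClosure _
      · refine (Subgroup.commutator_mono ?_ le_rfl).trans (Subgroup.le_topologicalClosure _)
        rw [Subgroup.commutator_comm]
        exact (ih m)
    rw [Subgroup.commutator_le]
    intro x hx y hy
    have hc : Continuous fun z : G => ⁅z, y⁆ := by
      simp only [commutatorElement_def]; fun_prop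
    have h1 : ((⁅closedLowerCentralSeries G n, (⊤ : Subgroup G)⁆ : Subgroup G) : Set G) ⊆
        (fun z : G => ⁅z, y⁆) ⁻¹' (closedLowerCentralSeries G (m + (n + 1) + 1) : Set G) :=
      fun z hz => h0 (Subgroup.commutator_mem_commutator hz hy)
    exact closure_minimal h1 (hN.preimage hc) hx

variable (G)

/-- The lower central series `γ_1(G) = G`, `γ_{n+1}(G) = closure of [γ_n(G), G]`. -/
def gammaSeries : CentralSeries G where
  toFun n := closedLowerCentralSeries G n.natPred
  one_eq_top := rfl
  succ_le n := by
    have : (n + 1).natPred = n.natPred + 1 := by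
      have := PNat.natPred_add_one n; have := PNat.natPred_add_one (n + 1)
      rw [PNat.add_coe, PNat.one_coe] at this; omega
    rw [this]
    refine Subgroup.topologicalClosure_minimal _ (Subgroup.commutator_le_left _ _) ?_
    cases n.natPred with
    | zero => exact isClosed_univ
    | succ k => exact Subgroup.isClosed_topologicalClosure _
  commutator_mem {m n g h} hg hh := by
    have : (m + n).natPred = n.natPred + m.natPred + 1 := by
      have := PNat.natPred_add_one n; have := PNat.natPred_add_one m
      have := PNat.natPred_add_one (m + n)
      rw [PNat.add_coe] at this; omega
    rw [this]
    exact closedLowerCentralSeries_commutator _ _ (Subgroup.commutator_mem_commutator hg hh)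

variable {G}

theorem map_mem_gammaSeries {H : Type*} [Group H] [TopologicalSpace H] [IsTopologicalGroup H]
    (f : G →ₜ* H) (n : ℕ+) (g : G) (hg : g ∈ gammaSeries G n) :
    (f : G →* H) g ∈ gammaSeries H n := by
  have key : ∀ n : ℕ, closedLowerCentralSeries G n ≤
      (closedLowerCentralSeries H n).comap (f : G →* H) := by
    intro n
    induction n with
    | zero => exact fun _ _ => Subgroup.mem_top _
    | succ n ih =>
      refine Subgroup.topologicalClosure_minimal _ ?_ ?_
      · rw [← Subgroup.map_le_iff_le_comap, Subgroup.map_commutator]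
        refine (Subgroup.commutator_mono (Subgroup.map_le_iff_le_comap.2 ih) le_top).trans
          (Subgroup.le_topologicalClosure _)
      · exact (Subgroup.isClosed_topologicalClosure _).preimage f.continuous_toFun
  exact key _ hg

end LowerCentralSeries

/-! ### Dimension subgroups and the Zassenhaus restricted Lie algebra -/

section Dimension

/-- The augmentation `R[G] → R`. -/
def augmentation (R G : Type*) [CommRing R] [Group G] : MonoidAlgebra R G →ₐ[R] R :=
  MonoidAlgebra.lift R R G 1

/-- The augmentation ideal of `R[G]`. -/
def augmentationIdeal (R G : Type*) [CommRing R] [Group G] : Ideal (MonoidAlgebra R G) :=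
  RingHom.ker (augmentation R G)

instance (R G : Type*) [CommRing R] [Group G] : (augmentationIdeal R G).IsTwoSided :=
  inferInstanceAs (RingHom.ker (augmentation R G)).IsTwoSided

/-- The `n`-th dimension subgroup `{g ∈ G | 1 - g ∈ ω^n}` of `G` over `R`, where `ω` is the
augmentation ideal. -/
def dimensionSubgroup (R G : Type*) [CommRing R] [Group G] (n : ℕ) : Subgroup G where
  carrier := {g | 1 - MonoidAlgebra.of R G g ∈ augmentationIdeal R G ^ n}
  one_mem' := by
    show 1 - MonoidAlgebra.of R G 1 ∈ augmentationIdeal R G ^ n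
    rw [map_one, sub_self]; exact zero_mem _
  mul_mem' {g h} hg hh := by
    have e : 1 - MonoidAlgebra.of R G (g * h) =
        (1 - MonoidAlgebra.of R G g) + MonoidAlgebra.of R G g * (1 - MonoidAlgebra.of R G h) := by
      rw [map_mul]; noncomm_ring
    show 1 - MonoidAlgebra.of R G (g * h) ∈ augmentationIdeal R G ^ n
    rw [e]
    exact add_mem hg (Ideal.mul_mem_left _ _ hh)
  inv_mem' {g} hg := by
    have e : 1 - MonoidAlgebra.of R G g⁻¹ =
        -(MonoidAlgebra.of R G g⁻¹ * (1 - MonoidAlgebra.of R G g)) := by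
      rw [mul_sub, mul_one, ← map_mul, inv_mul_cancel, map_one]; noncomm_ring
    show 1 - MonoidAlgebra.of R G g⁻¹ ∈ augmentationIdeal R G ^ n
    rw [e]
    exact neg_mem (Ideal.mul_mem_left _ _ hg)

theorem map_augmentationIdeal_pow (R : Type*) [CommRing R] {G H : Type*} [Group G] [Group H]
    (f : G →* H) (n : ℕ) : augmentationIdeal R G ^ n ≤
      (augmentationIdeal R H ^ n).comap (MonoidAlgebra.mapDomainRingHom R f) := by
  have h1 : augmentationIdeal R G ≤
      (augmentationIdeal R H).comap (MonoidAlgebra.mapDomainRingHom R f) := by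
    intro x hx
    have e : (augmentation R H).comp (MonoidAlgebra.mapDomainAlgHom R R f) = augmentation R G := by
      ext
      simp [augmentation]
    exact (DFunLike.congr_fun e x).trans hx
  induction n with
  | zero =>
    rw [Submodule.pow_zero, Submodule.pow_zero, Ideal.one_eq_top, Ideal.one_eq_top,
      Ideal.comap_top]
  | succ n ih =>
    rw [Submodule.pow_succ, Submodule.pow_succ]
    refine Ideal.mul_le.2 fun x hx y hy => ?_
    rw [Ideal.mem_comap, map_mul]
    exact Ideal.mul_mem_mul (ih hx) (h1 hy)

theorem map_mem_dimensionSubgroup (R : Type*) [CommRing R] {G H : Type*} [Group G] [Group H]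
    (f : G →* H) (n : ℕ) {g : G} (hg : g ∈ dimensionSubgroup R G n) :
    f g ∈ dimensionSubgroup R H n := by
  have := map_augmentationIdeal_pow R f n hg
  rw [Ideal.mem_comap, map_sub, map_one] at this
  have e : MonoidAlgebra.mapDomainRingHom R f (MonoidAlgebra.of R G g) =
      MonoidAlgebra.of R H (f g) := by simp
  rwa [e] at this

variable (p : ℕ) (G : Type*) [Group G] [TopologicalSpace G]

/-- The elements of `𝔽_p[G]` whose images in `𝔽_p[G/U]` lie in the `n`-th power of the augmentation
ideal, for all open normal subgroups `U` of `G`. -/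
def closedAugmentation : AlgFiltration (MonoidAlgebra (ZMod p) G) where
  toFun n := ⨅ U : OpenNormalSubgroup G, ((augmentationIdeal (ZMod p) (G ⧸ U.toSubgroup) ^ n).comap
    (MonoidAlgebra.mapDomainRingHom (ZMod p) (QuotientGroup.mk' U.toSubgroup))).toAddSubgroup
  mem_zero x := by
    simp [Submodule.pow_zero, Ideal.one_eq_top]
  succ_le n := iInf_mono fun U => by
    rw [Submodule.toAddSubgroup_le]
    exact Ideal.comap_mono (Ideal.pow_le_pow_right n.le_succ)
  mul_mem {m n x y} hx hy := by
    rw [AddSubgroup.mem_iInf] at *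
    intro U
    have h1 : _ ∈ augmentationIdeal (ZMod p) (G ⧸ U.toSubgroup) ^ m := hx U
    have h2 : _ ∈ augmentationIdeal (ZMod p) (G ⧸ U.toSubgroup) ^ n := hy U
    show MonoidAlgebra.mapDomainRingHom (ZMod p) (QuotientGroup.mk' U.toSubgroup) (x * y) ∈
      augmentationIdeal (ZMod p) (G ⧸ U.toSubgroup) ^ (m + n)
    rw [map_mul, Ideal.IsTwoSided.pow_add]
    exact Ideal.mul_mem_mul h1 h2

/-- The subgroup of the elements of `G` whose images in `G/U` lie in the `n`-th dimension subgroup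
over `𝔽_p` for all open normal subgroups `U`. -/
def closedDimensionSubgroup (n : ℕ) : Subgroup G :=
  ⨅ U : OpenNormalSubgroup G,
    (dimensionSubgroup (ZMod p) (G ⧸ U.toSubgroup) n).comap (QuotientGroup.mk' U.toSubgroup)

theorem mem_closedDimensionSubgroup {n : ℕ} {g : G} : g ∈ closedDimensionSubgroup p G n ↔
    ∀ U : OpenNormalSubgroup G, (QuotientGroup.mk g : G ⧸ U.toSubgroup) ∈
      dimensionSubgroup (ZMod p) (G ⧸ U.toSubgroup) n := by
  rw [closedDimensionSubgroup, Subgroup.mem_iInf]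
  rfl

/-- For discrete groups this is the usual dimension subgroup. -/
theorem closedDimensionSubgroup_eq [DiscreteTopology G] (n : ℕ) :
    closedDimensionSubgroup p G n = dimensionSubgroup (ZMod p) G n := by
  ext g
  rw [mem_closedDimensionSubgroup]
  constructor
  · intro h
    let U : OpenNormalSubgroup G :=
      { toSubgroup := ⊥, isOpen' := isOpen_discrete _, isNormal' := inferInstance }
    have := map_mem_dimensionSubgroup (ZMod p)
      (QuotientGroup.quotientBot (G := G)).toMonoidHom n (h U)
    exact this
  · exact fun h U => map_mem_dimensionSubgroup (ZMod p) (QuotientGroup.mk' U.toSubgroup) n h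

theorem mem_closedDimensionSubgroup_iff {n : ℕ} {g : G} : g ∈ closedDimensionSubgroup p G n ↔
    MonoidAlgebra.of (ZMod p) G g - 1 ∈ closedAugmentation p G n := by
  rw [mem_closedDimensionSubgroup]
  refine Iff.trans (forall_congr' fun U => ?_) AddSubgroup.mem_iInf.symm
  have e : MonoidAlgebra.mapDomainRingHom (ZMod p) (QuotientGroup.mk' U.toSubgroup)
      (MonoidAlgebra.of (ZMod p) G g - 1) =
      -(1 - MonoidAlgebra.of (ZMod p) (G ⧸ U.toSubgroup) (QuotientGroup.mk g)) := by
    rw [map_sub, map_one, neg_sub]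
    simp
  show _ ↔ MonoidAlgebra.mapDomainRingHom (ZMod p) (QuotientGroup.mk' U.toSubgroup)
      (MonoidAlgebra.of (ZMod p) G g - 1) ∈ augmentationIdeal (ZMod p) (G ⧸ U.toSubgroup) ^ n
  rw [e, neg_mem_iff]
  rfl

variable [hp : Fact p.Prime]

instance : CharP (MonoidAlgebra (ZMod p) G) p :=
  charP_of_injective_algebraMap (algebraMap (ZMod p) (MonoidAlgebra (ZMod p) G)).injective p

/-- The `p`-Zassenhaus series `D_n(G)`, `n ≥ 1`. -/
def zassenhausSeries : CentralSeries G where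
  toFun n := closedDimensionSubgroup p G n
  one_eq_top := by
    refine eq_top_iff.2 fun g _ => (mem_closedDimensionSubgroup p G).2 fun U => ?_
    show 1 - MonoidAlgebra.of (ZMod p) (G ⧸ U.toSubgroup) (QuotientGroup.mk g) ∈
      augmentationIdeal (ZMod p) (G ⧸ U.toSubgroup) ^ 1
    rw [Submodule.pow_one]
    show augmentation _ _ _ = 0
    rw [map_sub, map_one]
    simp [augmentation]
  succ_le n g hg := by
    rw [mem_closedDimensionSubgroup_iff] at *
    exact (closedAugmentation p G).succ_le _ hg
  commutator_mem {m n g h} hg hh := by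
    rw [mem_closedDimensionSubgroup_iff] at *
    have hJ := closedAugmentation p G
    set u := MonoidAlgebra.of (ZMod p) G
    have e5 : u ⁅g, h⁆ - 1 = ((u g - 1) * (u h - 1) - (u h - 1) * (u g - 1)) * u (h * g)⁻¹ := by
      have e1 : (u g - 1) * (u h - 1) - (u h - 1) * (u g - 1) = u (g * h) - u (h * g) := by
        rw [map_mul, map_mul]; noncomm_ring
      rw [e1, sub_mul, ← map_mul, ← map_mul, mul_inv_cancel, map_one, mul_inv_rev,
        commutatorElement_def, ← mul_assoc]
    have e6 := (closedAugmentation p G).mul_mem hh hg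
    rw [add_comm] at e6
    have e7 := (closedAugmentation p G).mul_mem
      (sub_mem ((closedAugmentation p G).mul_mem hg hh) e6)
      ((closedAugmentation p G).mem_zero (u (h * g)⁻¹))
    rw [e5]
    exact e7

theorem zassenhausSeries_isInduced : (zassenhausSeries p G).IsInduced (closedAugmentation p G)
    (MonoidAlgebra.of (ZMod p) G) :=
  ⟨fun _ _ => mem_closedDimensionSubgroup_iff p G⟩

/-- The graded Lie algebra `gr^{Z,p}(G) = ⨁ n, D_n(G) / D_{n+1}(G)`. -/
abbrev GrZ : Type _ := (zassenhausSeries p G).Gr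

instance : Module (ZMod p) (GrZ p G) := (zassenhausSeries_isInduced p G).module p

instance : LieAlgebra (ZMod p) (GrZ p G) := CentralSeries.lieAlgebraOfModule p

/-- The `p`-map of `gr^{Z,p}(G)` is the restriction of the `p`-th power map of the graded algebra of
the group algebra. On homogeneous elements it is induced by the `p`-th power map of `G`. -/
instance : RestrictedLieAlgebra p (ZMod p) (GrZ p G) :=
  (zassenhausSeries_isInduced p G).restricted p

theorem pow_mem_zassenhausSeries {n : ℕ+} {g : G} (hg : g ∈ zassenhausSeries p G n) :
    g ^ p ∈ zassenhausSeries p G (primePNat p * n) :=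
  (zassenhausSeries_isInduced p G).pow_mem p hg

/-- The `p`-map sends `g D_{n+1}(G)` to `g ^ p D_{pn+1}(G)`. -/
theorem pPow_of (n : ℕ+) (g : zassenhausSeries p G n) :
    pPow p (ZMod p) ((zassenhausSeries p G).of n (CentralSeries.Piece.mk g)) =
      (zassenhausSeries p G).of (primePNat p * n)
        (CentralSeries.Piece.mk ⟨(g : G) ^ p, pow_mem_zassenhausSeries p G g.2⟩) := by
  have h := zassenhausSeries_isInduced p G
  refine CentralSeries.embHom_injective h (ZMod p) ?_
  rw [← CentralSeries.embHom_pow h (ZMod p) p g]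
  exact (h.exists_pow p _).choose_spec

variable {G}

theorem map_mem_zassenhausSeries {H : Type*} [Group H] [TopologicalSpace H]
    (f : G →ₜ* H) (n : ℕ+) (g : G) (hg : g ∈ zassenhausSeries p G n) :
    (f : G →* H) g ∈ zassenhausSeries p H n := by
  refine (mem_closedDimensionSubgroup p H).2 fun V => ?_
  let U : OpenNormalSubgroup G :=
    { toSubgroup := V.toSubgroup.comap (f : G →* H)
      isOpen' := V.isOpen'.preimage f.continuous_toFun
      isNormal' := inferInstance }
  exact map_mem_dimensionSubgroup (ZMod p)
    (QuotientGroup.map U.toSubgroup V.toSubgroup (f : G →* H) le_rfl) n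
    ((mem_closedDimensionSubgroup p G).1 hg U)

variable (G) in
theorem gammaSeries_le_zassenhausSeries [IsTopologicalGroup G] (n : ℕ+) (g : G)
    (hg : g ∈ gammaSeries G n) : g ∈ zassenhausSeries p G n := by
  have hcl : ∀ m : ℕ, IsClosed (closedDimensionSubgroup p G m : Set G) := fun m => by
    rw [closedDimensionSubgroup, Subgroup.coe_iInf]
    refine isClosed_iInter fun U => Subgroup.isClosed_of_isOpen _ ?_
    refine Subgroup.isOpen_mono ?_ U.isOpen'
    intro x hx
    have hx1 : (QuotientGroup.mk x : G ⧸ U.toSubgroup) = 1 := (QuotientGroup.eq_one_iff x).2 hx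
    show (QuotientGroup.mk x : G ⧸ U.toSubgroup) ∈ dimensionSubgroup (ZMod p) _ m
    rw [hx1]
    exact one_mem _
  have key : ∀ k : ℕ, closedLowerCentralSeries G k ≤ closedDimensionSubgroup p G (k + 1) := by
    intro k
    induction k with
    | zero => exact le_of_eq (zassenhausSeries p G).one_eq_top.symm
    | succ k ih =>
      refine Subgroup.topologicalClosure_minimal _ ?_ (hcl _)
      refine Subgroup.commutator_le.2 fun x hx y _ => ?_
      have hy : y ∈ zassenhausSeries p G 1 := by
        rw [(zassenhausSeries p G).one_eq_top]; exact Subgroup.mem_top _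
      obtain ⟨m, hm⟩ : ∃ m : ℕ+, (m : ℕ) = k + 1 := ⟨⟨k + 1, k.succ_pos⟩, rfl⟩
      have hx' : x ∈ zassenhausSeries p G m := by
        show x ∈ closedDimensionSubgroup p G m
        rw [hm]; exact ih hx
      have h3 : ⁅x, y⁆ ∈ closedDimensionSubgroup p G ((m + 1 : ℕ+) : ℕ) :=
        (zassenhausSeries p G).commutator_mem hx' hy
      rwa [PNat.add_coe, hm] at h3
  have h1 := key n.natPred hg
  rw [PNat.natPred_add_one] at h1
  exact h1

end Dimension

/-! ### The Magnus–Zassenhaus map -/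

section Theta

open CentralSeries

/-- The extension of a homomorphism of Lie rings `L → M` to a homomorphism of `K`-Lie algebras
`K ⊗ L → M`. -/
def liftLie (K : Type*) [CommRing K] {L M : Type*} [LieRing L] [LieRing M] [LieAlgebra K M]
    (f : L →ₗ⁅ℤ⁆ M) : K ⊗[ℤ] L →ₗ⁅K⁆ M :=
  { (f : L →ₗ[ℤ] M).liftBaseChange K with
    map_lie' := by
      intro x y
      show (f : L →ₗ[ℤ] M).liftBaseChange K ⁅x, y⁆ =
        ⁅(f : L →ₗ[ℤ] M).liftBaseChange K x, (f : L →ₗ[ℤ] M).liftBaseChange K y⁆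
      induction x with
      | zero => rw [zero_lie, map_zero, zero_lie]
      | add x x' hx hx' => rw [add_lie, map_add, map_add, add_lie, hx, hx']
      | tmul a x =>
        induction y with
        | zero => exact (congrArg _ (lie_zero (a ⊗ₜ[ℤ] x))).trans (by rw [map_zero, lie_zero])
        | add y y' hy hy' =>
          refine (congrArg _ (lie_add (a ⊗ₜ[ℤ] x) y y')).trans ?_
          rw [map_add, map_add, lie_add, hy, hy']
        | tmul b y =>
          rw [LieAlgebra.ExtendScalars.bracket_tmul]
          simp [mul_smul, smul_comm a b] }

theorem liftLie_tmul (K : Type*) [CommRing K] {L M : Type*} [LieRing L] [LieRing M]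
    [LieAlgebra K M] (f : L →ₗ⁅ℤ⁆ M) (a : K) (x : L) : liftLie K f (a ⊗ₜ x) = a • f x := by
  exact LinearMap.liftBaseChange_tmul _ _ _ _

/-- The base change of a homomorphism of Lie rings. -/
def baseChangeLie (K : Type*) [CommRing K] {L M : Type*} [LieRing L] [LieRing M]
    (f : L →ₗ⁅ℤ⁆ M) : K ⊗[ℤ] L →ₗ⁅K⁆ K ⊗[ℤ] M :=
  { (f : L →ₗ[ℤ] M).baseChange K with
    map_lie' := by
      intro x y
      show (f : L →ₗ[ℤ] M).baseChange K ⁅x, y⁆ =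
        ⁅(f : L →ₗ[ℤ] M).baseChange K x, (f : L →ₗ[ℤ] M).baseChange K y⁆
      induction x with
      | zero => rw [zero_lie, map_zero, zero_lie]
      | add x x' hx hx' => rw [add_lie, map_add, map_add, add_lie, hx, hx']
      | tmul a x =>
        induction y with
        | zero => exact (congrArg _ (lie_zero (a ⊗ₜ[ℤ] x))).trans (by rw [map_zero, lie_zero])
        | add y y' hy hy' =>
          refine (congrArg _ (lie_add (a ⊗ₜ[ℤ] x) y y')).trans ?_
          rw [map_add, map_add, lie_add, hy, hy']
        | tmul b y =>
          rw [LieAlgebra.ExtendScalars.bracket_tmul]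
          simp }

variable (p : ℕ) [hp : Fact p.Prime]

section Objects

variable (G : Type*) [Group G] [TopologicalSpace G] [IsTopologicalGroup G]

/-- The Magnus Lie ring `gr^M(G) = ⨁ n, γ_n(G) / γ_{n+1}(G)`. -/
abbrev GrM : Type _ := (gammaSeries G).Gr

/-- The `𝔽_p`-Lie algebra `gr^M(G) ⊗ 𝔽_p`. -/
abbrev GrMp : Type _ := ZMod p ⊗[ℤ] GrM G

/-- The restricted `𝔽_p`-Lie algebra `(gr^M(G) ⊗ 𝔽_p)^[p]`. -/
abbrev GrMpRes : Type _ := Restrictification p (ZMod p) (GrMp p G)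

/-- `ρ : gr^M(G) → gr^{Z,p}(G)`, `g γ_{n+1}(G) ↦ g D_{n+1}(G)`. -/
def rho : GrM G →ₗ⁅ℤ⁆ GrZ p G :=
  grMap (gammaSeries G) (zassenhausSeries p G) (MonoidHom.id G)
    (gammaSeries_le_zassenhausSeries p G)

/-- `θ = ρ ⊗ 𝔽_p : gr^M(G) ⊗ 𝔽_p → gr^{Z,p}(G)`. -/
def theta : GrMp p G →ₗ⁅ZMod p⁆ GrZ p G := liftLie (ZMod p) (rho p G)

/-- The homomorphism of restricted Lie algebras `(gr^M(G) ⊗ 𝔽_p)^[p] → gr^{Z,p}(G)` that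
corresponds to `θ` under the adjunction. -/
def thetaHat : RestrictedLieHom p (ZMod p) (GrMpRes p G) (GrZ p G) :=
  Restrictification.lift (theta p G)

/-- The component `gr^M_n(G) ⊗ 𝔽_p` of degree `n`. -/
def gradingM (n : ℕ+) : Submodule (ZMod p) (GrMp p G) :=
  Submodule.span (ZMod p) {x | ∃ a : (gammaSeries G).Piece n, x = 1 ⊗ₜ (gammaSeries G).of n a}

/-- The component of degree `n` of `(gr^M(G) ⊗ 𝔽_p)^[p]`. -/
def gradingMRes (n : ℕ+) : Submodule (ZMod p) (GrMpRes p G) :=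
  Restrictification.grading p (gradingM p G) n

/-- The component `gr^{Z,p}_n(G) = D_n(G) / D_{n+1}(G)`. -/
def gradingZ (n : ℕ+) : Submodule (ZMod p) (GrZ p G) :=
  Submodule.span (ZMod p) (Set.range ((zassenhausSeries p G).of n))

end Objects

section Functoriality

theorem pPow_zero {L : Type*} [LieRing L] [LieAlgebra (ZMod p) L]
    [RestrictedLieAlgebra p (ZMod p) L] : pPow p (ZMod p) (0 : L) = 0 := by
  have := pPow_smul p (0 : ZMod p) (0 : L)
  rwa [smul_zero, zero_pow hp.out.ne_zero, zero_smul] at this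

variable {G H : Type*} [Group G] [TopologicalSpace G] [Group H] [TopologicalSpace H]

/-- The homomorphism `gr^{Z,p}(G) → gr^{Z,p}(H)`, `g D_{n+1}(G) ↦ f(g) D_{n+1}(H)`, of restricted
Lie algebras induced by a continuous homomorphism `f`. -/
def grZMap (f : G →ₜ* H) : RestrictedLieHom p (ZMod p) (GrZ p G) (GrZ p H) :=
  let φ : GrZ p G →ₗ⁅ℤ⁆ GrZ p H :=
    grMap (zassenhausSeries p G) (zassenhausSeries p H) (f : G →* H) (map_mem_zassenhausSeries p f)
  { toFun := φ
    map_add' := map_add φ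
    map_smul' := fun c x => ZMod.map_smul φ.toLinearMap.toAddMonoidHom c x
    map_lie' := LieHom.map_lie φ _ _
    map_pPow' := fun x => by
      show φ (pPow p (ZMod p) x) = pPow p (ZMod p) (φ x)
      have h0 : ∀ (n : ℕ+) (g : zassenhausSeries p G n),
          φ ((zassenhausSeries p G).of n (Piece.mk g)) =
            (zassenhausSeries p H).of n
              (Piece.mk ⟨(f : G →* H) g, map_mem_zassenhausSeries p f n g g.2⟩) :=
        fun n g => grMap_of _ _ _ _ n g
      induction x using Gr.ind with
      | hof n g =>
        rw [pPow_of, h0, h0, pPow_of]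
        exact congrArg _ (congrArg _ (Subtype.ext (map_pow (f : G →* H) _ _)))
      | h0 =>
        rw [pPow_zero, map_zero, pPow_zero]
      | hadd x y hx hy =>
        rw [pPow_add, map_add, map_add, map_add, pPow_add, hx, hy, map_sum]
        refine congrArg _ (Finset.sum_congr rfl fun k _ => ?_)
        refine (ZMod.map_smul φ.toLinearMap.toAddMonoidHom _ _).trans ?_
        exact congrArg _ (lieCoeff_map φ.toLinearMap.toAddMonoidHom
          (fun x y => LieHom.map_lie φ x y) x y _ _) }

variable [IsTopologicalGroup G] [IsTopologicalGroup H]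

/-- The homomorphism `gr^M(G) → gr^M(H)`, `g γ_{n+1}(G) ↦ f(g) γ_{n+1}(H)`, of Lie rings induced by
a continuous homomorphism `f`. -/
def grMMap (f : G →ₜ* H) : GrM G →ₗ⁅ℤ⁆ GrM H :=
  grMap (gammaSeries G) (gammaSeries H) (f : G →* H) (map_mem_gammaSeries f)

/-- The homomorphism `(gr^M(G) ⊗ 𝔽_p)^[p] → (gr^M(H) ⊗ 𝔽_p)^[p]` of restricted Lie algebras induced
by a continuous homomorphism `f`. -/
def grMpResMap (f : G →ₜ* H) : RestrictedLieHom p (ZMod p) (GrMpRes p G) (GrMpRes p H) :=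
  Restrictification.map p (baseChangeLie (ZMod p) (grMMap f))

end Functoriality

end Theta

/-! ### The notions in the statement -/

/-- Pro-`p` groups: compact, totally disconnected topological groups whose continuous finite
quotients are `p`-groups. -/
structure IsProP (p : ℕ) (G : Type*) [Group G] [TopologicalSpace G] : Prop where
  compactSpace : CompactSpace G
  totallyDisconnectedSpace : TotallyDisconnectedSpace G
  isPGroup : ∀ U : OpenNormalSubgroup G, IsPGroup p (G ⧸ U.toSubgroup)

section Graded

variable (p : ℕ) {K R : Type*} [Field K] [LieRing R] [LieAlgebra K R] [RestrictedLieAlgebra p K R]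

/-- The subspaces `𝒜 n`, `n ≥ 1`, make `R` an `ℕ`-graded restricted Lie algebra: `R = ⨁ 𝒜 n`,
`⁅𝒜 m, 𝒜 n⁆ ⊆ 𝒜 (m + n)` and `(𝒜 n)^[p] ⊆ 𝒜 (p n)`. -/
structure IsNGraded [Fact p.Prime] (𝒜 : ℕ+ → Submodule K R) : Prop where
  isInternal : DirectSum.IsInternal 𝒜
  lie_mem : ∀ {m n : ℕ+} {x y : R}, x ∈ 𝒜 m → y ∈ 𝒜 n → ⁅x, y⁆ ∈ 𝒜 (m + n)
  pPow_mem : ∀ {n : ℕ+} {x : R}, x ∈ 𝒜 n → pPow p K x ∈ 𝒜 (primePNat p * n)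

/-- `R` is (topologically) generated by `𝒜 1` as a restricted Lie algebra: the only restricted
subalgebra of `R` that contains `𝒜 1` and is closed is `R` itself. Here the topology is given on
spaces `P n` with maps `e n : P n → R`, and closed means that all the preimages in `P n` are closed.
For discrete spaces `P n` this is generation in the algebraic sense. -/
def IsOneGenerated {P : ℕ+ → Type*} [∀ n, TopologicalSpace (P n)] (e : ∀ n, P n → R)
    (𝒜 : ℕ+ → Submodule K R) : Prop :=
  ∀ S : Submodule K R, (∀ x ∈ S, ∀ y ∈ S, ⁅x, y⁆ ∈ S) → (∀ x ∈ S, pPow p K x ∈ S) →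
    (∀ n, IsClosed (e n ⁻¹' (S : Set R))) → 𝒜 1 ≤ S → S = ⊤

theorem isOneGenerated_iff {P : ℕ+ → Type*} [∀ n, TopologicalSpace (P n)]
    [∀ n, DiscreteTopology (P n)] (e : ∀ n, P n → R) (𝒜 : ℕ+ → Submodule K R) :
    IsOneGenerated p e 𝒜 ↔ ∀ S : Submodule K R, (∀ x ∈ S, ∀ y ∈ S, ⁅x, y⁆ ∈ S) →
      (∀ x ∈ S, pPow p K x ∈ S) → 𝒜 1 ≤ S → S = ⊤ :=
  ⟨fun h S h1 h2 h3 => h S h1 h2 (fun _ => isClosed_discrete _) h3,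
    fun h S h1 h2 _ h3 => h S h1 h2 h3⟩

instance {G : Type*} [Group G] [TopologicalSpace G] [DiscreteTopology G] (Γ : CentralSeries G)
    (n : ℕ+) : DiscreteTopology (Γ.Piece n) :=
  discreteTopology_iff_forall_isOpen.2 fun s => by
    have : IsOpen ((QuotientGroup.mk : Γ n → Γ n ⧸ (Γ (n + 1)).subgroupOf (Γ n)) ⁻¹' s) :=
      isOpen_discrete _
    exact this

end Graded

section Pieces

variable (p : ℕ) [Fact p.Prime] (G : Type*) [Group G] [TopologicalSpace G]

/-- The map `gr^{Z,p}_n(G) → gr^{Z,p}(G)`. -/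
def pieceZ (n : ℕ+) (a : (zassenhausSeries p G).Piece n) : GrZ p G := (zassenhausSeries p G).of n a

variable [IsTopologicalGroup G]

/-- The map `gr^M_n(G) → (gr^M(G) ⊗ 𝔽_p)^[p]`, `a ↦ ι (1 ⊗ a)`. -/
def pieceMRes (n : ℕ+) (a : (gammaSeries G).Piece n) : GrMpRes p G :=
  Restrictification.ι p (ZMod p) (GrMp p G) (1 ⊗ₜ (gammaSeries G).of n a)

end Pieces

end
end MagnusZassenhaus

open MagnusZassenhaus

open scoped TensorProduct

universe u v

/-!
The proof has three independent ingredients.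

*Gradings.* That `(gr^M(G) ⊗ 𝔽_p)^[p]` is the direct sum of its components is shown without a
universal enveloping algebra. If `R` is a restricted Lie algebra, so is `R[t] = K[t] ⊗ R`, with
`(t ^ n x)^[p] = t ^ (p n) x^[p]`. This comes down to the fact that the defect of additivity of a
`p`-map, `jacobsonSum p K x y = ∑ s_k(x, y)`, is a symmetric 2-cocycle on every Lie algebra in
characteristic `p` (`jacobsonSum_cocycle`): then `p`-maps are homomorphic sections of an
extension of abelian groups, which may be prescribed on monomials. The cocycle identity expresses
that the differential form `ad (u) ^ (p - 1) (du)` is closed (`derivation_iterate_lie_comm`). Now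
the homomorphism that multiplies the elements of degree `n` of a graded Lie algebra `L` by
`t ^ n` extends to `L^[p] → L^[p][t]`, and this separates the components of `L^[p]`.

*Jennings' theorem.* A central series `Γ` with `g ^ p ∈ Γ (p n)` for `g ∈ Γ n` contains the
dimension subgroups over `𝔽_p` (`dimensionSubgroup_le`). The powers of the augmentation ideal lie
in the filtration of the group algebra by weights with respect to `Γ`. It is compared with `Γ` in
a finitely generated subgroup `K`, where `Γ n ∩ K` has finite index, by induction on the index: a
character of the first nontrivial quotient of `K` has a kernel `H` of index `p`, and
`h x ^ a ↦ h`, `0 ≤ a < p`, induces a retraction of `𝔽_p[K]` to `𝔽_p[H]` that respects weights.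

*Generation in degree one.* For a closed restricted subalgebra `S` of `gr^{Z,p}(G)` that contains
the component of degree one, replace `D_n(G)` by the subgroup of the elements with class in `S`.
By induction on `n` this is again a restricted central series, so it contains `D_n(G)` modulo
every open normal subgroup, hence `D_n(G)`, and `S` is everything (`isOneGenerated_gradingZ`).
Surjectivity follows, since the image of the extension of `θ` contains the restricted subalgebra
spanned by the `p ^ j`-th powers of the classes of elements of the lower central series. This
subalgebra is closed: as sums of `p ^ j`-th powers of elements of one degree are single
`p ^ j`-th powers up to lower ones, its preimage in `D_n(G)` is a product of finitely many sets of
the form `{y ^ (p ^ j) | y ∈ γ_i(G)}` and of `D_{n+1}(G)`, which are compact if `G` is pro-`p`.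
-/

namespace MagnusZassenhaus

open scoped TensorProduct commutatorElement Pointwise
open LieAlgebra CentralSeries

/-! ### A closed differential form on a Lie algebra of characteristic `p` -/

section Closed

variable {S : Type*} [LieRing S]

/-- A binomial formula for the derivative of `ad (u) ^ n (x)` in a direction in which `x` is
constant and `u` changes by `y`. -/
theorem derivation_iterate_lie (D : S →+ S) (hD : ∀ a b, D ⁅a, b⁆ = ⁅D a, b⁆ + ⁅a, D b⁆)
    {u x y : S} (hu : D u = y) (hx : D x = 0) (n : ℕ) :
    D ((fun z => ⁅u, z⁆)^[n] x) = ∑ k ∈ Finset.range n,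
      n.choose (k + 1) • ⁅(fun z => ⁅u, z⁆)^[k] y, (fun z => ⁅u, z⁆)^[n - 1 - k] x⁆ := by
  induction n with
  | zero => simpa using hx
  | succ n ih =>
    rw [Function.iterate_succ_apply', hD, hu, ih, lie_sum, Finset.sum_range_succ']
    have e1 : ∀ k ∈ Finset.range n,
        ⁅u, n.choose (k + 1) • ⁅(fun z => ⁅u, z⁆)^[k] y, (fun z => ⁅u, z⁆)^[n - 1 - k] x⁆⁆ =
        n.choose (k + 1) • ⁅(fun z => ⁅u, z⁆)^[k + 1] y, (fun z => ⁅u, z⁆)^[n - 1 - k] x⁆ +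
        n.choose (k + 1) • ⁅(fun z => ⁅u, z⁆)^[k] y, (fun z => ⁅u, z⁆)^[n - k] x⁆ := by
      intro k hk
      have h : n - k = n - 1 - k + 1 := by have := Finset.mem_range.1 hk; omega
      rw [lie_nsmul, leibniz_lie, nsmul_add, h, Function.iterate_succ_apply',
        Function.iterate_succ_apply']
    rw [Finset.sum_congr rfl e1, Finset.sum_add_distrib]
    have e2 : ∀ k ∈ Finset.range n, (n + 1).choose (k + 1 + 1) •
        ⁅(fun z => ⁅u, z⁆)^[k + 1] y, (fun z => ⁅u, z⁆)^[n + 1 - 1 - (k + 1)] x⁆ =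
        n.choose (k + 1) • ⁅(fun z => ⁅u, z⁆)^[k + 1] y, (fun z => ⁅u, z⁆)^[n - 1 - k] x⁆ +
        n.choose (k + 2) • ⁅(fun z => ⁅u, z⁆)^[k + 1] y, (fun z => ⁅u, z⁆)^[n - (k + 1)] x⁆ := by
      intro k _
      have h : n + 1 - 1 - (k + 1) = n - 1 - k := by omega
      have h' : n - (k + 1) = n - 1 - k := by omega
      rw [Nat.choose_succ_succ, add_nsmul, h, h']
    rw [Finset.sum_congr rfl e2, Finset.sum_add_distrib]
    have e3 := Finset.sum_range_succ' (fun k => n.choose (k + 1) •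
      ⁅(fun z => ⁅u, z⁆)^[k] y, (fun z => ⁅u, z⁆)^[n - k] x⁆) n
    rw [Finset.sum_range_succ, Nat.choose_succ_self, zero_nsmul, add_zero] at e3
    rw [e3]
    simp only [Function.iterate_zero, id_eq, zero_add, Nat.choose_one_right, add_tsub_cancel_right,
      Nat.sub_zero, succ_nsmul]
    abel

/-- The differential form `ad (u) ^ (p - 1) (du)` on a Lie algebra of characteristic `p` is
closed: the derivations `D` and `D'` are the partial derivatives in the directions `x` and `y`. The
reason is that `(-1) ^ k (p - 1 choose k) = 1` in characteristic `p`. -/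
theorem derivation_iterate_lie_comm (p : ℕ) [hp : Fact p.Prime] (K : Type*) [Field K] [CharP K p]
    [LieAlgebra K S] (D D' : S →+ S) (hD : ∀ a b, D ⁅a, b⁆ = ⁅D a, b⁆ + ⁅a, D b⁆)
    (hD' : ∀ a b, D' ⁅a, b⁆ = ⁅D' a, b⁆ + ⁅a, D' b⁆) {u x y : S} (hx : D u = x) (hy : D' u = y)
    (hxy : D y = 0) (hyx : D' x = 0) :
    D' ((fun z => ⁅u, z⁆)^[p - 1] x) = D ((fun z => ⁅u, z⁆)^[p - 1] y) := by
  have hp1 := hp.out.one_le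
  have hneg : (-1 : K) ^ p = -1 := neg_one_pow_char K p
  have hch : ∀ k ∈ Finset.range (p - 1), ∀ w : S,
      (p - 1).choose (k + 1) • w = ((-1 : K) ^ (k + 1)) • w := by
    intro k hk w
    have hk' := Finset.mem_range.1 hk
    have h := choose_prime_sub_one (R := K) p (CharP.cast_eq_zero K p) (k + 1) (by omega)
    rw [← Nat.cast_smul_eq_nsmul K]
    congr 1
    have h2 : (-1 : K) ^ (k + 1) * (-1 : K) ^ (k + 1) = 1 := by
      rw [← mul_pow]; simp
    calc ((p - 1).choose (k + 1) : K)
        = (-1 : K) ^ (k + 1) * (-1 : K) ^ (k + 1) * ((p - 1).choose (k + 1) : K) := by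
          rw [h2, one_mul]
      _ = _ := by rw [mul_assoc, h, mul_one]
  rw [derivation_iterate_lie D' hD' hy hyx, derivation_iterate_lie D hD hx hxy,
    Finset.sum_congr rfl fun k hk => hch k hk _,
    Finset.sum_congr rfl fun k hk => hch k hk _, ← Finset.sum_range_reflect]
  refine Finset.sum_congr rfl fun k hk => ?_
  have hk' := Finset.mem_range.1 hk
  have h1 : p - 1 - 1 - (p - 1 - 1 - k) = k := by omega
  rw [h1, ← lie_skew, smul_neg, ← neg_smul]
  congr 1
  have h2 : p - 1 - 1 - k + 1 + (k + 1) = p := by omega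
  have h3 : (-1 : K) ^ (k + 1) * (-1 : K) ^ (k + 1) = 1 := by
    rw [← mul_pow]; simp
  calc -(-1 : K) ^ (p - 1 - 1 - k + 1)
      = -((-1 : K) ^ (p - 1 - 1 - k + 1) * ((-1 : K) ^ (k + 1) * (-1 : K) ^ (k + 1))) := by
        rw [h3, mul_one]
    _ = _ := by rw [← mul_assoc, ← pow_add, h2, hneg]; ring

end Closed

/-! ### Lie algebras of polynomials -/

/-- The Lie algebra `K[M] ⊗ L` of polynomials with coefficients in `L` and exponents in a monoid
`M`. -/
def PolyLie (K M L : Type*) [Field K] [LieRing L] [LieAlgebra K L] : Type _ := loopAlgebra K M L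

namespace PolyLie

variable {K M L : Type*} [Field K] [LieRing L] [LieAlgebra K L] [AddCommMonoid M]

noncomputable instance : LieRing (PolyLie K M L) := inferInstanceAs (LieRing (loopAlgebra K M L))

noncomputable instance : LieAlgebra K (PolyLie K M L) :=
  inferInstanceAs (LieAlgebra K (loopAlgebra K M L))

/-- The coefficients of a polynomial. -/
noncomputable def coeffs : PolyLie K M L ≃ₗ[K] M →₀ L := LoopAlgebra.toFinsupp K M L

/-- The monomial `t ^ a x`. -/
noncomputable def monom (K : Type*) {M L : Type*} [Field K] [LieRing L] [LieAlgebra K L]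
    [AddCommMonoid M] (a : M) : L →ₗ[K] PolyLie K M L :=
  TensorProduct.mk K (AddMonoidAlgebra K M) L (AddMonoidAlgebra.single a 1)

theorem coeffs_monom (a : M) (x : L) : coeffs (monom K a x) = Finsupp.single a x :=
  LoopAlgebra.toFinsupp_single_tmul K M L a x

theorem coeffs_symm_single (a : M) (x : L) : coeffs.symm (Finsupp.single a x) = monom K a x :=
  LoopAlgebra.toFinsupp_symm_single K M L a x

@[elab_as_elim]
theorem induction {P : PolyLie K M L → Prop} (f : PolyLie K M L) (h0 : P 0)
    (hadd : ∀ f g, P f → P g → P (f + g)) (hm : ∀ a x, P (monom K a x)) : P f := by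
  have key : ∀ g : M →₀ L, P (coeffs.symm g) := by
    intro g
    induction g using Finsupp.induction_linear with
    | zero => rwa [map_zero]
    | add f g hf hg => rw [map_add]; exact hadd _ _ hf hg
    | single a x => rw [coeffs_symm_single]; exact hm a x
  simpa using key (coeffs f)

theorem monom_lie_monom (a b : M) (x y : L) :
    ⁅monom K a x, monom K b y⁆ = monom K (a + b) ⁅x, y⁆ := by
  refine (ExtendScalars.bracket_tmul K (AddMonoidAlgebra K M) L L (AddMonoidAlgebra.single a 1)
    (AddMonoidAlgebra.single b 1) x y).trans ?_
  rw [AddMonoidAlgebra.single_mul_single, one_mul]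
  rfl

/-- The additive map on polynomials given by its values on monomials. -/
noncomputable def liftAdd {A : Type*} [AddCommMonoid A] (φ : M → L →+ A) : PolyLie K M L →+ A :=
  (Finsupp.liftAddHom φ).comp (coeffs (K := K)).toLinearMap.toAddMonoidHom

theorem liftAdd_monom {A : Type*} [AddCommMonoid A] (φ : M → L →+ A) (a : M) (x : L) :
    liftAdd φ (monom K a x) = φ a x := by
  show Finsupp.liftAddHom φ (coeffs (monom K a x)) = _
  rw [coeffs_monom, Finsupp.liftAddHom_apply_single]

/-- The derivation that multiplies `t ^ a x` by `w a`. -/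
noncomputable def euler (w : M →+ ℕ) : PolyLie K M L →+ PolyLie K M L :=
  liftAdd fun a => w a • (monom K a : L →ₗ[K] PolyLie K M L).toAddMonoidHom

theorem euler_monom (w : M →+ ℕ) (a : M) (x : L) :
    euler w (monom K a x) = w a • monom K a x :=
  liftAdd_monom _ a x

theorem coeffs_euler (w : M →+ ℕ) (f : PolyLie K M L) (a : M) :
    coeffs (euler w f) a = w a • coeffs f a := by
  classical
  induction f using induction with
  | h0 => simp
  | hadd f g hf hg => simp only [map_add, Finsupp.add_apply, hf, hg, nsmul_add]
  | hm b x =>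
    rw [euler_monom, map_nsmul, coeffs_monom, Finsupp.smul_apply, Finsupp.single_apply]
    split_ifs with h
    · rw [h]
    · simp

theorem euler_lie (w : M →+ ℕ) (f g : PolyLie K M L) :
    euler w ⁅f, g⁆ = ⁅euler w f, g⁆ + ⁅f, euler w g⁆ := by
  induction f using induction with
  | h0 => simp
  | hadd f f' hf hf' => simp only [map_add, add_lie, hf, hf']; abel
  | hm a x =>
    induction g using induction with
    | h0 => simp
    | hadd g g' hg hg' => simp only [map_add, lie_add, hg, hg']; abel
    | hm b y =>
      rw [monom_lie_monom, euler_monom, euler_monom, euler_monom, nsmul_lie, lie_nsmul,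
        monom_lie_monom, map_add, add_nsmul]

/-- The additive map induced by a homomorphism of the monoids of exponents. By `map_lie` it
respects brackets. -/
noncomputable def map {N : Type*} [AddCommMonoid N] (π : M →+ N) :
    PolyLie K M L →+ PolyLie K N L :=
  liftAdd fun a => (monom K (π a) : L →ₗ[K] PolyLie K N L).toAddMonoidHom

theorem map_monom {N : Type*} [AddCommMonoid N] (π : M →+ N) (a : M) (x : L) :
    map π (monom K a x) = monom K (π a) x :=
  liftAdd_monom _ a x

theorem map_lie {N : Type*} [AddCommMonoid N] (π : M →+ N) (f g : PolyLie K M L) :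
    map π ⁅f, g⁆ = ⁅map π f, map π g⁆ := by
  induction f using induction with
  | h0 => simp
  | hadd f f' hf hf' => simp only [_root_.map_add, add_lie, hf, hf']
  | hm a x =>
    induction g using induction with
    | h0 => simp
    | hadd g g' hg hg' => simp only [_root_.map_add, lie_add, hg, hg']
    | hm b y => simp only [monom_lie_monom, map_monom, _root_.map_add]

theorem coeffs_monom_lie {M' : Type*} [AddCancelCommMonoid M'] (a : M') (x : L)
    (f : PolyLie K M' L) (b : M') : coeffs ⁅monom K a x, f⁆ (a + b) = ⁅x, coeffs f b⁆ := by
  classical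
  induction f using induction with
  | h0 => simp
  | hadd f g hf hg => simp only [map_add, lie_add, Finsupp.add_apply, hf, hg]
  | hm c y =>
    rw [monom_lie_monom, coeffs_monom, coeffs_monom, Finsupp.single_apply, Finsupp.single_apply]
    simp only [add_right_inj]
    split_ifs <;> simp

theorem coeffs_monom_lie_of_ne (a : M) (x : L) (f : PolyLie K M L) (c : M)
    (h : ∀ b, a + b ≠ c) : coeffs ⁅monom K a x, f⁆ c = 0 := by
  classical
  induction f using induction with
  | h0 => simp
  | hadd f g hf hg => simp only [map_add, lie_add, Finsupp.add_apply, hf, hg, add_zero]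
  | hm b y =>
    rw [monom_lie_monom, coeffs_monom, Finsupp.single_apply, if_neg (h b)]

end PolyLie

/-! ### The Jacobson sum is a symmetric cocycle -/

section Cocycle

open PolyLie

variable {L : Type*} [LieRing L]

/-- The sum `∑ s_k(x, y)`, the defect of additivity of a `p`-map. -/
def jacobsonSum (p : ℕ) (K : Type*) [Field K] [LieAlgebra K L] (x y : L) : L :=
  ∑ k ∈ Finset.Icc 1 (p - 1), (k : K)⁻¹ • jacobsonS p k x y

variable {K : Type*} [Field K] [LieAlgebra K L]

/-- `lieCoeff` gives the coefficients of `ad (t x + y) ^ n (t x)`. -/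
theorem coeffs_iterate (x y : L) (n : ℕ) :
    coeffs ((fun z => ⁅monom K 1 x + monom K 0 y, z⁆)^[n] (monom K (1 : ℕ) x)) 0 = 0 ∧
    ∀ k, coeffs ((fun z => ⁅monom K 1 x + monom K 0 y, z⁆)^[n] (monom K (1 : ℕ) x)) (k + 1) =
      lieCoeff x y n k := by
  induction n with
  | zero =>
    refine ⟨by simp [coeffs_monom], fun k => ?_⟩
    cases k <;> simp [coeffs_monom, lieCoeff]
  | succ n ih =>
    obtain ⟨ih0, ih⟩ := ih
    rw [Function.iterate_succ_apply']
    set f := (fun z => ⁅monom K 1 x + monom K 0 y, z⁆)^[n] (monom K (1 : ℕ) x)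
    have e0 : ∀ k, coeffs ⁅monom K 0 y, f⁆ k = ⁅y, coeffs f k⁆ := fun k => by
      simpa using coeffs_monom_lie 0 y f k
    have e1 : ∀ k, coeffs ⁅monom K 1 x, f⁆ (k + 1) = ⁅x, coeffs f k⁆ := fun k => by
      rw [add_comm k 1]; exact coeffs_monom_lie 1 x f k
    constructor
    · rw [add_lie, map_add, Finsupp.add_apply, e0, ih0, lie_zero, add_zero]
      exact coeffs_monom_lie_of_ne _ _ _ _ (by simp)
    · intro k
      rw [add_lie, map_add coeffs, Finsupp.add_apply, e0, e1, ih]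
      cases k with
      | zero => rw [ih0, lie_zero, zero_add, lieCoeff]
      | succ k => rw [ih, lieCoeff]

/-- The polynomial `ad (s x + t y + z) ^ n (s x)`. -/
noncomputable def adPoly (K : Type*) [Field K] [LieAlgebra K L] (x y z : L) (n : ℕ) :
    PolyLie K (ℕ × ℕ) L :=
  (fun w => ⁅monom K (1, 0) x + monom K (0, 1) y + monom K (0, 0) z, w⁆)^[n] (monom K (1, 0) x)

theorem map_adPoly (x y z : L) (n : ℕ) (π : ℕ × ℕ →+ ℕ) :
    PolyLie.map π (adPoly K x y z n) =
      (fun w => ⁅monom K (π (1, 0)) x + monom K (π (0, 1)) y + monom K 0 z, w⁆)^[n]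
        (monom K (π (1, 0)) x) := by
  induction n with
  | zero => exact map_monom _ _ _
  | succ n ih =>
    rw [adPoly, Function.iterate_succ_apply', Function.iterate_succ_apply', ← ih, map_lie]
    have h0 : π (0, 0) = 0 := map_zero π
    simp only [map_add, map_monom, h0]
    rfl

/-- The polynomial `ad (s x + t y + z) ^ n (s x)` is divisible by `s`, reduces to
`ad (s x + z) ^ n (s x)` for `t = 0`, and has degree at most `n + 1`. -/
theorem coeffs_adPoly_zero (x y z : L) (n : ℕ) :
    (∀ j, coeffs (adPoly K x y z n) (0, j) = 0) ∧
    (∀ k, coeffs (adPoly K x y z n) (k + 1, 0) = lieCoeff x z n k) ∧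
    ∀ i j, n + 1 < i + j → coeffs (adPoly K x y z n) (i, j) = 0 := by
  classical
  induction n with
  | zero =>
    refine ⟨fun j => ?_, fun k => ?_, fun i j h => ?_⟩ <;>
      rw [adPoly, Function.iterate_zero, id_eq, coeffs_monom, Finsupp.single_apply]
    · simp
    · cases k <;> simp [lieCoeff]
    · rw [if_neg]
      simp only [Prod.mk.injEq, not_and]
      omega
  | succ n ih =>
    obtain ⟨h1, h2, h3⟩ := ih
    have e : adPoly K x y z (n + 1) = ⁅monom K (1, 0) x, adPoly K x y z n⁆ +
        ⁅monom K (0, 1) y, adPoly K x y z n⁆ + ⁅monom K (0, 0) z, adPoly K x y z n⁆ := by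
      rw [← add_lie, ← add_lie, adPoly, Function.iterate_succ_apply']
      rfl
    have ex : ∀ i j, coeffs ⁅monom K (1, 0) x, adPoly K x y z n⁆ (i + 1, j) =
        ⁅x, coeffs (adPoly K x y z n) (i, j)⁆ := fun i j => by
      have := coeffs_monom_lie (1, 0) x (adPoly K x y z n) (i, j)
      rwa [Prod.mk_add_mk, zero_add, add_comm] at this
    have ex0 : ∀ j, coeffs ⁅monom K (1, 0) x, adPoly K x y z n⁆ (0, j) = 0 := fun j =>
      coeffs_monom_lie_of_ne _ _ _ _ (by rintro ⟨i, k⟩ h; simp at h)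
    have ey : ∀ i j, coeffs ⁅monom K (0, 1) y, adPoly K x y z n⁆ (i, j + 1) =
        ⁅y, coeffs (adPoly K x y z n) (i, j)⁆ := fun i j => by
      have := coeffs_monom_lie (0, 1) y (adPoly K x y z n) (i, j)
      rwa [Prod.mk_add_mk, zero_add, add_comm 1 j] at this
    have ey0 : ∀ i, coeffs ⁅monom K (0, 1) y, adPoly K x y z n⁆ (i, 0) = 0 := fun j =>
      coeffs_monom_lie_of_ne _ _ _ _ (by rintro ⟨i, k⟩ h; simp at h)
    have ez : ∀ i j, coeffs ⁅monom K (0, 0) z, adPoly K x y z n⁆ (i, j) =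
        ⁅z, coeffs (adPoly K x y z n) (i, j)⁆ := fun i j => by
      have := coeffs_monom_lie (0, 0) z (adPoly K x y z n) (i, j)
      rwa [Prod.mk_add_mk, zero_add, zero_add] at this
    simp only [e, map_add, Finsupp.add_apply, ez]
    refine ⟨fun j => ?_, fun k => ?_, fun i j h => ?_⟩
    · rw [ex0, h1, lie_zero]
      cases j with
      | zero => rw [ey0]; simp
      | succ j => rw [ey, h1]; simp
    · rw [ex, ey0, h2, add_zero]
      cases k with
      | zero => rw [h1, lie_zero, zero_add, lieCoeff]
      | succ k => rw [h2, lieCoeff]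
    · rw [h3 i j (by omega), lie_zero, add_zero]
      have e1 : coeffs ⁅monom K (1, 0) x, adPoly K x y z n⁆ (i, j) = 0 := by
        cases i with
        | zero => exact ex0 j
        | succ i => rw [ex, h3 i j (by omega), lie_zero]
      have e2 : coeffs ⁅monom K (0, 1) y, adPoly K x y z n⁆ (i, j) = 0 := by
        cases j with
        | zero => exact ey0 i
        | succ j => rw [ey, h3 i j (by omega), lie_zero]
      rw [e1, e2, add_zero]

/-- The coefficients of a polynomial in `s` and `t` after setting `t = 1`. -/
theorem coeffs_map_fst (f : PolyLie K (ℕ × ℕ) L) (N : ℕ) (i : ℕ)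
    (h : ∀ j, N ≤ j → coeffs f (i, j) = 0) :
    coeffs (PolyLie.map (AddMonoidHom.fst ℕ ℕ) f) i =
      ∑ j ∈ Finset.range N, coeffs f (i, j) := by
  classical
  -- any range that contains the support will do, and the excess terms vanish
  have key : ∃ N₀, ∀ N, N₀ ≤ N → coeffs (PolyLie.map (AddMonoidHom.fst ℕ ℕ) f) i =
      ∑ j ∈ Finset.range N, coeffs f (i, j) := by
    clear h
    induction f using PolyLie.induction with
    | h0 => exact ⟨0, by simp⟩
    | hadd f g hf hg =>
      obtain ⟨a, ha⟩ := hf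
      obtain ⟨b, hb⟩ := hg
      refine ⟨max a b, fun N hN => ?_⟩
      simp only [map_add, Finsupp.add_apply, Finset.sum_add_distrib,
        ha N ((le_max_left _ _).trans hN), hb N ((le_max_right _ _).trans hN)]
    | hm c x =>
      obtain ⟨k, l⟩ := c
      refine ⟨l + 1, fun N hN => ?_⟩
      have hl : l < N := hN
      simp only [map_monom, coeffs_monom, AddMonoidHom.coe_fst, Finsupp.single_apply,
        Prod.mk.injEq]
      by_cases hk : k = i
      · simp [hk, hl]
      · simp [hk]
  obtain ⟨N₀, h₀⟩ := key
  rw [h₀ (max N N₀) (le_max_right _ _)]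
  symm
  refine Finset.sum_subset (by intro j hj; simp only [Finset.mem_range] at *; omega) ?_
  intro j _ hj
  exact h j (by simpa using hj)

variable (p : ℕ)

/-- Expansion of `jacobsonSum p K x (y + z)` in terms of the degrees in `x` and `y`. -/
theorem jacobsonSum_add_right [hp : Fact p.Prime] (x y z : L) :
    jacobsonSum p K x (y + z) = jacobsonSum p K x z +
      ∑ i ∈ Finset.Icc 1 (p - 1), ∑ j ∈ Finset.Icc 1 (p - 1),
        (i : K)⁻¹ • coeffs (adPoly K x y z (p - 1)) (i, j) := by
  have hp2 := hp.out.two_le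
  obtain ⟨h1, h2, h3⟩ := coeffs_adPoly_zero (K := K) x y z (p - 1)
  rw [jacobsonSum, jacobsonSum, ← Finset.sum_add_distrib]
  refine Finset.sum_congr rfl fun i hi => ?_
  obtain ⟨hi1, hi2⟩ := Finset.mem_Icc.1 hi
  obtain ⟨k, rfl⟩ : ∃ k, i = k + 1 := ⟨i - 1, by omega⟩
  have e := (coeffs_iterate (K := K) x (y + z) (p - 1)).2 k
  have e2 := map_adPoly (K := K) x y z (p - 1) (AddMonoidHom.fst ℕ ℕ)
  simp only [AddMonoidHom.coe_fst, add_assoc, ← map_add] at e2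
  rw [← e2, coeffs_map_fst _ p _ fun j hj => h3 _ _ (by omega)] at e
  rw [jacobsonS, jacobsonS, Nat.add_sub_cancel, ← Finset.smul_sum, ← smul_add, ← e, ← h2,
    Finset.range_eq_Ico, Finset.sum_eq_sum_Ico_succ_bot hp.out.pos]
  have hI : Finset.Ico (0 + 1) p = Finset.Icc 1 (p - 1) := by
    ext k; simp only [Finset.mem_Ico, Finset.mem_Icc]; omega
  rw [hI]

theorem coeffs_adPoly_swap (x y z : L) (n i j : ℕ) :
    coeffs (adPoly K y x z n) (j, i) =
      coeffs ((fun w => ⁅monom K (1, 0) x + monom K (0, 1) y + monom K (0, 0) z, w⁆)^[n]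
        (monom K (0, 1) y)) (i, j) := by
  classical
  have key : ∀ f : PolyLie K (ℕ × ℕ) L,
      coeffs (PolyLie.map (AddEquiv.prodComm : ℕ × ℕ ≃+ ℕ × ℕ).toAddMonoidHom f) (i, j) =
        coeffs f (j, i) := by
    intro f
    induction f using PolyLie.induction with
    | h0 => simp
    | hadd f g hf hg => simp only [map_add, Finsupp.add_apply, hf, hg]
    | hm c x =>
      obtain ⟨k, l⟩ := c
      rw [map_monom, coeffs_monom, coeffs_monom, Finsupp.single_apply, Finsupp.single_apply]
      congr 1
      simp [and_comm]
  rw [← key]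
  congr 2
  induction n with
  | zero => exact map_monom _ _ _
  | succ n ih =>
    rw [adPoly, Function.iterate_succ_apply', Function.iterate_succ_apply', ← ih, map_lie,
      add_comm (monom K (1, 0) x)]
    simp only [map_add, map_monom]
    rfl

/-- The polynomials `∫ ad (s x + t y + z) ^ (p - 1) (x) ds` and
`∫ ad (s x + t y + z) ^ (p - 1) (y) dt` have the same terms divisible by `s t`. -/
theorem coeffs_adPoly_comm [hp : Fact p.Prime] [CharP K p] (x y z : L) {i j : ℕ}
    (hi : i ∈ Finset.Icc 1 (p - 1)) (hj : j ∈ Finset.Icc 1 (p - 1)) :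
    (i : K)⁻¹ • coeffs (adPoly K x y z (p - 1)) (i, j) =
      (j : K)⁻¹ • coeffs (adPoly K y x z (p - 1)) (j, i) := by
  have h0 : ∀ k ∈ Finset.Icc 1 (p - 1), (k : K) ≠ 0 := by
    intro k hk h
    obtain ⟨h1, h2⟩ := Finset.mem_Icc.1 hk
    have := Nat.le_of_dvd (by omega) ((CharP.cast_eq_zero_iff K p k).1 h)
    have := hp.out.pos
    omega
  have key := derivation_iterate_lie_comm p K
    (euler (AddMonoidHom.fst ℕ ℕ)) (euler (K := K) (L := L) (AddMonoidHom.snd ℕ ℕ))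
    (euler_lie _) (euler_lie _)
    (u := monom K (1, 0) x + monom K (0, 1) y + monom K (0, 0) z)
    (x := monom K (1, 0) x) (y := monom K (0, 1) y)
    (by simp [euler_monom]) (by simp [euler_monom]) (by simp [euler_monom])
    (by simp [euler_monom])
  have key2 := congrArg (fun f => coeffs f (i, j)) key
  simp only [coeffs_euler, ← coeffs_adPoly_swap] at key2
  have key3 : (j : K) • coeffs (adPoly K x y z (p - 1)) (i, j) =
      (i : K) • coeffs (adPoly K y x z (p - 1)) (j, i) := by
    rw [Nat.cast_smul_eq_nsmul, Nat.cast_smul_eq_nsmul]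
    exact key2
  rw [inv_smul_eq_iff₀ (h0 i hi), smul_smul, mul_comm, ← smul_smul, ← key3,
    inv_smul_smul₀ (h0 j hj)]

/-- Up to the terms `jacobsonSum p K x z + jacobsonSum p K y z`, both sides consist of the terms
that involve `x` and `y`, which agree by `coeffs_adPoly_comm`. -/
theorem jacobsonSum_swap [Fact p.Prime] [CharP K p] (x y z : L) :
    jacobsonSum p K x (y + z) + jacobsonSum p K y z =
      jacobsonSum p K y (x + z) + jacobsonSum p K x z := by
  rw [jacobsonSum_add_right, jacobsonSum_add_right,
    Finset.sum_congr rfl fun i hi => Finset.sum_congr rfl fun j hj =>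
      coeffs_adPoly_comm p x y z hi hj, Finset.sum_comm]
  abel

theorem lieCoeff_eq_zero_of_left {x y : L} (hx : x = 0) (n k : ℕ) : lieCoeff x y n k = 0 := by
  subst hx
  induction n generalizing k with
  | zero => cases k <;> rfl
  | succ n ih => cases k <;> simp [lieCoeff, ih]

theorem lieCoeff_zero_right (x : L) (n k : ℕ) (hn : n ≠ 0) : lieCoeff x 0 n k = 0 := by
  have key : ∀ m k, lieCoeff x 0 (m + 1) k = 0 := by
    intro m
    induction m with
    | zero =>
      intro k
      rcases k with _ | _ | k <;> simp [lieCoeff]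
    | succ m ih => intro k; cases k <;> rw [lieCoeff] <;> simp [ih]
  obtain ⟨m, rfl⟩ := Nat.exists_eq_succ_of_ne_zero hn
  exact key m k

theorem jacobsonSum_zero_left (y : L) : jacobsonSum p K 0 y = 0 :=
  Finset.sum_eq_zero fun k _ => by rw [jacobsonS, lieCoeff_eq_zero_of_left rfl, smul_zero]

theorem jacobsonSum_zero_right [hp : Fact p.Prime] (x : L) : jacobsonSum p K x 0 = 0 :=
  Finset.sum_eq_zero fun k _ => by
    have := hp.out.two_le
    rw [jacobsonS, lieCoeff_zero_right _ _ _ (by omega), smul_zero]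

theorem jacobsonSum_comm [Fact p.Prime] [CharP K p] (x y : L) :
    jacobsonSum p K x y = jacobsonSum p K y x := by
  have := jacobsonSum_swap (K := K) p x y 0
  simpa [jacobsonSum_zero_right p] using this

theorem jacobsonSum_cocycle [Fact p.Prime] [CharP K p] (x y z : L) :
    jacobsonSum p K x y + jacobsonSum p K (x + y) z =
      jacobsonSum p K y z + jacobsonSum p K x (y + z) := by
  rw [jacobsonSum_comm p (x + y) z, add_comm, jacobsonSum_swap, jacobsonSum_comm p z y, add_comm,
    add_comm z y]

end Cocycle

/-! ### Polynomials over a restricted Lie algebra -/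

/-- The extension of the additive group of `L` by itself given by the cocycle `jacobsonSum`. A
function `P : L → L` satisfies Jacobson's formula for `P (x + y)` if and only if its graph
`x ↦ (x, P x)` is a homomorphism to this group. -/
@[ext]
structure PGraph (p : ℕ) (K L : Type*) [Field K] [LieRing L] [LieAlgebra K L] where
  /-- The argument. -/
  fst : L
  /-- The value. -/
  snd : L

namespace PGraph

variable {p : ℕ} {K L : Type*} [Field K] [LieRing L] [LieAlgebra K L]

instance : Zero (PGraph p K L) := ⟨⟨0, 0⟩⟩
instance : Add (PGraph p K L) :=
  ⟨fun a b => ⟨a.fst + b.fst, a.snd + b.snd + jacobsonSum p K a.fst b.fst⟩⟩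
instance : Neg (PGraph p K L) :=
  ⟨fun a => ⟨-a.fst, -a.snd - jacobsonSum p K (-a.fst) a.fst⟩⟩

theorem fst_add (a b : PGraph p K L) : (a + b).fst = a.fst + b.fst := rfl
theorem snd_add (a b : PGraph p K L) :
    (a + b).snd = a.snd + b.snd + jacobsonSum p K a.fst b.fst := rfl

theorem zero_add' (a : PGraph p K L) : 0 + a = a := by
  refine PGraph.ext (zero_add _) ?_
  show 0 + a.snd + jacobsonSum p K 0 a.fst = a.snd
  rw [jacobsonSum_zero_left, add_zero, zero_add]

variable [Fact p.Prime] [CharP K p]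

theorem add_comm' (a b : PGraph p K L) : a + b = b + a := by
  refine PGraph.ext (add_comm _ _) ?_
  rw [snd_add, snd_add, jacobsonSum_comm, add_comm a.snd]

instance : AddCommGroup (PGraph p K L) where
  add_assoc a b c := by
    refine PGraph.ext (add_assoc _ _ _) ?_
    simp only [snd_add, fst_add]
    have := jacobsonSum_cocycle (K := K) p a.fst b.fst c.fst
    rw [← sub_eq_zero] at this ⊢
    rw [← this]
    abel
  add_comm := add_comm'
  zero_add := zero_add'
  add_zero a := by rw [add_comm', zero_add']
  neg_add_cancel a := by
    refine PGraph.ext (neg_add_cancel _) ?_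
    show -a.snd - jacobsonSum p K (-a.fst) a.fst + a.snd + jacobsonSum p K (-a.fst) a.fst = 0
    abel
  nsmul := nsmulRec
  zsmul := zsmulRec

end PGraph

section PolyRestricted

variable {p : ℕ} {K L : Type*} [Field K] [LieRing L] [LieAlgebra K L]

theorem lieCoeff_smul (c : K) (x y : L) (n k : ℕ) :
    lieCoeff (c • x) (c • y) n k = c ^ (n + 1) • lieCoeff x y n k := by
  induction n generalizing k with
  | zero => cases k <;> simp [lieCoeff]
  | succ n ih =>
    cases k <;> simp only [lieCoeff, ih, smul_lie, lie_smul, ← smul_add, smul_smul, ← pow_succ]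

theorem jacobsonSum_smul [hp : Fact p.Prime] (c : K) (x y : L) :
    jacobsonSum p K (c • x) (c • y) = c ^ p • jacobsonSum p K x y := by
  rw [jacobsonSum, jacobsonSum, Finset.smul_sum]
  refine Finset.sum_congr rfl fun k _ => ?_
  rw [jacobsonS, jacobsonS, lieCoeff_smul, Nat.sub_add_cancel hp.out.one_le, smul_comm]

theorem map_jacobsonSum {L' : Type*} [LieRing L'] [LieAlgebra K L'] (f : L →ₗ⁅K⁆ L') (x y : L) :
    f (jacobsonSum p K x y) = jacobsonSum p K (f x) (f y) := by
  rw [jacobsonSum, jacobsonSum, map_sum]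
  refine Finset.sum_congr rfl fun k _ => ?_
  rw [map_smul]
  exact congrArg _ (lieCoeff_map (f : L →ₗ[K] L').toAddMonoidHom (fun x y => LieHom.map_lie f x y)
    x y _ _)

namespace PolyLie

theorem monom_lieCoeff (a : ℕ) (x y : L) (n k : ℕ) :
    lieCoeff (monom K a x) (monom K a y) n k = monom K ((n + 1) * a) (lieCoeff x y n k) := by
  induction n generalizing k with
  | zero => cases k <;> simp [lieCoeff]
  | succ n ih =>
    have h : (n + 1 + 1) * a = a + (n + 1) * a := by ring
    cases k <;> simp only [lieCoeff, ih, monom_lie_monom, map_add, h]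

theorem monom_jacobsonSum [hp : Fact p.Prime] (a : ℕ) (x y : L) :
    jacobsonSum p K (monom K a x) (monom K a y) = monom K (p * a) (jacobsonSum p K x y) := by
  rw [jacobsonSum, jacobsonSum, map_sum]
  refine Finset.sum_congr rfl fun k _ => ?_
  rw [jacobsonS, jacobsonS, monom_lieCoeff, Nat.sub_add_cancel hp.out.one_le, map_smul]

variable [hp : Fact p.Prime] [CharP K p] [RestrictedLieAlgebra p K L]

variable (p K L) in
/-- The graph of the `p`-map, the homomorphism with `t ^ n x ↦ (t ^ n x, t ^ (p n) x^[p])`. -/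
noncomputable def graph : PolyLie K ℕ L →+ PGraph p K (PolyLie K ℕ L) :=
  liftAdd fun n => AddMonoidHom.mk' (fun x => ⟨monom K n x, monom K (p * n) (pPow p K x)⟩)
    fun x y => by
      refine PGraph.ext (map_add _ _ _) ?_
      rw [PGraph.snd_add, monom_jacobsonSum, ← map_add, ← map_add, pPow_add]
      rfl

theorem graph_monom (n : ℕ) (x : L) :
    graph p K L (monom K n x) = ⟨monom K n x, monom K (p * n) (pPow p K x)⟩ :=
  liftAdd_monom _ n x

theorem fst_graph (f : PolyLie K ℕ L) : (graph p K L f).fst = f := by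
  induction f using induction with
  | h0 => rw [map_zero]; rfl
  | hadd f g hf hg => rw [map_add, PGraph.fst_add, hf, hg]
  | hm n x => rw [graph_monom]

attribute [local instance] LieRing.ofAssociativeRing

/-- `K[t] ⊗ L` is restricted if `L` is, with `(t ^ n x)^[p] = t ^ (p n) x^[p]`. Since it suffices to
prescribe the graph of the `p`-map on monomials, no associative envelope is needed. -/
noncomputable instance : RestrictedLieAlgebra p K (PolyLie K ℕ L) where
  pmap f := (graph p K L f).snd
  pmap_add f g := by
    rw [map_add, PGraph.snd_add, fst_graph, fst_graph]
    rfl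
  pmap_smul c f := by
    induction f using induction with
    | h0 => rw [smul_zero, map_zero]; exact (smul_zero _).symm
    | hadd f g hf hg =>
      rw [smul_add, map_add, map_add, PGraph.snd_add, PGraph.snd_add, hf, hg, fst_graph, fst_graph,
        fst_graph, fst_graph, jacobsonSum_smul, smul_add, smul_add]
    | hm n x => rw [← map_smul, graph_monom, graph_monom, pPow_smul]; exact map_smul _ _ _
  pmap_lie f g := by
    have key : ad K (PolyLie K ℕ L) (graph p K L f).snd = ad K (PolyLie K ℕ L) f ^ p := by
      induction f using induction with
      | h0 =>
        rw [map_zero, map_zero, zero_pow hp.out.ne_zero]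
        exact map_zero (ad K (PolyLie K ℕ L))
      | hadd f g hf hg =>
        rw [map_add, PGraph.snd_add, fst_graph, fst_graph, map_add, map_add, hf, hg, map_add,
          add_pow_prime p K, map_jacobsonSum]
        rfl
      | hm n x =>
        rw [graph_monom]
        ext g
        induction g using induction with
        | h0 => rw [map_zero, map_zero]
        | hadd g g' hg hg' => rw [map_add, map_add, hg, hg']
        | hm m y =>
          have h : ∀ k, (ad K (PolyLie K ℕ L) (monom K n x) ^ k) (monom K m y) =
              monom K (k * n + m) ((fun z => ⁅x, z⁆)^[k] y) := by
            intro k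
            induction k with
            | zero => rw [pow_zero, zero_mul, zero_add]; rfl
            | succ k ih =>
              rw [pow_succ', Module.End.mul_apply, ih, ad_apply, monom_lie_monom,
                Function.iterate_succ_apply']
              congr 2
              ring
          rw [h, ad_apply, monom_lie_monom, pPow_lie]
    have h : ∀ k, (ad K (PolyLie K ℕ L) f ^ k) g = (fun z => ⁅f, z⁆)^[k] g := by
      intro k
      induction k with
      | zero => rfl
      | succ k ih =>
        rw [pow_succ', Module.End.mul_apply, ih, ad_apply, Function.iterate_succ_apply']
    rw [← ad_apply K, key, h]

theorem pPow_monom (n : ℕ) (x : L) :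
    pPow p K (monom K n x) = monom K (p * n) (pPow p K x) :=
  congrArg PGraph.snd (graph_monom n x)

end PolyLie

end PolyRestricted

/-! ### Powers of a graded Lie subalgebra of a restricted Lie algebra -/

/-- A family of subspaces with `⁅𝓛 m, 𝓛 n⁆ ⊆ 𝓛 (m + n)`. -/
def IsLieFamily {K R : Type*} [Field K] [LieRing R] [LieAlgebra K R] (𝓛 : ℕ+ → Submodule K R) :
    Prop :=
  ∀ {m n : ℕ+} {x y : R}, x ∈ 𝓛 m → y ∈ 𝓛 n → ⁅x, y⁆ ∈ 𝓛 (m + n)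

section PowerSpan

variable {p : ℕ} {K R : Type*} [Field K] [LieRing R] [LieAlgebra K R]

theorem lieCoeff_mem {S : Submodule K R} (hS : ∀ x ∈ S, ∀ y ∈ S, ⁅x, y⁆ ∈ S) {x y : R}
    (hx : x ∈ S) (hy : y ∈ S) (n k : ℕ) : lieCoeff x y n k ∈ S := by
  induction n generalizing k with
  | zero => cases k <;> simp [lieCoeff, hx]
  | succ n ih =>
    cases k with
    | zero => exact hS _ hy _ (ih 0)
    | succ k => exact add_mem (hS _ hx _ (ih k)) (hS _ hy _ (ih (k + 1)))

theorem jacobsonSum_mem {S : Submodule K R} (hS : ∀ x ∈ S, ∀ y ∈ S, ⁅x, y⁆ ∈ S) {x y : R}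
    (hx : x ∈ S) (hy : y ∈ S) : jacobsonSum p K x y ∈ S :=
  sum_mem fun _ _ => S.smul_mem _ (lieCoeff_mem hS hx hy _ _)

variable [RestrictedLieAlgebra p K R]

theorem pPow_add' (x y : R) :
    pPow p K (x + y) = pPow p K x + pPow p K y + jacobsonSum p K x y := pPow_add p x y

theorem iterate_pPow_lie (j : ℕ) (x y : R) :
    ⁅((pPow p K)^[j] x : R), y⁆ = (fun z : R => ⁅x, z⁆)^[p ^ j] y := by
  have key : ∀ y, ⁅((pPow p K)^[j] x : R), y⁆ = (fun z : R => ⁅x, z⁆)^[p ^ j] y := by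
    induction j with
    | zero => intro y; rfl
    | succ j ih =>
      intro y
      rw [Function.iterate_succ_apply', pPow_lie, pow_succ, Function.iterate_mul]
      exact congrFun (congrArg (fun f : R → R => f^[p]) (funext ih)) y
  exact key y

/-- The subspace spanned by the `p ^ j`-th powers, `j < J`, of elements of degree `i`, where
`i * p ^ j = n`. -/
def powerSpanLT (p : ℕ) {K R : Type*} [Field K] [LieRing R] [LieAlgebra K R]
    [RestrictedLieAlgebra p K R] (𝓛 : ℕ+ → Submodule K R) (n : ℕ+) (J : ℕ) : Submodule K R :=
  Submodule.span K {z | ∃ (i : ℕ+) (j : ℕ) (a : R), j < J ∧ (i : ℕ) * p ^ j = n ∧ a ∈ 𝓛 i ∧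
    z = (pPow p K)^[j] a}

/-- The subspace spanned by the `p ^ j`-th powers of elements of degree `i`, where
`i * p ^ j = n`. -/
def powerSpan (p : ℕ) {K R : Type*} [Field K] [LieRing R] [LieAlgebra K R]
    [RestrictedLieAlgebra p K R] (𝓛 : ℕ+ → Submodule K R) (n : ℕ+) : Submodule K R :=
  Submodule.span K {z | ∃ (i : ℕ+) (j : ℕ) (a : R), (i : ℕ) * p ^ j = n ∧ a ∈ 𝓛 i ∧
    z = (pPow p K)^[j] a}

variable {𝓛 : ℕ+ → Submodule K R}

theorem iterate_pPow_mem_powerSpan {n i : ℕ+} {j : ℕ} {a : R} (h : (i : ℕ) * p ^ j = n)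
    (ha : a ∈ 𝓛 i) : (pPow p K)^[j] a ∈ powerSpan p 𝓛 n :=
  Submodule.subset_span ⟨i, j, a, h, ha, rfl⟩

theorem iterate_pPow_mem_powerSpanLT {n i : ℕ+} {j J : ℕ} {a : R} (hj : j < J)
    (h : (i : ℕ) * p ^ j = n) (ha : a ∈ 𝓛 i) : (pPow p K)^[j] a ∈ powerSpanLT p 𝓛 n J :=
  Submodule.subset_span ⟨i, j, a, hj, h, ha, rfl⟩

theorem le_powerSpan (n : ℕ+) : 𝓛 n ≤ powerSpan p 𝓛 n :=
  fun _ ha => iterate_pPow_mem_powerSpan (j := 0) (by simp) ha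

theorem powerSpanLT_le (n : ℕ+) (J : ℕ) : powerSpanLT p 𝓛 n J ≤ powerSpan p 𝓛 n :=
  Submodule.span_mono fun _ ⟨i, j, a, _, h⟩ => ⟨i, j, a, h⟩

theorem powerSpan_eq [hp : Fact p.Prime] (n : ℕ+) : powerSpan p 𝓛 n = powerSpanLT p 𝓛 n n := by
  refine le_antisymm (Submodule.span_mono ?_) (powerSpanLT_le n n)
  rintro _ ⟨i, j, a, h, ha⟩
  refine ⟨i, j, a, ?_, h, ha⟩
  have h1 := Nat.lt_pow_self (n := j) hp.out.one_lt
  have h2 := Nat.le_mul_of_pos_left (p ^ j) i.pos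
  omega

theorem iterate_lie_mem (h𝓛 : IsLieFamily 𝓛) {i m : ℕ+} {a b : R} (ha : a ∈ 𝓛 i)
    (hb : b ∈ 𝓛 m) (k : ℕ) (n : ℕ+) (hn : (n : ℕ) = k * i + m) : (fun z => ⁅a, z⁆)^[k] b ∈ 𝓛 n := by
  induction k generalizing n with
  | zero =>
    have : n = m := PNat.coe_injective (by simpa using hn)
    rwa [this]
  | succ k ih =>
    rw [Function.iterate_succ_apply']
    obtain ⟨N, hN⟩ : ∃ N : ℕ+, (N : ℕ) = k * i + m := ⟨⟨k * i + m, by have := m.pos; omega⟩, rfl⟩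
    have e : n = i + N := PNat.coe_injective (by rw [hn, PNat.add_coe, hN]; ring)
    rw [e]
    exact h𝓛 ha (ih _ hN)

/-- Since `ad (a^[p]) = ad (a) ^ p`, brackets of `p ^ j`-th powers are iterated brackets of
elements of the family. -/
theorem powerSpan_lie [hp : Fact p.Prime] (h𝓛 : IsLieFamily 𝓛) {m n : ℕ+} {x y : R}
    (hx : x ∈ powerSpan p 𝓛 m) (hy : y ∈ powerSpan p 𝓛 n) : ⁅x, y⁆ ∈ 𝓛 (m + n) := by
  induction hx using Submodule.span_induction with
  | zero => rw [zero_lie]; exact zero_mem _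
  | add x x' _ _ hx hx' => rw [add_lie]; exact add_mem hx hx'
  | smul c x _ hx => rw [smul_lie]; exact Submodule.smul_mem _ _ hx
  | mem x hx =>
    obtain ⟨i, j, a, hi, ha, rfl⟩ := hx
    induction hy using Submodule.span_induction with
    | zero => rw [lie_zero]; exact zero_mem _
    | add x x' _ _ hx hx' => rw [lie_add]; exact add_mem hx hx'
    | smul c x _ hx => rw [lie_smul]; exact Submodule.smul_mem _ _ hx
    | mem y hy =>
      obtain ⟨l, k, b, hl, hb, rfl⟩ := hy
      have h1 : ⁅((pPow p K)^[j] a : R), b⁆ ∈ 𝓛 (m + l) := by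
        rw [iterate_pPow_lie]
        exact iterate_lie_mem h𝓛 ha hb _ _ (by rw [PNat.add_coe, ← hi]; ring)
      obtain ⟨q, hq⟩ := Nat.exists_eq_succ_of_ne_zero (pow_pos hp.out.pos k).ne'
      rw [← lie_skew, iterate_pPow_lie, hq, Function.iterate_succ_apply, ← lie_skew b, neg_mem_iff]
      refine iterate_lie_mem h𝓛 hb (neg_mem h1) _ _ ?_
      rw [PNat.add_coe, PNat.add_coe, ← hl, hq, Nat.succ_eq_add_one]
      ring

theorem jacobsonSum_mem_of_powerSpan [hp : Fact p.Prime] (h𝓛 : IsLieFamily 𝓛) {n : ℕ+} {x y : R}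
    (hx : x ∈ powerSpan p 𝓛 n) (hy : y ∈ powerSpan p 𝓛 n) :
    jacobsonSum p K x y ∈ 𝓛 (primePNat p * n) := by
  have key : ∀ (m k : ℕ) (N : ℕ+), (N : ℕ) = (m + 2) * n → lieCoeff x y (m + 1) k ∈ 𝓛 N := by
    intro m
    induction m with
    | zero =>
      intro k N hN
      have e : N = n + n := PNat.coe_injective (by rw [hN, PNat.add_coe]; ring)
      rw [e]
      rcases k with _ | _ | k
      · exact powerSpan_lie h𝓛 hy hx
      · exact add_mem (powerSpan_lie h𝓛 hx hx) (powerSpan_lie h𝓛 hy (zero_mem _))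
      · exact add_mem (powerSpan_lie h𝓛 hx (zero_mem _)) (powerSpan_lie h𝓛 hy (zero_mem _))
    | succ m ih =>
      intro k N hN
      obtain ⟨N', hN'⟩ : ∃ N' : ℕ+, (N' : ℕ) = (m + 2) * n :=
        ⟨⟨(m + 2) * n, Nat.mul_pos (by omega) n.pos⟩, rfl⟩
      have e : N = n + N' := PNat.coe_injective (by rw [hN, PNat.add_coe, hN']; ring)
      have h1 : ∀ k, lieCoeff x y (m + 1) k ∈ powerSpan p 𝓛 N' :=
        fun k => le_powerSpan _ (ih k _ hN')
      rw [e]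
      cases k with
      | zero => exact powerSpan_lie h𝓛 hy (h1 0)
      | succ k => exact add_mem (powerSpan_lie h𝓛 hx (h1 k)) (powerSpan_lie h𝓛 hy (h1 (k + 1)))
  refine sum_mem fun k _ => Submodule.smul_mem _ _ ?_
  have hp2 := hp.out.two_le
  have e : p - 1 = p - 2 + 1 := by omega
  rw [jacobsonS, e]
  refine key _ _ _ ?_
  rw [PNat.mul_coe, coe_primePNat, Nat.sub_add_cancel hp2]

theorem powerSpanLT_pPow [hp : Fact p.Prime] (h𝓛 : IsLieFamily 𝓛) {n : ℕ+} {J : ℕ} {x : R}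
    (hx : x ∈ powerSpanLT p 𝓛 n J) : pPow p K x ∈ powerSpanLT p 𝓛 (primePNat p * n) (J + 1) := by
  induction hx using Submodule.span_induction with
  | zero =>
    have := pPow_smul p (0 : K) (0 : R)
    rw [smul_zero, zero_pow hp.out.ne_zero, zero_smul] at this
    rw [this]
    exact zero_mem _
  | smul c x _ hx => rw [pPow_smul]; exact Submodule.smul_mem _ _ hx
  | add x y hx hy hx' hy' =>
    rw [pPow_add']
    refine add_mem (add_mem hx' hy') ?_
    exact iterate_pPow_mem_powerSpanLT (j := 0) (Nat.succ_pos J) (by simp)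
      (jacobsonSum_mem_of_powerSpan h𝓛 (powerSpanLT_le _ _ hx) (powerSpanLT_le _ _ hy))
  | mem x hx =>
    obtain ⟨i, j, a, hj, hi, ha, rfl⟩ := hx
    rw [← Function.iterate_succ_apply' (pPow p K)]
    refine iterate_pPow_mem_powerSpanLT (Nat.succ_lt_succ hj) ?_ ha
    rw [PNat.mul_coe, coe_primePNat, ← hi, pow_succ]
    ring

theorem powerSpan_pPow [Fact p.Prime] (h𝓛 : IsLieFamily 𝓛) {n : ℕ+} {x : R}
    (hx : x ∈ powerSpan p 𝓛 n) : pPow p K x ∈ powerSpan p 𝓛 (primePNat p * n) := by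
  rw [powerSpan_eq] at hx
  exact powerSpanLT_le _ _ (powerSpanLT_pPow h𝓛 hx)

theorem iSup_powerSpan_lie [Fact p.Prime] (h𝓛 : IsLieFamily 𝓛) {x y : R}
    (hx : x ∈ ⨆ n, powerSpan p 𝓛 n) (hy : y ∈ ⨆ n, powerSpan p 𝓛 n) :
    ⁅x, y⁆ ∈ ⨆ n, powerSpan p 𝓛 n := by
  induction hx using Submodule.iSup_induction' with
  | zero => rw [zero_lie]; exact zero_mem _
  | add x x' _ _ hx hx' => rw [add_lie]; exact add_mem hx hx'
  | mem m x hx =>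
    induction hy using Submodule.iSup_induction' with
    | zero => rw [lie_zero]; exact zero_mem _
    | add x x' _ _ hx hx' => rw [lie_add]; exact add_mem hx hx'
    | mem n y hy =>
      exact Submodule.mem_iSup_of_mem (m + n) (le_powerSpan _ (powerSpan_lie h𝓛 hx hy))

theorem iSup_powerSpan_pPow [hp : Fact p.Prime] (h𝓛 : IsLieFamily 𝓛) {x : R}
    (hx : x ∈ ⨆ n, powerSpan p 𝓛 n) : pPow p K x ∈ ⨆ n, powerSpan p 𝓛 n := by
  induction hx using Submodule.iSup_induction' with
  | zero =>
    have := pPow_smul p (0 : K) (0 : R)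
    rw [smul_zero, zero_pow hp.out.ne_zero, zero_smul] at this
    rw [this]
    exact zero_mem _
  | add x y hx hy hx' hy' =>
    rw [pPow_add']
    exact add_mem (add_mem hx' hy')
      (jacobsonSum_mem (fun _ h _ h' => iSup_powerSpan_lie h𝓛 h h') hx hy)
  | mem n x hx => exact Submodule.mem_iSup_of_mem _ (powerSpan_pPow h𝓛 hx)

/-- The `p ^ j`-th power is additive in a fixed degree, up to lower powers. -/
theorem iterate_pPow_add [hp : Fact p.Prime] (h𝓛 : IsLieFamily 𝓛) {i n : ℕ+} {j : ℕ} {x y : R}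
    (hx : x ∈ 𝓛 i) (hy : y ∈ 𝓛 i) (hn : (i : ℕ) * p ^ j = n) :
    (pPow p K)^[j] (x + y) - (pPow p K)^[j] x - (pPow p K)^[j] y ∈ powerSpanLT p 𝓛 n j := by
  induction j generalizing n with
  | zero => simp
  | succ j ih =>
    obtain ⟨m, hm⟩ : ∃ m : ℕ+, (i : ℕ) * p ^ j = m :=
      ⟨⟨i * p ^ j, Nat.mul_pos i.pos (pow_pos hp.out.pos j)⟩, rfl⟩
    have e : n = primePNat p * m := PNat.coe_injective (by
      rw [← hn, PNat.mul_coe, coe_primePNat, ← hm, pow_succ]; ring)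
    have h := ih hm
    rw [Function.iterate_succ_apply', Function.iterate_succ_apply', Function.iterate_succ_apply', e]
    have hX : (pPow p K)^[j] x ∈ powerSpan p 𝓛 m := iterate_pPow_mem_powerSpan hm hx
    have hY : (pPow p K)^[j] y ∈ powerSpan p 𝓛 m := iterate_pPow_mem_powerSpan hm hy
    generalize hv : (pPow p K)^[j] (x + y) - (pPow p K)^[j] x - (pPow p K)^[j] y = v at h
    have e2 : (pPow p K)^[j] (x + y) = (pPow p K)^[j] x + (pPow p K)^[j] y + v := by
      rw [← hv]; abel
    rw [e2, pPow_add', pPow_add']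
    generalize (pPow p K)^[j] x = X at *
    generalize (pPow p K)^[j] y = Y at *
    have h0 : ∀ z ∈ 𝓛 (primePNat p * m), z ∈ powerSpanLT p 𝓛 (primePNat p * m) (j + 1) :=
      fun z hz => iterate_pPow_mem_powerSpanLT (j := 0) (Nat.succ_pos j) (by simp) hz
    have h1 := h0 _ (jacobsonSum_mem_of_powerSpan h𝓛 hX hY)
    have h2 := h0 _ (jacobsonSum_mem_of_powerSpan h𝓛 (add_mem hX hY) (powerSpanLT_le _ _ h))
    have h3 := powerSpanLT_pPow h𝓛 h
    convert add_mem (add_mem h1 h3) h2 using 1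
    abel

end PowerSpan

section PowerSpanZMod

variable {p : ℕ} [hp : Fact p.Prime] {R : Type*} [LieRing R] [LieAlgebra (ZMod p) R]
  [RestrictedLieAlgebra p (ZMod p) R]

theorem iterate_pPow_smul (c : ZMod p) (x : R) (j : ℕ) :
    (pPow p (ZMod p))^[j] (c • x) = c • (pPow p (ZMod p))^[j] x := by
  induction j with
  | zero => rfl
  | succ j ih =>
    rw [Function.iterate_succ_apply', Function.iterate_succ_apply', ih, pPow_smul, ZMod.pow_card]

/-- Over the prime field the `p ^ J`-th power is linear in a fixed degree, up to lower powers, so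
that a sum of `p ^ J`-th powers is a single one up to lower powers. -/
theorem exists_of_mem_powerSpanLT_succ {𝓛 : ℕ+ → Submodule (ZMod p) R}
    (h𝓛 : IsLieFamily 𝓛) {n : ℕ+} {J : ℕ}
    {i : ℕ+} (hi : (i : ℕ) * p ^ J = n) {z : R} (hz : z ∈ powerSpanLT p 𝓛 n (J + 1)) :
    ∃ a ∈ 𝓛 i, ∃ v ∈ powerSpanLT p 𝓛 n J, z = (pPow p (ZMod p))^[J] a + v := by
  have h0 : ∀ v ∈ powerSpanLT p 𝓛 n J, ∃ a ∈ 𝓛 i, ∃ v' ∈ powerSpanLT p 𝓛 n J,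
      v = (pPow p (ZMod p))^[J] a + v' := by
    intro v hv
    refine ⟨0, zero_mem _, v, hv, ?_⟩
    have := iterate_pPow_smul (p := p) 0 (0 : R) J
    rw [smul_zero, zero_smul] at this
    rw [this, zero_add]
  induction hz using Submodule.span_induction with
  | zero => exact h0 0 (zero_mem _)
  | smul c z _ hz =>
    obtain ⟨a, ha, v, hv, rfl⟩ := hz
    refine ⟨c • a, Submodule.smul_mem _ _ ha, c • v, Submodule.smul_mem _ _ hv, ?_⟩
    rw [smul_add, iterate_pPow_smul]
  | add z z' _ _ hz hz' =>
    obtain ⟨a, ha, v, hv, rfl⟩ := hz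
    obtain ⟨a', ha', v', hv', rfl⟩ := hz'
    refine ⟨a + a', add_mem ha ha', _,
      sub_mem (add_mem hv hv') (iterate_pPow_add h𝓛 ha ha' hi), ?_⟩
    abel
  | mem z hz =>
    obtain ⟨l, j, a, hj, hl, ha, rfl⟩ := hz
    rcases Nat.lt_succ_iff_lt_or_eq.1 hj with h | rfl
    · exact h0 _ (iterate_pPow_mem_powerSpanLT h hl ha)
    · have : l = i := PNat.coe_injective
        (Nat.eq_of_mul_eq_mul_right (pow_pos hp.out.pos j) (hl.trans hi.symm))
      subst this
      exact ⟨a, ha, 0, zero_mem _, (add_zero _).symm⟩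

theorem powerSpanLT_succ_of_forall_ne {𝓛 : ℕ+ → Submodule (ZMod p) R} {n : ℕ+} {J : ℕ}
    (hi : ∀ i : ℕ+, (i : ℕ) * p ^ J ≠ n) : powerSpanLT p 𝓛 n (J + 1) = powerSpanLT p 𝓛 n J := by
  refine congrArg (Submodule.span (ZMod p)) (Set.ext fun z => ?_)
  constructor
  · rintro ⟨l, j, a, hj, hl, ha⟩
    refine ⟨l, j, a, ?_, hl, ha⟩
    rcases Nat.lt_succ_iff_lt_or_eq.1 hj with h | rfl
    · exact h
    · exact absurd hl (hi l)
  · rintro ⟨l, j, a, hj, hl, ha⟩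
    exact ⟨l, j, a, hj.trans (Nat.lt_succ_self _), hl, ha⟩

end PowerSpanZMod

/-! ### The grading of the restrictification -/

section Restrictification

variable {p : ℕ} {K L : Type*} [Field K] [LieRing L] [LieAlgebra K L]

namespace Restrictification

@[elab_as_elim]
theorem induction {P : Restrictification p K L → Prop} (x : Restrictification p K L)
    (hι : ∀ a, P (ι p K L a)) (hadd : ∀ x y, P x → P y → P (x + y))
    (hsmul : ∀ (c : K) x, P x → P (c • x)) (hlie : ∀ x y, P x → P y → P ⁅x, y⁆)
    (hpow : ∀ x, P x → P (MagnusZassenhaus.pPow p K x)) : P x := by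
  obtain ⟨a⟩ := x
  induction a with
  | of x => exact hι x
  | zero =>
    have := hι 0
    rwa [map_zero] at this
  | add a b ha hb => exact hadd _ _ ha hb
  | smul r a ha => exact hsmul r _ ha
  | lie a b ha hb => exact hlie _ _ ha hb
  | pPow a ha => exact hpow _ ha

/-- The restrictification is generated, as a restricted Lie algebra, by the Lie algebra. -/
theorem eq_top_of_ι_mem {S : Submodule K (Restrictification p K L)}
    (hS : ∀ x ∈ S, ∀ y ∈ S, ⁅x, y⁆ ∈ S) (hP : ∀ x ∈ S, MagnusZassenhaus.pPow p K x ∈ S)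
    (h : ∀ a, ι p K L a ∈ S) : S = ⊤ := by
  refine eq_top_iff.2 fun x _ => ?_
  induction x using induction with
  | hι a => exact h a
  | hadd x y hx hy => exact add_mem (hx trivial) (hy trivial)
  | hsmul c x hx => exact S.smul_mem c (hx trivial)
  | hlie x y hx hy => exact hS _ (hx trivial) _ (hy trivial)
  | hpow x hx => exact hP _ (hx trivial)

theorem grading_eq_powerSpan (𝓛 : ℕ+ → Submodule K L) (n : ℕ+) :
    grading p 𝓛 n = powerSpan p (fun i => (𝓛 i).map (ι p K L : L →ₗ[K] _)) n := by
  refine congrArg _ (Set.ext fun z => ?_)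
  constructor
  · rintro ⟨i, j, a, h, ha, rfl⟩
    exact ⟨i, j, _, h, Submodule.mem_map_of_mem ha, rfl⟩
  · rintro ⟨i, j, _, h, ⟨a, ha, rfl⟩, rfl⟩
    exact ⟨i, j, a, h, ha, rfl⟩

/-- If `g` multiplies the elements of degree `n` of `L` by `t ^ n`, then so does its extension to
the restrictification. -/
theorem lift_eq_monom [Fact p.Prime] [CharP K p] {𝓛 : ℕ+ → Submodule K L}
    (g : L →ₗ⁅K⁆ PolyLie K ℕ (Restrictification p K L))
    (hg : ∀ (n : ℕ+), ∀ a ∈ 𝓛 n, g a = PolyLie.monom K (n : ℕ) (ι p K L a)) {n : ℕ+}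
    {x : Restrictification p K L} (hx : x ∈ grading p 𝓛 n) :
    lift (p := p) g x = PolyLie.monom K (n : ℕ) x := by
  induction hx using Submodule.span_induction with
  | zero => rw [map_zero]; exact (map_zero _).symm
  | add x y _ _ hx hy => rw [(lift (p := p) g).map_add, hx, hy, map_add]
  | smul c x _ hx => rw [(lift (p := p) g).map_smul, hx, map_smul]
  | mem x hx =>
    obtain ⟨i, j, a, h, ha, rfl⟩ := hx
    have key : ∀ j, lift (p := p) g ((MagnusZassenhaus.pPow p K)^[j] (ι p K L a)) =
        PolyLie.monom K (i * p ^ j) ((MagnusZassenhaus.pPow p K)^[j] (ι p K L a)) := by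
      intro j
      induction j with
      | zero => rw [pow_zero, mul_one]; exact hg i a ha
      | succ j ih =>
        rw [Function.iterate_succ_apply', RestrictedLieHom.map_pPow, ih, PolyLie.pPow_monom]
        congr 2
        ring
    rw [key, h]

/-- The restrictification of a graded Lie algebra is graded. The grading of `L` is given by the
homomorphism `g`, which sends `a` of degree `n` to `t ^ n ι(a)`; the components are independent
because the extension of `g` to the restrictification separates them. -/
theorem isNGraded_grading [Fact p.Prime] [CharP K p] {𝓛 : ℕ+ → Submodule K L}
    (h𝓛 : IsLieFamily 𝓛) (htop : ⨆ n, 𝓛 n = ⊤)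
    (g : L →ₗ⁅K⁆ PolyLie K ℕ (Restrictification p K L))
    (hg : ∀ (n : ℕ+), ∀ a ∈ 𝓛 n, g a = PolyLie.monom K (n : ℕ) (ι p K L a)) :
    IsNGraded p (grading p 𝓛) := by
  have h𝓛' : IsLieFamily fun n => (𝓛 n).map (ι p K L : L →ₗ[K] Restrictification p K L) := by
    rintro m n _ _ ⟨a, ha, rfl⟩ ⟨b, hb, rfl⟩
    exact ⟨⁅a, b⁆, h𝓛 ha hb, LieHom.map_lie _ _ _⟩
  have hsup : ⨆ n, grading p 𝓛 n = ⊤ := by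
    simp only [grading_eq_powerSpan]
    refine eq_top_of_ι_mem (fun x hx y hy => iSup_powerSpan_lie h𝓛' hx hy)
      (fun x hx => iSup_powerSpan_pPow h𝓛' hx) fun a => ?_
    have ha : a ∈ ⨆ n, 𝓛 n := htop ▸ Submodule.mem_top
    induction ha using Submodule.iSup_induction' with
    | zero => rw [map_zero]; exact zero_mem _
    | add x y _ _ hx hy => rw [map_add]; exact add_mem hx hy
    | mem n x hx =>
      exact Submodule.mem_iSup_of_mem n (le_powerSpan n (Submodule.mem_map_of_mem hx))
  refine ⟨⟨?_, ?_⟩, fun {m n x y} hx hy => ?_, fun {n x} hx => ?_⟩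
  · rw [injective_iff_map_eq_zero]
    intro f hf
    have key : ∀ (f : DirectSum ℕ+ fun n => grading p 𝓛 n) (n : ℕ+),
        PolyLie.coeffs (lift (p := p) g (DirectSum.coeAddMonoidHom (grading p 𝓛) f)) (n : ℕ) =
          f n := by
      intro f n
      induction f using DirectSum.induction_on with
      | zero =>
        rw [map_zero]
        have : lift (p := p) g (0 : Restrictification p K L) = 0 :=
          map_zero (lift (p := p) g).toLieHom
        rw [this]
        simp
      | add f f' hf hf' =>
        rw [map_add, (lift (p := p) g).map_add, map_add, Finsupp.add_apply, hf, hf']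
        rfl
      | of m x =>
        rw [DirectSum.coeAddMonoidHom_of, lift_eq_monom g hg x.2, PolyLie.coeffs_monom]
        by_cases h : m = n
        · subst h
          rw [Finsupp.single_eq_same, DirectSum.of_eq_same]
        · rw [Finsupp.single_eq_of_ne fun h' => h (PNat.coe_injective h'.symm),
            DirectSum.of_eq_of_ne _ _ _ (Ne.symm h)]
          rfl
    refine DFinsupp.ext fun n => Subtype.ext ?_
    rw [← key, hf]
    have : lift (p := p) g (0 : Restrictification p K L) = 0 := map_zero (lift (p := p) g).toLieHom
    rw [this]
    simp
  · intro x
    have hx : x ∈ LinearMap.range (DirectSum.coeLinearMap (grading p 𝓛)) := by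
      rw [DirectSum.range_coeLinearMap, hsup]
      exact Submodule.mem_top
    exact hx
  · rw [grading_eq_powerSpan] at *
    exact le_powerSpan _ (powerSpan_lie h𝓛' hx hy)
  · rw [grading_eq_powerSpan] at *
    exact powerSpan_pPow h𝓛' hx

end Restrictification

end Restrictification

/-! ### Subgroups given by classes in the associated graded Lie ring -/

section Preimage

variable {G : Type*} [Group G] (Γ : CentralSeries G)

/-- The subgroup of the elements of `Γ n` whose class in `Γ n / Γ (n + 1)` lies in `V`. -/
def CentralSeries.preimage (n : ℕ+) (V : AddSubgroup (Γ.Piece n)) : Subgroup G where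
  carrier := {g | ∃ hg : g ∈ Γ n, Piece.mk ⟨g, hg⟩ ∈ V}
  one_mem' := ⟨one_mem _, V.zero_mem⟩
  mul_mem' := fun ⟨hg, h⟩ ⟨hg', h'⟩ => ⟨mul_mem hg hg', V.add_mem h h'⟩
  inv_mem' := fun ⟨hg, h⟩ => ⟨inv_mem hg, V.neg_mem h⟩

variable {Γ}

theorem CentralSeries.mem_preimage {n : ℕ+} {V : AddSubgroup (Γ.Piece n)} {g : G} (hg : g ∈ Γ n) :
    g ∈ Γ.preimage n V ↔ Piece.mk ⟨g, hg⟩ ∈ V :=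
  ⟨fun ⟨_, h⟩ => h, fun h => ⟨hg, h⟩⟩

theorem CentralSeries.preimage_le (n : ℕ+) (V : AddSubgroup (Γ.Piece n)) : Γ.preimage n V ≤ Γ n :=
  fun _ ⟨h, _⟩ => h

theorem CentralSeries.Piece.continuous_mk [TopologicalSpace G] (n : ℕ+) :
    Continuous (Piece.mk : Γ n → Γ.Piece n) :=
  continuous_quot_mk

theorem CentralSeries.isClosed_preimage [TopologicalSpace G] {n : ℕ+}
    (hn : IsClosed (Γ n : Set G)) {V : AddSubgroup (Γ.Piece n)}
    (hV : IsClosed (V : Set (Γ.Piece n))) : IsClosed (Γ.preimage n V : Set G) := by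
  have h : (Γ.preimage n V : Set G) = Subtype.val '' ((Piece.mk : Γ n → Γ.Piece n) ⁻¹' V) := by
    ext g
    exact ⟨fun ⟨hg, h⟩ => ⟨⟨g, hg⟩, h, rfl⟩, fun ⟨⟨_, hg⟩, h, e⟩ => e ▸ ⟨hg, h⟩⟩
  rw [h]
  exact hn.isClosedEmbedding_subtypeVal.isClosedMap _ (hV.preimage (Piece.continuous_mk n))

end Preimage

section Gamma

variable {G : Type*} [Group G] [TopologicalSpace G] [IsTopologicalGroup G]

theorem gammaSeries_succ (n : ℕ+) : gammaSeries G (n + 1) =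
    (⁅gammaSeries G n, (⊤ : Subgroup G)⁆).topologicalClosure := by
  have : (n + 1).natPred = n.natPred + 1 := by
    have := PNat.natPred_add_one n
    have := PNat.natPred_add_one (n + 1)
    rw [PNat.add_coe, PNat.one_coe] at this
    omega
  show closedLowerCentralSeries G (n + 1).natPred = _
  rw [this]
  rfl

theorem isClosed_gammaSeries (n : ℕ+) : IsClosed (gammaSeries G n : Set G) := by
  induction n using PNat.recOn with
  | one => rw [(gammaSeries G).one_eq_top]; exact isClosed_univ
  | succ n _ => rw [gammaSeries_succ]; exact Subgroup.isClosed_topologicalClosure _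

/-- The closed lower central series descends faster than any other closed central series. -/
theorem gammaSeries_le {W : ℕ+ → Subgroup G} (h1 : W 1 = ⊤) (hcl : ∀ n, IsClosed (W n : Set G))
    (hcomm : ∀ n, ∀ g ∈ gammaSeries G n, g ∈ W n → ∀ h, ⁅g, h⁆ ∈ W (n + 1)) (n : ℕ+) :
    gammaSeries G n ≤ W n := by
  induction n using PNat.recOn with
  | one => rw [h1]; exact le_top
  | succ n ih =>
    rw [gammaSeries_succ]
    refine Subgroup.topologicalClosure_minimal _ ?_ (hcl _)
    exact Subgroup.commutator_le.2 fun g hg h _ => hcomm n g hg (ih hg) h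

end Gamma

/-! ### The grading of the restrictification of the Magnus Lie algebra -/

section Magnus

variable (p : ℕ) [hp : Fact p.Prime]

theorem zmod_smul_eq_nsmul {A : Type*} [AddCommGroup A] [Module (ZMod p) A] (c : ZMod p) (x : A) :
    c • x = c.val • x := by
  conv_lhs => rw [← ZMod.natCast_zmod_val c]
  rw [Nat.cast_smul_eq_nsmul]

variable (G : Type*) [Group G] [TopologicalSpace G] [IsTopologicalGroup G]

/-- The map `γ_n(G) / γ_{n+1}(G) → gr^M(G) ⊗ 𝔽_p`. -/
noncomputable def pieceM (n : ℕ+) : (gammaSeries G).Piece n →+ GrMp p G :=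
  (TensorProduct.mk ℤ (ZMod p) (GrM G) 1).toAddMonoidHom.comp ((gammaSeries G).of n)

theorem mem_gradingM {n : ℕ+} {x : GrMp p G} :
    x ∈ gradingM p G n ↔ ∃ a, x = pieceM p G n a := by
  constructor
  · intro hx
    induction hx using Submodule.span_induction with
    | mem x hx => exact hx
    | zero => exact ⟨0, (map_zero _).symm⟩
    | add x y _ _ hx hy =>
      obtain ⟨a, rfl⟩ := hx
      obtain ⟨b, rfl⟩ := hy
      exact ⟨a + b, (map_add _ _ _).symm⟩
    | smul c x _ hx =>
      obtain ⟨a, rfl⟩ := hx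
      exact ⟨c.val • a, by rw [map_nsmul, zmod_smul_eq_nsmul]⟩
  · rintro ⟨a, rfl⟩
    exact Submodule.subset_span ⟨a, rfl⟩

theorem pieceM_lie {m n : ℕ+} (a : (gammaSeries G).Piece m) (b : (gammaSeries G).Piece n) :
    ⁅pieceM p G m a, pieceM p G n b⁆ = pieceM p G (m + n) ((gammaSeries G).pieceLie m n a b) := by
  refine (ExtendScalars.bracket_tmul ℤ (ZMod p) (GrM G) (GrM G) 1 1 _ _).trans ?_
  rw [of_lie_of, mul_one]
  rfl

theorem isLieFamily_gradingM : IsLieFamily (gradingM p G) := by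
  intro m n x y hx hy
  obtain ⟨a, rfl⟩ := (mem_gradingM p G).1 hx
  obtain ⟨b, rfl⟩ := (mem_gradingM p G).1 hy
  exact (mem_gradingM p G).2 ⟨_, pieceM_lie p G a b⟩

theorem iSup_gradingM : ⨆ n, gradingM p G n = ⊤ := by
  refine eq_top_iff.2 fun x _ => ?_
  induction x using TensorProduct.induction_on with
  | zero => exact zero_mem _
  | add x y hx hy => exact add_mem (hx trivial) (hy trivial)
  | tmul c x =>
    have : c ⊗ₜ[ℤ] x = c • ((1 : ZMod p) ⊗ₜ[ℤ] x) := by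
      rw [TensorProduct.smul_tmul', smul_eq_mul, mul_one]
    rw [this]
    refine Submodule.smul_mem _ _ ?_
    clear this
    induction x using Gr.ind with
    | hof n g =>
      exact Submodule.mem_iSup_of_mem n ((mem_gradingM p G).2 ⟨_, rfl⟩)
    | h0 => rw [TensorProduct.tmul_zero]; exact zero_mem _
    | hadd x y hx hy =>
      rw [TensorProduct.tmul_add]
      exact add_mem (hx trivial) (hy trivial)

/-- The map `gr^M(G) → 𝔽_p[t] ⊗ (gr^M(G) ⊗ 𝔽_p)^[p]` that multiplies the elements of degree `n` by
`t ^ n`, as a homomorphism of groups. -/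
noncomputable def degreeHom : GrM G →+ PolyLie (ZMod p) ℕ (GrMpRes p G) :=
  Gr.lift (gammaSeries G) fun n => (PolyLie.monom (ZMod p) (n : ℕ)).toAddMonoidHom.comp
    ((Restrictification.ι p (ZMod p) (GrMp p G)).toLinearMap.toAddMonoidHom.comp (pieceM p G n))

theorem degreeHom_of (n : ℕ+) (a : (gammaSeries G).Piece n) :
    degreeHom p G ((gammaSeries G).of n a) =
      PolyLie.monom (ZMod p) (n : ℕ) (Restrictification.ι p (ZMod p) _ (pieceM p G n a)) := by
  rw [degreeHom, Gr.lift_of]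
  rfl

/-- The homomorphism of Lie rings `gr^M(G) → 𝔽_p[t] ⊗ (gr^M(G) ⊗ 𝔽_p)^[p]` that multiplies the
elements of degree `n` by `t ^ n`. -/
noncomputable def degreeM : GrM G →ₗ⁅ℤ⁆ PolyLie (ZMod p) ℕ (GrMpRes p G) :=
  { (degreeHom p G).toIntLinearMap with
    map_lie' := by
      intro x y
      show degreeHom p G ⁅x, y⁆ = ⁅degreeHom p G x, degreeHom p G y⁆
      induction x using Gr.ind with
      | h0 => rw [zero_lie, map_zero, zero_lie]
      | hadd x x' hx hx' => rw [add_lie, map_add, map_add, add_lie, hx, hx']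
      | hof m g =>
        induction y using Gr.ind with
        | h0 => rw [lie_zero, map_zero, lie_zero]
        | hadd y y' hy hy' => rw [lie_add, map_add, map_add, lie_add, hy, hy']
        | hof n g' =>
          rw [of_lie_of, degreeHom_of, degreeHom_of, degreeHom_of, PolyLie.monom_lie_monom,
            ← LieHom.map_lie, pieceM_lie]
          rfl }

theorem isNGraded_gradingMRes : IsNGraded p (gradingMRes p G) := by
  refine Restrictification.isNGraded_grading (isLieFamily_gradingM p G) (iSup_gradingM p G)
    (liftLie (ZMod p) (degreeM p G)) fun n a ha => ?_
  obtain ⟨a, rfl⟩ := (mem_gradingM p G).1 ha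
  show liftLie (ZMod p) (degreeM p G) ((1 : ZMod p) ⊗ₜ[ℤ] (gammaSeries G).of n a) = _
  rw [liftLie_tmul, one_smul]
  exact degreeHom_of p G n a

/-- The elements of `γ_n(G)` whose classes lie in a given closed restricted subalgebra that contains
the component of degree one form a closed subgroup, and these closed subgroups contain the lower
central series by induction. -/
theorem isOneGenerated_gradingMRes : IsOneGenerated p (pieceMRes p G) (gradingMRes p G) := by
  intro S hS hP hcl h1
  let V : ∀ n, AddSubgroup ((gammaSeries G).Piece n) := fun n =>
    S.toAddSubgroup.comap
      ((Restrictification.ι p (ZMod p) (GrMp p G)).toLinearMap.toAddMonoidHom.comp (pieceM p G n))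
  have hdeg : ∀ a, pieceMRes p G 1 a ∈ S := fun a => h1 <|
    Submodule.subset_span ⟨1, 0, pieceM p G 1 a, by simp, (mem_gradingM p G).2 ⟨a, rfl⟩, rfl⟩
  have hW : ∀ n, gammaSeries G n ≤ (gammaSeries G).preimage n (V n) := by
    refine gammaSeries_le ?_ (fun n => isClosed_preimage (isClosed_gammaSeries n) (hcl n)) ?_
    · refine eq_top_iff.2 fun g _ => ?_
      have hg : g ∈ gammaSeries G 1 := by rw [(gammaSeries G).one_eq_top]; trivial
      exact ⟨hg, hdeg _⟩
    · rintro n g hg ⟨_, hgV⟩ h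
      have hh : h ∈ gammaSeries G 1 := by rw [(gammaSeries G).one_eq_top]; trivial
      refine ⟨(gammaSeries G).commutator_mem hg hh, ?_⟩
      have e := hS _ hgV _ (hdeg (Piece.mk ⟨h, hh⟩))
      show Restrictification.ι p (ZMod p) (GrMp p G) (pieceM p G (n + 1) _) ∈ S
      rw [← (gammaSeries G).pieceLie_mk ⟨g, hg⟩ ⟨h, hh⟩, ← pieceM_lie, LieHom.map_lie]
      exact e
  refine Restrictification.eq_top_of_ι_mem hS hP fun a => ?_
  have ha : a ∈ ⨆ n, gradingM p G n := iSup_gradingM p G ▸ Submodule.mem_top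
  induction ha using Submodule.iSup_induction' with
  | zero => rw [map_zero]; exact zero_mem _
  | add x y _ _ hx hy => rw [map_add]; exact add_mem hx hy
  | mem n x hx =>
    obtain ⟨a, rfl⟩ := (mem_gradingM p G).1 hx
    induction a using Piece.ind with | _ g
    exact (mem_preimage g.2).1 (hW n g.2)

end Magnus

/-! ### The grading of the Zassenhaus Lie algebra -/

section Zassenhaus

variable (p : ℕ) [hp : Fact p.Prime] (G : Type*) [Group G] [TopologicalSpace G]

theorem mem_gradingZ {n : ℕ+} {x : GrZ p G} :
    x ∈ gradingZ p G n ↔ ∃ a, x = (zassenhausSeries p G).of n a := by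
  constructor
  · intro hx
    induction hx using Submodule.span_induction with
    | mem x hx => exact hx.imp fun _ => Eq.symm
    | zero => exact ⟨0, (map_zero _).symm⟩
    | add x y _ _ hx hy =>
      obtain ⟨a, rfl⟩ := hx
      obtain ⟨b, rfl⟩ := hy
      exact ⟨a + b, (map_add _ _ _).symm⟩
    | smul c x _ hx =>
      obtain ⟨a, rfl⟩ := hx
      exact ⟨c.val • a, by rw [map_nsmul, zmod_smul_eq_nsmul]⟩
  · rintro ⟨a, rfl⟩
    exact Submodule.subset_span ⟨a, rfl⟩

theorem of_injective (n : ℕ+) : Function.Injective ((zassenhausSeries p G).of n) :=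
  DirectSum.of_injective n

theorem iSup_gradingZ : ⨆ n, gradingZ p G n = ⊤ := by
  refine eq_top_iff.2 fun x _ => ?_
  induction x using Gr.ind with
  | hof n g => exact Submodule.mem_iSup_of_mem n ((mem_gradingZ p G).2 ⟨_, rfl⟩)
  | h0 => exact zero_mem _
  | hadd x y hx hy => exact add_mem (hx trivial) (hy trivial)

theorem isNGraded_gradingZ : IsNGraded p (gradingZ p G) := by
  refine ⟨⟨?_, ?_⟩, fun {m n x y} hx hy => ?_, fun {n x} hx => ?_⟩
  · rw [injective_iff_map_eq_zero]
    intro f hf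
    -- the component in degree `n`
    let π : ∀ n, GrZ p G →+ (zassenhausSeries p G).Piece n := fun n =>
      (DFinsupp.evalAddMonoidHom n :
        (DirectSum ℕ+ fun n => (zassenhausSeries p G).Piece n) →+ (zassenhausSeries p G).Piece n)
    have hπ : ∀ n a, π n ((zassenhausSeries p G).of n a) = a :=
      fun n a => DirectSum.of_eq_same n a
    have hπ' : ∀ m n a, m ≠ n → π n ((zassenhausSeries p G).of m a) = 0 :=
      fun m n a h => DirectSum.of_eq_of_ne _ _ _ (Ne.symm h)
    have key : ∀ (f : DirectSum ℕ+ fun n => gradingZ p G n) (n : ℕ+),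
        (zassenhausSeries p G).of n (π n (DirectSum.coeAddMonoidHom (gradingZ p G) f)) = f n := by
      intro f n
      induction f using DirectSum.induction_on with
      | zero => simp
      | add f f' hf hf' =>
        rw [map_add, map_add, map_add, hf, hf']
        rfl
      | of m x =>
        obtain ⟨x, hx⟩ := x
        obtain ⟨a, rfl⟩ := (mem_gradingZ p G).1 hx
        rw [DirectSum.coeAddMonoidHom_of]
        by_cases h : m = n
        · subst h
          rw [hπ, DirectSum.of_eq_same]
        · rw [hπ' _ _ _ h, DirectSum.of_eq_of_ne _ _ _ (Ne.symm h), map_zero]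
          rfl
    refine DFinsupp.ext fun n => Subtype.ext ?_
    rw [← key, hf]
    simp
  · intro x
    have hx : x ∈ LinearMap.range (DirectSum.coeLinearMap (gradingZ p G)) := by
      rw [DirectSum.range_coeLinearMap, iSup_gradingZ]
      exact Submodule.mem_top
    exact hx
  · obtain ⟨a, rfl⟩ := (mem_gradingZ p G).1 hx
    obtain ⟨b, rfl⟩ := (mem_gradingZ p G).1 hy
    exact (mem_gradingZ p G).2 ⟨_, of_lie_of _ a b⟩
  · obtain ⟨a, rfl⟩ := (mem_gradingZ p G).1 hx
    induction a using Piece.ind with | _ g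
    exact (mem_gradingZ p G).2 ⟨_, pPow_of p G n g⟩

end Zassenhaus

/-! ### Dimension subgroups and restricted central series -/

section WeightSpan

variable {p : ℕ} {G : Type*} [Group G] {Γ : CentralSeries G}

/-- The sum of the weights in a list of group elements with weights. -/
def weightSum (l : List (G × ℕ+)) : ℕ := (l.map fun q => (q.2 : ℕ)).sum

/-- The product of the elements `g - 1` of the group algebra, for `g` in a list of group elements
with weights. -/
noncomputable def weightProd (p : ℕ) (l : List (G × ℕ+)) : MonoidAlgebra (ZMod p) G :=
  (l.map fun q => MonoidAlgebra.of (ZMod p) G q.1 - 1).prod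

/-- The span of the products `∏ (g_i - 1)` of total weight at least `n`, with `g_i ∈ H` of weight
`w_i` if `g_i ∈ Γ w_i`. -/
noncomputable def weightSpan (p : ℕ) (Γ : CentralSeries G) (H : Subgroup G) (n : ℕ) :
    Submodule (ZMod p) (MonoidAlgebra (ZMod p) G) :=
  Submodule.span _ {y | ∃ l : List (G × ℕ+), (∀ q ∈ l, q.1 ∈ H ∧ q.1 ∈ Γ q.2) ∧ n ≤ weightSum l ∧
    y = weightProd p l}

theorem weightSpan_anti {H : Subgroup G} {m n : ℕ} (h : m ≤ n) :
    weightSpan p Γ H n ≤ weightSpan p Γ H m :=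
  Submodule.span_mono fun _ ⟨l, h1, h2, h3⟩ => ⟨l, h1, h.trans h2, h3⟩

theorem weightSpan_mono {H K : Subgroup G} (h : H ≤ K) (n : ℕ) :
    weightSpan p Γ H n ≤ weightSpan p Γ K n :=
  Submodule.span_mono fun _ ⟨l, h1, h2⟩ => ⟨l, fun q hq => ⟨h (h1 q hq).1, (h1 q hq).2⟩, h2⟩

theorem weightProd_mem {H : Subgroup G} {l : List (G × ℕ+)} (hl : ∀ q ∈ l, q.1 ∈ H ∧ q.1 ∈ Γ q.2)
    {n : ℕ} (hn : n ≤ weightSum l) : weightProd p l ∈ weightSpan p Γ H n :=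
  Submodule.subset_span ⟨l, hl, hn, rfl⟩

theorem weightSpan_mul {H : Subgroup G} {m n : ℕ} {a b : MonoidAlgebra (ZMod p) G}
    (ha : a ∈ weightSpan p Γ H m) (hb : b ∈ weightSpan p Γ H n) :
    a * b ∈ weightSpan p Γ H (m + n) := by
  induction ha using Submodule.span_induction with
  | zero => rw [zero_mul]; exact zero_mem _
  | add a a' _ _ ha ha' => rw [add_mul]; exact add_mem ha ha'
  | smul c a _ ha => rw [smul_mul_assoc]; exact Submodule.smul_mem _ _ ha
  | mem a ha =>
    obtain ⟨l, hl, hm, rfl⟩ := ha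
    induction hb using Submodule.span_induction with
    | zero => rw [mul_zero]; exact zero_mem _
    | add a a' _ _ ha ha' => rw [mul_add]; exact add_mem ha ha'
    | smul c a _ ha => rw [mul_smul_comm]; exact Submodule.smul_mem _ _ ha
    | mem b hb =>
      obtain ⟨l', hl', hn, rfl⟩ := hb
      have e : weightProd p l * weightProd p l' = weightProd p (l ++ l') := by
        simp [weightProd]
      rw [e]
      refine weightProd_mem (fun q hq => ?_) ?_
      · rcases List.mem_append.1 hq with h | h
        · exact hl q h
        · exact hl' q h
      · simp only [weightSum, List.map_append, List.sum_append] at *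
        omega

theorem one_mem_weightSpan (H : Subgroup G) : (1 : MonoidAlgebra (ZMod p) G) ∈ weightSpan p Γ H 0 :=
  weightProd_mem (l := []) (by simp) (Nat.zero_le _)

theorem sub_one_mem_weightSpan {H : Subgroup G} {n : ℕ+} {h : G} (hH : h ∈ H) (hn : h ∈ Γ n) :
    MonoidAlgebra.of (ZMod p) G h - 1 ∈ weightSpan p Γ H n := by
  have := weightProd_mem (p := p) (Γ := Γ) (H := H) (l := [(h, n)]) (n := n) (by simp [hH, hn])
    (by simp [weightSum])
  simpa [weightProd] using this

theorem of_mem_weightSpan {H : Subgroup G} {h : G} (hH : h ∈ H) :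
    MonoidAlgebra.of (ZMod p) G h ∈ weightSpan p Γ H 0 := by
  have h1 : h ∈ Γ 1 := by rw [Γ.one_eq_top]; trivial
  have := add_mem (weightSpan_anti (Nat.zero_le _) (sub_one_mem_weightSpan (p := p) hH h1))
    (one_mem_weightSpan (p := p) (Γ := Γ) H)
  simpa using this

theorem exists_fg_of_mem_weightSpan {H : Subgroup G} {n : ℕ} {y : MonoidAlgebra (ZMod p) G}
    (hy : y ∈ weightSpan p Γ H n) : ∃ K : Subgroup G, K.FG ∧ y ∈ weightSpan p Γ K n := by
  classical
  induction hy using Submodule.span_induction with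
  | zero => exact ⟨⊥, ⟨∅, by simp⟩, zero_mem _⟩
  | add a b _ _ ha hb =>
    obtain ⟨K, hK, ha⟩ := ha
    obtain ⟨K', hK', hb⟩ := hb
    exact ⟨K ⊔ K', hK.sup hK', add_mem (weightSpan_mono le_sup_left _ ha)
      (weightSpan_mono le_sup_right _ hb)⟩
  | smul c a _ ha =>
    obtain ⟨K, hK, ha⟩ := ha
    exact ⟨K, hK, Submodule.smul_mem _ _ ha⟩
  | mem y hy =>
    obtain ⟨l, hl, hn, rfl⟩ := hy
    refine ⟨Subgroup.closure ((l.map Prod.fst).toFinset : Set G), ⟨_, rfl⟩, ?_⟩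
    refine weightProd_mem (fun q hq => ⟨Subgroup.subset_closure ?_, (hl q hq).2⟩) hn
    simp only [List.coe_toFinset, List.mem_map, Set.mem_ofPred_eq]
    exact ⟨q, hq, rfl⟩

/-- The group algebra of a subgroup, as a subspace of the group algebra. -/
noncomputable def subgroupSpan (p : ℕ) (H : Subgroup G) :
    Submodule (ZMod p) (MonoidAlgebra (ZMod p) G) :=
  Submodule.span _ (MonoidAlgebra.of (ZMod p) G '' H)

theorem of_mul_mem_subgroupSpan {H : Subgroup G} {h : G} (hH : h ∈ H)
    {y : MonoidAlgebra (ZMod p) G} (hy : y ∈ subgroupSpan p H) :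
    MonoidAlgebra.of (ZMod p) G h * y ∈ subgroupSpan p H := by
  induction hy using Submodule.span_induction with
  | zero => rw [mul_zero]; exact zero_mem _
  | add a a' _ _ ha ha' => rw [mul_add]; exact add_mem ha ha'
  | smul c a _ ha => rw [mul_smul_comm]; exact Submodule.smul_mem _ _ ha
  | mem y hy =>
    obtain ⟨g, hg, rfl⟩ := hy
    rw [← map_mul]
    exact Submodule.subset_span ⟨h * g, mul_mem hH hg, rfl⟩

theorem weightProd_mem_subgroupSpan {H : Subgroup G} {l : List (G × ℕ+)} (hl : ∀ q ∈ l, q.1 ∈ H) :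
    weightProd p l ∈ subgroupSpan p H := by
  induction l with
  | nil => exact Submodule.subset_span ⟨1, one_mem _, map_one _⟩
  | cons q l ih =>
    have h := ih fun q hq => hl q (List.mem_cons_of_mem _ hq)
    have e : weightProd p (q :: l) =
        MonoidAlgebra.of (ZMod p) G q.1 * weightProd p l - weightProd p l := by
      simp only [weightProd, List.map_cons, List.prod_cons]
      rw [sub_mul, one_mul]
    rw [e]
    exact sub_mem (of_mul_mem_subgroupSpan (hl q List.mem_cons_self) h) h

theorem weightSpan_le_subgroupSpan {H : Subgroup G} (n : ℕ) :
    weightSpan p Γ H n ≤ subgroupSpan p H := by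
  refine Submodule.span_le.2 ?_
  rintro _ ⟨l, hl, _, rfl⟩
  exact weightProd_mem_subgroupSpan fun q hq => (hl q hq).1

/-- The linear map on the group algebra given by its values on the group. -/
noncomputable def linExt {M : Type*} [AddCommGroup M] [Module (ZMod p) M] (f : G → M) :
    MonoidAlgebra (ZMod p) G →ₗ[ZMod p] M :=
  (MonoidAlgebra.basis G (ZMod p)).constr ℕ f

theorem linExt_of {M : Type*} [AddCommGroup M] [Module (ZMod p) M] (f : G → M) (g : G) :
    linExt f (MonoidAlgebra.of (ZMod p) G g) = f g := by
  have := (MonoidAlgebra.basis G (ZMod p)).constr_basis ℕ f g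
  rwa [MonoidAlgebra.basis_apply] at this

end WeightSpan

section Character

variable {p : ℕ} {G : Type*} [Group G] {Γ : CentralSeries G}

/-- Functions `χ` that induce a homomorphism `Γ w / Γ (w + 1) → 𝔽_p`. -/
structure IsCharacter (Γ : CentralSeries G) (w : ℕ+) (χ : G → ZMod p) : Prop where
  map_mul : ∀ g ∈ Γ w, ∀ h ∈ Γ w, χ (g * h) = χ g + χ h
  map_succ : ∀ g ∈ Γ (w + 1), χ g = 0

theorem exists_isCharacter [hp : Fact p.Prime]
    (hpow : ∀ n : ℕ+, ∀ g ∈ Γ n, g ^ p ∈ Γ (primePNat p * n)) {w : ℕ+} {g : G} (hg : g ∈ Γ w)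
    (hg' : g ∉ Γ (w + 1)) : ∃ χ : G → ZMod p, IsCharacter Γ w χ ∧ χ g = 1 := by
  classical
  have htor : ∀ x : Γ.Piece w, p • x = 0 := by
    intro x
    induction x using Piece.ind with | _ g
    have : ∀ k : ℕ, k • (Piece.mk g : Γ.Piece w) = Piece.mk (g ^ k) := fun k => by
      induction k with
      | zero => rw [zero_smul, pow_zero]; rfl
      | succ k ih => rw [succ_nsmul, ih, pow_succ, Piece.mk_mul]
    rw [this, Piece.mk_eq_zero]
    refine Γ.antitone ?_ (hpow w g g.2)
    have h2 := hp.out.two_le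
    have h3 := w.pos
    rw [← PNat.coe_le_coe, PNat.mul_coe, PNat.add_coe, coe_primePNat, PNat.one_coe]
    nlinarith
  let _ : Module (ZMod p) (Γ.Piece w) := AddCommGroup.zmodModule htor
  have hne : (Piece.mk ⟨g, hg⟩ : Γ.Piece w) ≠ 0 := fun h => hg' ((Piece.mk_eq_zero Γ).1 h)
  obtain ⟨f, hf⟩ : ∃ f : Γ.Piece w →+ ZMod p, f (Piece.mk ⟨g, hg⟩) ≠ 0 := by
    by_contra! h
    exact hne ((Module.forall_dual_apply_eq_zero_iff (ZMod p) _).1 fun f => h f.toAddMonoidHom)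
  refine ⟨fun h => if hh : h ∈ Γ w then (f (Piece.mk ⟨g, hg⟩))⁻¹ * f (Piece.mk ⟨h, hh⟩) else 0,
    ⟨fun a ha b hb => ?_, fun a ha => ?_⟩, ?_⟩
  · rw [dif_pos ha, dif_pos hb, dif_pos (mul_mem ha hb), ← mul_add, ← map_add, ← Piece.mk_mul]
    rfl
  · rw [dif_pos (Γ.succ_le w ha), (Piece.mk_eq_zero Γ (g := ⟨a, Γ.succ_le w ha⟩)).2 ha, map_zero,
      mul_zero]
  · simp only [dif_pos hg]
    exact inv_mul_cancel₀ hf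

variable {w : ℕ+} {χ : G → ZMod p}

theorem IsCharacter.map_one (hχ : IsCharacter Γ w χ) : χ 1 = 0 := hχ.map_succ 1 (one_mem _)

theorem IsCharacter.map_inv (hχ : IsCharacter Γ w χ) {g : G} (hg : g ∈ Γ w) : χ g⁻¹ = -χ g := by
  have := hχ.map_mul g⁻¹ (inv_mem hg) g hg
  rw [inv_mul_cancel, hχ.map_one] at this
  exact eq_neg_of_add_eq_zero_left this.symm

theorem IsCharacter.map_pow (hχ : IsCharacter Γ w χ) {g : G} (hg : g ∈ Γ w) (k : ℕ) :
    χ (g ^ k) = k * χ g := by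
  induction k with
  | zero => rw [pow_zero, hχ.map_one, Nat.cast_zero, zero_mul]
  | succ k ih =>
    rw [pow_succ, hχ.map_mul _ (pow_mem hg k) _ hg, ih]
    push_cast
    ring

/-- A character of `Γ w`, extended linearly to the group algebra, vanishes on elements of weight
at least `w + 1`: on products of one factor because it vanishes on `Γ (w + 1)`, on longer products
because it is a derivation with respect to the augmentation. -/
theorem IsCharacter.linExt_eq_zero (hχ : IsCharacter Γ w χ) {K : Subgroup G} (hK : K ≤ Γ w)
    {y : MonoidAlgebra (ZMod p) G} (hy : y ∈ weightSpan p Γ K (w + 1)) : linExt χ y = 0 := by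
  have h1 : ∀ g ∈ K, ∀ y ∈ subgroupSpan p K,
      linExt χ ((MonoidAlgebra.of (ZMod p) G g - 1) * y) =
        χ g * augmentation (ZMod p) G y := by
    intro g hg y hy
    induction hy using Submodule.span_induction with
    | zero => simp
    | add a a' _ _ ha ha' => rw [mul_add, map_add, map_add, ha, ha', mul_add]
    | smul c a _ ha =>
      rw [mul_smul_comm, map_smul, map_smul, ha, smul_eq_mul, smul_eq_mul]; ring
    | mem y hy =>
      obtain ⟨h, hh, rfl⟩ := hy
      rw [sub_mul, one_mul, ← _root_.map_mul, map_sub, linExt_of, linExt_of,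
        hχ.map_mul g (hK hg) h (hK hh), add_sub_cancel_right]
      simp [augmentation]
  induction hy using Submodule.span_induction with
  | zero => exact map_zero _
  | add a a' _ _ ha ha' => rw [map_add, ha, ha', add_zero]
  | smul c a _ ha => rw [map_smul, ha, smul_zero]
  | mem y hy =>
    obtain ⟨l, hl, hn, rfl⟩ := hy
    match l, hl, hn with
    | [], _, hn => simp [weightSum] at hn
    | [q], hl, hn =>
      have hq := (hl q (by simp)).2
      have h2 : q.1 ∈ Γ (w + 1) := by
        refine Γ.antitone ?_ hq
        rw [← PNat.coe_le_coe, PNat.add_coe, PNat.one_coe]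
        simpa [weightSum] using hn
      have e : weightProd p [q] = MonoidAlgebra.of (ZMod p) G q.1 - 1 := by simp [weightProd]
      rw [e, map_sub, linExt_of, hχ.map_succ _ h2, ← _root_.map_one (MonoidAlgebra.of (ZMod p) G),
        linExt_of, hχ.map_one, sub_zero]
    | q :: q' :: l, hl, _ =>
      have e : weightProd p (q :: q' :: l) =
          (MonoidAlgebra.of (ZMod p) G q.1 - 1) * weightProd p (q' :: l) := by simp [weightProd]
      rw [e, h1 q.1 (hl q (by simp)).1 _ (weightProd_mem_subgroupSpan fun r hr =>
        (hl r (List.mem_cons_of_mem _ hr)).1)]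
      have h0 : augmentation (ZMod p) G (MonoidAlgebra.of (ZMod p) G q'.1 - 1) = 0 := by
        rw [map_sub, _root_.map_one]; simp [augmentation]
      have e' : weightProd p (q' :: l) =
          (MonoidAlgebra.of (ZMod p) G q'.1 - 1) * weightProd p l := by simp [weightProd]
      rw [e', _root_.map_mul, h0, zero_mul, mul_zero]

end Character

section Retraction

variable {p : ℕ} {G : Type*} [Group G] {Γ : CentralSeries G} {H : Subgroup G} {x : G} {w : ℕ+}

theorem conj_sub_one_mem_weightSpan (hx : x ∈ Γ w) {h : G} {v : ℕ+} (hc : ⁅x, h⁆ ∈ H) (hH : h ∈ H)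
    (hv : h ∈ Γ v) :
    MonoidAlgebra.of (ZMod p) G x * (MonoidAlgebra.of (ZMod p) G h - 1) *
      MonoidAlgebra.of (ZMod p) G x⁻¹ - (MonoidAlgebra.of (ZMod p) G h - 1) ∈
        weightSpan p Γ H (w + v) := by
  have e : MonoidAlgebra.of (ZMod p) G x * (MonoidAlgebra.of (ZMod p) G h - 1) *
      MonoidAlgebra.of (ZMod p) G x⁻¹ - (MonoidAlgebra.of (ZMod p) G h - 1) =
        (MonoidAlgebra.of (ZMod p) G ⁅x, h⁆ - 1) * MonoidAlgebra.of (ZMod p) G h := by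
    rw [mul_sub, sub_mul, mul_one, sub_mul, one_mul, ← map_mul, ← map_mul, ← map_mul, ← map_mul,
      commutatorElement_def, inv_mul_cancel_right, mul_inv_cancel, map_one,
      sub_sub_sub_cancel_right]
  have h1 := sub_one_mem_weightSpan (p := p) hc (Γ.commutator_mem hx hv)
  rw [PNat.add_coe] at h1
  have h2 := weightSpan_mul h1 (of_mem_weightSpan (p := p) (Γ := Γ) hH)
  rw [add_zero] at h2
  rwa [e]

theorem conj_sub_mem_weightSpan (hx : x ∈ Γ w) (hxH : ∀ h ∈ H, x * h * x⁻¹ ∈ H) {m : ℕ}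
    {b : MonoidAlgebra (ZMod p) G} (hb : b ∈ weightSpan p Γ H m) :
    MonoidAlgebra.of (ZMod p) G x * b * MonoidAlgebra.of (ZMod p) G x⁻¹ - b ∈
      weightSpan p Γ H (m + w) := by
  set u := MonoidAlgebra.of (ZMod p) G
  induction hb using Submodule.span_induction with
  | zero => simp
  | add a a' _ _ ha ha' =>
    rw [mul_add, add_mul, add_sub_add_comm]
    exact add_mem ha ha'
  | smul c a _ ha =>
    rw [mul_smul_comm, smul_mul_assoc, ← smul_sub]
    exact Submodule.smul_mem _ _ ha
  | mem b hb =>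
    obtain ⟨l, hl, hn, rfl⟩ := hb
    refine weightSpan_anti (Nat.add_le_add_right hn w) ?_
    clear hn
    have hxx : u x⁻¹ * u x = 1 := by rw [← map_mul, inv_mul_cancel, map_one]
    have hxx' : u x * u x⁻¹ = 1 := by rw [← map_mul, mul_inv_cancel, map_one]
    induction l with
    | nil =>
      simp only [weightProd, List.map_nil, List.prod_nil, mul_one, hxx', sub_self]
      exact zero_mem _
    | cons q l ih =>
      have ih := ih fun q hq => hl q (List.mem_cons_of_mem _ hq)
      obtain ⟨hqH, hqΓ⟩ := hl q List.mem_cons_self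
      have hl' := weightProd_mem (p := p) (fun q hq => hl q (List.mem_cons_of_mem _ hq))
        (le_refl (weightSum l))
      have e : weightProd p (q :: l) = (u q.1 - 1) * weightProd p l := by simp [weightProd, u]
      have e' : weightSum (q :: l) = q.2 + weightSum l := by simp [weightSum]
      have hc : ⁅x, q.1⁆ ∈ H := by
        rw [commutatorElement_def]; exact mul_mem (hxH _ hqH) (inv_mem hqH)
      have h1 := conj_sub_one_mem_weightSpan (p := p) hx hc hqH hqΓ
      have h2 : u x * weightProd p l * u x⁻¹ ∈ weightSpan p Γ H (weightSum l) := by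
        have := add_mem (weightSpan_anti (Nat.le_add_right (weightSum l) w) ih) hl'
        rwa [sub_add_cancel] at this
      have h3 := weightSpan_mul h1 h2
      have h4 := weightSpan_mul (sub_one_mem_weightSpan (p := p) hqH hqΓ) ih
      rw [e', e]
      have e3 : u x * ((u q.1 - 1) * weightProd p l) * u x⁻¹ =
          u x * (u q.1 - 1) * u x⁻¹ * (u x * weightProd p l * u x⁻¹) := by
        simp only [mul_assoc]
        rw [← mul_assoc (u x⁻¹) (u x), hxx, one_mul]
      rw [e3]
      have n1 : (w : ℕ) + q.2 + weightSum l = q.2 + weightSum l + w := by ring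
      have n2 : (q.2 : ℕ) + (weightSum l + w) = q.2 + weightSum l + w := by ring
      rw [n1] at h3
      rw [n2] at h4
      rw [sub_mul _ _ (u x * weightProd p l * u x⁻¹)] at h3
      rw [mul_sub] at h4
      have h5 := add_mem h3 h4
      rwa [sub_add_sub_cancel] at h5

/-- The span of the elements `b (x - 1) ^ k` of total weight at least `n`, where `b` is in the
weight filtration of `𝔽_p[H]` and `x` has weight `w`. -/
noncomputable def stepSpan (p : ℕ) (Γ : CentralSeries G) (H : Subgroup G) (x : G) (w : ℕ+) (n : ℕ) :
    Submodule (ZMod p) (MonoidAlgebra (ZMod p) G) :=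
  Submodule.span _ {y | ∃ (m k : ℕ) (b : MonoidAlgebra (ZMod p) G), b ∈ weightSpan p Γ H m ∧
    n ≤ m + w * k ∧ y = b * (MonoidAlgebra.of (ZMod p) G x - 1) ^ k}

theorem mem_stepSpan {m k n : ℕ} {b : MonoidAlgebra (ZMod p) G} (hb : b ∈ weightSpan p Γ H m)
    (hn : n ≤ m + w * k) : b * (MonoidAlgebra.of (ZMod p) G x - 1) ^ k ∈ stepSpan p Γ H x w n :=
  Submodule.subset_span ⟨m, k, b, hb, hn, rfl⟩

theorem stepSpan_anti {m n : ℕ} (h : m ≤ n) : stepSpan p Γ H x w n ≤ stepSpan p Γ H x w m :=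
  Submodule.span_mono fun _ ⟨m', k, b, hb, hn, e⟩ => ⟨m', k, b, hb, h.trans hn, e⟩

theorem mul_mem_stepSpan {v n : ℕ} {b y : MonoidAlgebra (ZMod p) G}
    (hb : b ∈ weightSpan p Γ H v) (hy : y ∈ stepSpan p Γ H x w n) :
    b * y ∈ stepSpan p Γ H x w (v + n) := by
  induction hy using Submodule.span_induction with
  | zero => rw [mul_zero]; exact zero_mem _
  | add a a' _ _ ha ha' => rw [mul_add]; exact add_mem ha ha'
  | smul c a _ ha => rw [mul_smul_comm]; exact Submodule.smul_mem _ _ ha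
  | mem y hy =>
    obtain ⟨m, k, b', hb', hn, rfl⟩ := hy
    rw [← mul_assoc]
    exact mem_stepSpan (weightSpan_mul hb hb') (by omega)

theorem sub_one_mul_mem_stepSpan (hx : x ∈ Γ w) (hxH : ∀ h ∈ H, x * h * x⁻¹ ∈ H) {n : ℕ}
    {y : MonoidAlgebra (ZMod p) G} (hy : y ∈ stepSpan p Γ H x w n) :
    (MonoidAlgebra.of (ZMod p) G x - 1) * y ∈ stepSpan p Γ H x w (w + n) := by
  induction hy using Submodule.span_induction with
  | zero => rw [mul_zero]; exact zero_mem _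
  | add a a' _ _ ha ha' => rw [mul_add]; exact add_mem ha ha'
  | smul c a _ ha => rw [mul_smul_comm]; exact Submodule.smul_mem _ _ ha
  | mem y hy =>
    obtain ⟨m, k, b, hb, hn, rfl⟩ := hy
    have h1 := conj_sub_mem_weightSpan hx hxH hb
    have hxx : MonoidAlgebra.of (ZMod p) G x⁻¹ * MonoidAlgebra.of (ZMod p) G x = 1 := by
      rw [← map_mul, inv_mul_cancel, map_one]
    set u := MonoidAlgebra.of (ZMod p) G
    set c := u x * b * u x⁻¹ with hc
    have h2 : c ∈ weightSpan p Γ H m := by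
      have := add_mem (weightSpan_anti (Nat.le_add_right m w) h1) hb
      rwa [sub_add_cancel] at this
    -- `x b = c x` with `c = x b x⁻¹`
    have hcx : c * u x = u x * b := by rw [hc, mul_assoc, hxx, mul_one]
    have e : (u x - 1) * (b * (u x - 1) ^ k) =
        c * (u x - 1) ^ (k + 1) + (c - b) * (u x - 1) ^ k := by
      rw [pow_succ', ← mul_assoc, ← mul_assoc, ← add_mul]
      congr 1
      rw [mul_sub, hcx]
      noncomm_ring
    rw [e]
    refine add_mem (mem_stepSpan h2 ?_) (mem_stepSpan h1 ?_)
    · rw [mul_add]; omega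
    · omega

theorem pow_sub_one_mul_mem_stepSpan (hx : x ∈ Γ w) (hxH : ∀ h ∈ H, x * h * x⁻¹ ∈ H) (a : ℕ) {n : ℕ}
    {y : MonoidAlgebra (ZMod p) G} (hy : y ∈ stepSpan p Γ H x w n) :
    (MonoidAlgebra.of (ZMod p) G (x ^ a) - 1) * y ∈ stepSpan p Γ H x w (w + n) := by
  induction a with
  | zero => rw [pow_zero, map_one, sub_self, zero_mul]; exact zero_mem _
  | succ a ih =>
    have e : (MonoidAlgebra.of (ZMod p) G (x ^ (a + 1)) - 1) * y =
        (MonoidAlgebra.of (ZMod p) G x - 1) * ((MonoidAlgebra.of (ZMod p) G (x ^ a) - 1) * y) +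
        (MonoidAlgebra.of (ZMod p) G (x ^ a) - 1) * y +
        (MonoidAlgebra.of (ZMod p) G x - 1) * y := by
      rw [pow_succ', map_mul]
      noncomm_ring
    rw [e]
    exact add_mem (add_mem (stepSpan_anti (Nat.le_add_left _ _)
      (sub_one_mul_mem_stepSpan hx hxH ih)) ih) (sub_one_mul_mem_stepSpan hx hxH hy)

/-- The weight filtration of `𝔽_p[K]`, where `K` is generated by a subgroup `H` and an element `x`
of weight `w` that normalizes `H`: a factor `h x ^ a - 1` of weight at most `w` is expanded, and
elements of `𝔽_p[H]` are moved to the left of powers of `x - 1`. -/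
theorem weightSpan_le_stepSpan {K : Subgroup G} (hx : x ∈ Γ w) (hxH : ∀ h ∈ H, x * h * x⁻¹ ∈ H)
    (hK : K ≤ Γ w) (hHK : H ≤ K) (hKH : ∀ g ∈ K, g ∈ Γ (w + 1) → g ∈ H)
    (hgen : ∀ g ∈ K, ∃ h ∈ H, ∃ a : ℕ, g = h * x ^ a) (n : ℕ) :
    weightSpan p Γ K n ≤ stepSpan p Γ H x w n := by
  refine Submodule.span_le.2 ?_
  rintro _ ⟨l, hl, hn, rfl⟩
  refine stepSpan_anti hn ?_
  clear hn
  induction l with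
  | nil =>
    have := mem_stepSpan (x := x) (w := w) (k := 0) (n := 0)
      (one_mem_weightSpan (p := p) (Γ := Γ) H) (Nat.zero_le _)
    simpa [weightProd, weightSum] using this
  | cons q l ih =>
    have ih := ih fun q hq => hl q (List.mem_cons_of_mem _ hq)
    obtain ⟨hqK, hqΓ⟩ := hl q List.mem_cons_self
    have e : weightProd p (q :: l) = (MonoidAlgebra.of (ZMod p) G q.1 - 1) * weightProd p l := by
      simp [weightProd]
    have e' : weightSum (q :: l) = q.2 + weightSum l := by simp [weightSum]
    rw [e, e']
    rcases le_or_gt (w + 1) q.2 with h | h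
    · exact mul_mem_stepSpan (sub_one_mem_weightSpan (hKH _ hqK (Γ.antitone h hqΓ)) hqΓ) ih
    · have hqw : (q.2 : ℕ) ≤ w := PNat.coe_le_coe _ _ |>.2 (PNat.lt_add_one_iff.1 h)
      refine stepSpan_anti (Nat.add_le_add_right hqw _) ?_
      obtain ⟨h, hh, a, ha⟩ := hgen _ hqK
      have h1 := pow_sub_one_mul_mem_stepSpan hx hxH a ih
      have h2 : MonoidAlgebra.of (ZMod p) G (x ^ a) * weightProd p l ∈
          stepSpan p Γ H x w (weightSum l) := by
        have := add_mem (stepSpan_anti (Nat.le_add_left _ _) h1) ih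
        rwa [sub_mul, one_mul, sub_add_cancel] at this
      have h3 := mul_mem_stepSpan (sub_one_mem_weightSpan (p := p) hh (hK (hHK hh))) h2
      rw [ha, map_mul]
      convert add_mem h3 h1 using 1
      noncomm_ring

/-- The retraction `h x ^ a ↦ h`, `0 ≤ a < p`, of `𝔽_p[K]` to `𝔽_p[H]` preserves weights. -/
theorem retraction_mem [hp : Fact p.Prime] {d : G → G}
    (hpow : x ^ p ∈ Γ (primePNat p * w)) (hxp : x ^ p ∈ H)
    (hdH : ∀ h ∈ H, d h = h) (hdx : ∀ h ∈ H, ∀ a < p, d (h * x ^ a) = h) {n : ℕ}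
    {y : MonoidAlgebra (ZMod p) G} (hy : y ∈ stepSpan p Γ H x w n) :
    linExt (fun g => MonoidAlgebra.of (ZMod p) G (d g)) y ∈ weightSpan p Γ H n := by
  set u := MonoidAlgebra.of (ZMod p) G with hu
  induction hy using Submodule.span_induction with
  | zero => rw [map_zero]; exact zero_mem _
  | add a a' _ _ ha ha' => rw [map_add]; exact add_mem ha ha'
  | smul c a _ ha => rw [map_smul]; exact Submodule.smul_mem _ _ ha
  | mem y hy =>
    obtain ⟨m, k, b, hb, hn, rfl⟩ := hy
    have hD0 : ∀ b ∈ subgroupSpan p H, linExt (fun g => u (d g)) b = b := by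
      intro b hb
      induction hb using Submodule.span_induction with
      | zero => exact map_zero _
      | add a a' _ _ ha ha' => rw [map_add, ha, ha']
      | smul c a _ ha => rw [map_smul, ha]
      | mem b hb =>
        obtain ⟨h, hh, rfl⟩ := hb
        rw [linExt_of, hdH h hh]
    have hDx : ∀ a < p, ∀ b ∈ subgroupSpan p H, linExt (fun g => u (d g)) (b * u x ^ a) = b := by
      intro a ha b hb
      induction hb using Submodule.span_induction with
      | zero => rw [zero_mul]; exact map_zero _
      | add a a' _ _ ha ha' => rw [add_mul, map_add, ha, ha']
      | smul c a _ ha => rw [smul_mul_assoc, map_smul, ha]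
      | mem b hb =>
        obtain ⟨h, hh, rfl⟩ := hb
        rw [← map_pow, ← hu, ← map_mul, hu, linExt_of, hdx h hh a ha]
    induction k using Nat.strong_induction_on generalizing m b with
    | _ k ih =>
    rcases Nat.eq_zero_or_pos k with rfl | hk
    · rw [pow_zero, mul_one, hD0 b (weightSpan_le_subgroupSpan _ hb)]
      exact weightSpan_anti (by simpa using hn) hb
    rcases lt_or_ge k p with hkp | hkp
    · have e : b * (u x - 1) ^ k =
          ∑ a ∈ Finset.range (k + 1), ((-1 : ZMod p) ^ (k - a) * (k.choose a : ZMod p)) •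
            (b * u x ^ a) := by
        rw [sub_eq_add_neg, (Commute.one_right (u x)).neg_right.add_pow, Finset.mul_sum]
        refine Finset.sum_congr rfl fun a _ => ?_
        have h1 : (-1 : MonoidAlgebra (ZMod p) G) ^ (k - a) =
            algebraMap (ZMod p) _ ((-1 : ZMod p) ^ (k - a)) := by
          rw [map_pow, map_neg, map_one]
        have h2 : ((k.choose a : ℕ) : MonoidAlgebra (ZMod p) G) =
            algebraMap (ZMod p) _ (k.choose a : ZMod p) := by
          rw [map_natCast]
        rw [h1, h2, mul_assoc, ← map_mul, Algebra.smul_def, ← mul_assoc, Algebra.commutes]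
      have e2 : linExt (fun g => u (d g)) (b * (u x - 1) ^ k) = 0 := by
        rw [e, map_sum, Finset.sum_congr rfl fun a ha => by
          rw [map_smul, hDx a (by have := Finset.mem_range.1 ha; omega) b
            (weightSpan_le_subgroupSpan _ hb)], ← Finset.sum_smul]
        have e3 := add_pow (1 : ZMod p) (-1) k
        simp only [one_pow, one_mul, add_neg_cancel, zero_pow hk.ne'] at e3
        rw [← e3, zero_smul]
      rw [e2]
      exact zero_mem _
    · obtain ⟨q, rfl⟩ := Nat.exists_eq_add_of_le hkp
      have h1 : (u x - 1) ^ p = u (x ^ p) - 1 := by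
        rw [sub_pow_char_of_commute p (Commute.one_right (u x)), one_pow, map_pow]
      rw [pow_add, h1, ← mul_assoc]
      have hp0 := hp.out.pos
      refine ih q (by omega) _ _ (weightSpan_mul hb (sub_one_mem_weightSpan hxp hpow)) ?_
      rw [PNat.mul_coe, coe_primePNat]
      have e4 : (w : ℕ) * (p + q) = p * w + w * q := by ring
      omega

end Retraction

section Dimension

variable {p : ℕ} [hp : Fact p.Prime] {G : Type*} [Group G] {Γ : CentralSeries G}

/-- Induction on the index of `Γ n` in `K`. If `K` lies in `Γ w` but not in `Γ (w + 1)`, a character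
of `Γ w` shows that `g` lies in `Γ (w + 1)`, and the retraction to its kernel in `K` reduces the
claim to a subgroup in which `Γ n` has smaller index. -/
theorem mem_of_sub_one_mem_weightSpan
    (hpow : ∀ n : ℕ+, ∀ g ∈ Γ n, g ^ p ∈ Γ (primePNat p * n)) {n : ℕ+} {K : Subgroup G}
    (hfin : (Γ n).relIndex K ≠ 0) {g : G} (hg : g ∈ K)
    (h : MonoidAlgebra.of (ZMod p) G g - 1 ∈ weightSpan p Γ K n) :
    g ∈ Γ n := by
  obtain ⟨N, hN⟩ : ∃ N, (Γ n).relIndex K = N := ⟨_, rfl⟩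
  induction N using Nat.strong_induction_on generalizing K with
  | _ N ih =>
  by_cases hKn : K ≤ Γ n
  · exact hKn hg
  -- the largest `w` with `K ≤ Γ w`
  obtain ⟨w, hKw, hKw'⟩ : ∃ w : ℕ+, K ≤ Γ w ∧ ¬ K ≤ Γ (w + 1) := by
    by_contra! hc
    refine hKn ?_
    have : ∀ m, K ≤ Γ m := by
      intro m
      induction m using PNat.recOn with
      | one => rw [Γ.one_eq_top]; exact le_top
      | succ m ih => exact hc m ih
    exact this n
  have hwn : w + 1 ≤ n := by
    by_contra! hc
    exact hKn (hKw.trans (Γ.antitone (PNat.lt_add_one_iff.1 hc)))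
  by_cases hgw : g ∈ Γ (w + 1)
  · obtain ⟨x, hxK, hxw⟩ := SetLike.not_le_iff_exists.1 hKw'
    have hx := hKw hxK
    obtain ⟨χ, hχ, hχx⟩ := exists_isCharacter hpow hx hxw
    let H : Subgroup G :=
      { carrier := {g | g ∈ K ∧ χ g = 0}
        one_mem' := ⟨one_mem _, hχ.map_one⟩
        mul_mem' := fun {a b} ha hb => ⟨mul_mem ha.1 hb.1, by
          rw [hχ.map_mul a (hKw ha.1) b (hKw hb.1), ha.2, hb.2, add_zero]⟩
        inv_mem' := fun {a} ha => ⟨inv_mem ha.1, by rw [hχ.map_inv (hKw ha.1), ha.2, neg_zero]⟩ }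
    have hHK : H ≤ K := fun a ha => ha.1
    have hKH : ∀ g ∈ K, g ∈ Γ (w + 1) → g ∈ H := fun a ha ha' => ⟨ha, hχ.map_succ a ha'⟩
    have hxH : ∀ a ∈ H, x * a * x⁻¹ ∈ H := fun a ha => ⟨mul_mem (mul_mem hxK ha.1) (inv_mem hxK), by
      rw [hχ.map_mul _ (hKw (mul_mem hxK ha.1)) _ (inv_mem hx), hχ.map_mul x hx a (hKw ha.1),
        hχ.map_inv hx, ha.2, add_zero, add_neg_cancel]⟩
    have hxp : x ^ p ∈ H := ⟨pow_mem hxK p, by rw [hχ.map_pow hx]; simp⟩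
    have hgen : ∀ a ∈ K, a * (x ^ (χ a).val)⁻¹ ∈ H := fun a ha =>
      ⟨mul_mem ha (inv_mem (pow_mem hxK _)), by
        rw [hχ.map_mul a (hKw ha) _ (inv_mem (pow_mem hx _)), hχ.map_inv (pow_mem hx _),
          hχ.map_pow hx, hχx, mul_one, ZMod.natCast_zmod_val, add_neg_cancel]⟩
    have hgH : g ∈ H := hKH g hg hgw
    -- the retraction `a x ^ i ↦ a`
    have h1 := retraction_mem (d := fun a => a * (x ^ (χ a).val)⁻¹) (hpow w x hx) hxp
      (fun a ha => by
        show a * (x ^ (χ a).val)⁻¹ = a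
        rw [ha.2, ZMod.val_zero, pow_zero, inv_one, mul_one])
      (fun a ha i hi => by
        show a * x ^ i * (x ^ (χ (a * x ^ i)).val)⁻¹ = a
        rw [hχ.map_mul a (hKw ha.1) _ (pow_mem hx i), ha.2, hχ.map_pow hx, hχx, mul_one, zero_add,
          ZMod.val_natCast_of_lt hi, mul_inv_cancel_right])
      (weightSpan_le_stepSpan hx hxH hKw hHK hKH
        (fun a ha => ⟨_, hgen a ha, (χ a).val, by rw [inv_mul_cancel_right]⟩) n h)
    rw [map_sub, ← map_one (MonoidAlgebra.of (ZMod p) G), linExt_of, linExt_of, hgH.2, hχ.map_one,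
      ZMod.val_zero, pow_zero, inv_one, mul_one, mul_one, map_one] at h1
    have h2 : (Γ n).relIndex H * H.relIndex K = (Γ n).relIndex K := by
      rw [← Subgroup.inf_relIndex_right (Γ n) H, ← Subgroup.inf_relIndex_right (Γ n) K]
      have : Γ n ⊓ H = Γ n ⊓ K := le_antisymm (inf_le_inf_left _ hHK) fun a ha =>
        ⟨ha.1, hKH a ha.2 (Γ.antitone hwn ha.1)⟩
      rw [← this]
      exact Subgroup.relIndex_mul_relIndex _ _ _ inf_le_right hHK
    have h3 : H.relIndex K ≠ 1 := fun h => by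
      have := (Subgroup.relIndex_eq_one.1 h hxK).2
      rw [hχx] at this
      exact one_ne_zero this
    have h4 : (Γ n).relIndex H ≠ 0 := fun h => hfin (by rw [← h2, h, zero_mul])
    have h5 : H.relIndex K ≠ 0 := fun h => hfin (by rw [← h2, h, mul_zero])
    refine ih _ ?_ h4 hgH h1 rfl
    rw [← hN, ← h2]
    exact (Nat.lt_mul_iff_one_lt_right (Nat.pos_of_ne_zero h4)).2 (by omega)
  · exfalso
    obtain ⟨χ, hχ, hχg⟩ := exists_isCharacter hpow (hKw hg) hgw
    have h1 := hχ.linExt_eq_zero hKw (weightSpan_anti (by exact_mod_cast hwn) h)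
    rw [map_sub, ← map_one (MonoidAlgebra.of (ZMod p) G), linExt_of, linExt_of, hχ.map_one, hχg,
      sub_zero] at h1
    exact one_ne_zero h1

/-- The quotients `Γ n / Γ (n + 1)` are elementary abelian `p`-groups, so that `Γ n ∩ K` has
finite index in every finitely generated subgroup `K`. -/
theorem relIndex_ne_zero_of_fg (hpow : ∀ n : ℕ+, ∀ g ∈ Γ n, g ^ p ∈ Γ (primePNat p * n))
    {K : Subgroup G} (hK : K.FG) (n : ℕ+) : (Γ n).relIndex K ≠ 0 := by
  induction n using PNat.recOn with
  | one => rw [Γ.one_eq_top, Subgroup.relIndex_top_left]; exact one_ne_zero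
  | succ n ih =>
    have hfg : Group.FG (Γ n ⊓ K : Subgroup G) := by
      have : Group.FG K := (Group.fg_iff_subgroup_fg K).2 hK
      have : ((Γ n).subgroupOf K).FiniteIndex := ⟨ih⟩
      have : Group.FG ((Γ n).subgroupOf K) := Subgroup.fg_of_index_ne_zero _
      exact Group.fg_of_surjective
        (f := (MonoidHom.mk' (fun k => ⟨k.1.1, k.2, k.1.2⟩) fun a b => rfl :
          (Γ n).subgroupOf K →* (Γ n ⊓ K : Subgroup G))) fun k => ⟨⟨⟨k.1, k.2.2⟩, k.2.1⟩, rfl⟩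
    let φ : (Γ n ⊓ K : Subgroup G) →* Multiplicative (Γ.Piece n) :=
      MonoidHom.mk' (fun k => Multiplicative.ofAdd (Piece.mk ⟨k.1, k.2.1⟩)) fun a b => rfl
    have hfin : Finite φ.range := by
      refine CommGroup.finite_of_fg_isMulTorsion _ ?_
      rintro ⟨_, ⟨a, rfl⟩⟩
      refine isOfFinOrder_iff_pow_eq_one.2 ⟨p, hp.out.pos, Subtype.ext ?_⟩
      show φ a ^ p = 1
      rw [← map_pow]
      refine (Piece.mk_eq_zero Γ).2 (Γ.antitone ?_ (hpow n _ a.2.1))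
      have h2 := hp.out.two_le
      have h3 := n.pos
      rw [← PNat.coe_le_coe, PNat.mul_coe, PNat.add_coe, coe_primePNat, PNat.one_coe]
      nlinarith
    have hker : φ.ker.index ≠ 0 := by
      rw [Subgroup.index_ker]; exact Nat.card_pos.ne'
    have h1 : (Γ (n + 1)).relIndex (Γ n ⊓ K) ≠ 0 := by
      have : φ.ker = (Γ (n + 1)).subgroupOf (Γ n ⊓ K) := by
        ext k
        exact Piece.mk_eq_zero Γ (g := ⟨k.1, k.2.1⟩)
      rwa [this] at hker
    have h2 := Subgroup.relIndex_inf_mul_relIndex (Γ (n + 1)) (Γ n) K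
    rw [inf_eq_left.2 (Γ.succ_le n)] at h2
    rw [← h2]
    exact mul_ne_zero h1 ih

/-- The dimension subgroups over `𝔽_p` are contained in the terms of every central series that is
restricted, in the sense that `p`-th powers multiply weights by `p`. By
`exists_fg_of_mem_weightSpan` it suffices to work in a finitely generated subgroup. -/
theorem dimensionSubgroup_le (hpow : ∀ n : ℕ+, ∀ g ∈ Γ n, g ^ p ∈ Γ (primePNat p * n)) (n : ℕ+) :
    dimensionSubgroup (ZMod p) G n ≤ Γ n := by
  intro g hg
  have h1 : ∀ y ∈ augmentationIdeal (ZMod p) G, y ∈ weightSpan p Γ ⊤ 1 := by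
    intro y hy
    have key : ∀ y : MonoidAlgebra (ZMod p) G,
        y - algebraMap (ZMod p) _ (augmentation (ZMod p) G y) ∈ weightSpan p Γ ⊤ 1 := by
      intro y
      induction y using MonoidAlgebra.induction_on with
      | of g =>
        have e : augmentation (ZMod p) G (MonoidAlgebra.of (ZMod p) G g) = 1 := by
          simp [augmentation]
        rw [e, map_one]
        exact sub_one_mem_weightSpan (n := 1) (Subgroup.mem_top g)
          (by rw [Γ.one_eq_top]; trivial)
      | add a b ha hb =>
        convert add_mem ha hb using 1
        rw [map_add, map_add]
        abel
      | smul c a ha =>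
        convert Submodule.smul_mem _ c ha using 1
        rw [map_smul, smul_sub, smul_eq_mul, map_mul, ← Algebra.smul_def]
    have h0 : augmentation (ZMod p) G y = 0 := hy
    have := key y
    rwa [h0, map_zero, sub_zero] at this
  have h2 : ∀ m : ℕ, ∀ y ∈ augmentationIdeal (ZMod p) G ^ m, y ∈ weightSpan p Γ ⊤ m := by
    have h0 : ∀ y : MonoidAlgebra (ZMod p) G, y ∈ weightSpan p Γ ⊤ 0 := by
      intro y
      induction y using MonoidAlgebra.induction_on with
      | of g => exact of_mem_weightSpan (Subgroup.mem_top g)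
      | add a b ha hb => exact add_mem ha hb
      | smul c a ha => exact Submodule.smul_mem _ c ha
    intro m
    induction m with
    | zero => exact fun y _ => h0 y
    | succ m ih =>
      intro y hy
      rw [Submodule.pow_succ] at hy
      refine Submodule.mul_induction_on hy (fun a ha b hb => weightSpan_mul (ih a ha) (h1 b hb))
        fun a b => add_mem
  have h3 : MonoidAlgebra.of (ZMod p) G g - 1 ∈ weightSpan p Γ ⊤ n := by
    have : 1 - MonoidAlgebra.of (ZMod p) G g ∈ weightSpan p Γ ⊤ n := h2 n _ hg
    rw [← neg_sub]
    exact neg_mem this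
  obtain ⟨K, hK, h4⟩ := exists_fg_of_mem_weightSpan h3
  have h5 : g ∈ K ⊔ Subgroup.closure {g} :=
    le_sup_right (a := K) (Subgroup.subset_closure (Set.mem_singleton g))
  exact mem_of_sub_one_mem_weightSpan hpow
    (relIndex_ne_zero_of_fg hpow (hK.sup ⟨{g}, by simp⟩) n) h5
    (weightSpan_mono le_sup_left _ h4)

end Dimension

/-! ### Generation of the Zassenhaus Lie algebra in degree one -/

section Separation

variable {p : ℕ} {G : Type*} [Group G] [TopologicalSpace G] [IsTopologicalGroup G]

/-- In a discrete or pro-`p` group the open normal subgroups separate closed sets from points. -/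
theorem mem_of_forall_openNormalSubgroup (hG : DiscreteTopology G ∨ IsProP p G) {C : Set G}
    (hC : IsClosed C) {x : G} (h : ∀ U : OpenNormalSubgroup G, ∃ c ∈ C, c⁻¹ * x ∈ U.toSubgroup) :
    x ∈ C := by
  rcases hG with hG | hG
  · obtain ⟨c, hc, hx⟩ := h
      { toSubgroup := ⊥, isOpen' := isOpen_discrete _, isNormal' := inferInstance }
    have : c⁻¹ * x = 1 := hx
    rwa [← inv_mul_eq_one.1 this]
  · have := hG.compactSpace
    have := hG.totallyDisconnectedSpace
    by_contra hx
    have hV : IsOpen ((fun g => x * g⁻¹) ⁻¹' Cᶜ) := hC.isOpen_compl.preimage (by fun_prop)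
    obtain ⟨U, hU⟩ :=
      ProfiniteGrp.exist_openNormalSubgroup_sub_open_nhds_of_one hV (by simpa using hx)
    obtain ⟨c, hc, hcx⟩ := h U
    exact hU hcx (by simpa using hc)

variable (p G) in
theorem isClosed_zassenhausSeries [Fact p.Prime] (n : ℕ+) :
    IsClosed (zassenhausSeries p G n : Set G) := by
  show IsClosed (closedDimensionSubgroup p G n : Set G)
  rw [closedDimensionSubgroup, Subgroup.coe_iInf]
  refine isClosed_iInter fun U => Subgroup.isClosed_of_isOpen _ (Subgroup.isOpen_mono ?_ U.isOpen')
  intro x hx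
  have hx1 : (QuotientGroup.mk x : G ⧸ U.toSubgroup) = 1 := (QuotientGroup.eq_one_iff x).2 hx
  show (QuotientGroup.mk x : G ⧸ U.toSubgroup) ∈ dimensionSubgroup (ZMod p) _ n
  rw [hx1]
  exact one_mem _

end Separation

section Image

variable {G H : Type*} [Group G] [Group H]

/-- The image of a central series under a surjective homomorphism. -/
def CentralSeries.map (Γ : CentralSeries G) (f : G →* H) (hf : Function.Surjective f) :
    CentralSeries H where
  toFun n := (Γ n).map f
  one_eq_top := by rw [Γ.one_eq_top, Subgroup.map_top_of_surjective f hf]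
  succ_le n := Subgroup.map_mono (Γ.succ_le n)
  commutator_mem := by
    rintro m n _ _ ⟨g, hg, rfl⟩ ⟨h, hh, rfl⟩
    exact ⟨⁅g, h⁆, Γ.commutator_mem hg hh, map_commutatorElement f g h⟩

end Image

section Generation

variable {p : ℕ} [hp : Fact p.Prime] {G : Type*} [Group G] [TopologicalSpace G]
  [IsTopologicalGroup G]

/-- In a discrete or pro-`p` group the Zassenhaus series is contained in every central series of
closed subgroups that is restricted, in the sense that `p`-th powers multiply weights by `p`. -/
theorem zassenhausSeries_le (hG : DiscreteTopology G ∨ IsProP p G) {Γ : CentralSeries G}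
    (hpow : ∀ n : ℕ+, ∀ g ∈ Γ n, g ^ p ∈ Γ (primePNat p * n)) {n : ℕ+}
    (hn : IsClosed (Γ n : Set G)) : zassenhausSeries p G n ≤ Γ n := by
  intro x hx
  refine mem_of_forall_openNormalSubgroup hG hn fun U => ?_
  obtain ⟨c, hc, e⟩ := dimensionSubgroup_le
    (Γ := Γ.map (QuotientGroup.mk' U.toSubgroup) (QuotientGroup.mk'_surjective _))
    (by
      rintro n _ ⟨g, hg, rfl⟩
      exact ⟨g ^ p, hpow n g hg, map_pow _ _ _⟩) n
    ((mem_closedDimensionSubgroup p G).1 hx U)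
  exact ⟨c, hc, QuotientGroup.eq.1 e⟩

/-- The series that coincides with `Γ` except in degree `n`, where it is the preimage of a subgroup
of `Γ n / Γ (n + 1)` that contains all brackets. -/
def CentralSeries.refine (Γ : CentralSeries G) (n : ℕ+) (hn : n ≠ 1)
    (V : AddSubgroup (Γ.Piece n)) (hV : ∀ k m : ℕ+, k + m = n → ∀ g ∈ Γ k, ∀ h ∈ Γ m,
      ⁅g, h⁆ ∈ Γ.preimage n V) : CentralSeries G where
  toFun k := if k = n then Γ.preimage n V else Γ k
  one_eq_top := by rw [if_neg hn.symm, Γ.one_eq_top]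
  succ_le k := by
    have h1 : (if k + 1 = n then Γ.preimage n V else Γ (k + 1)) ≤ Γ (k + 1) := by
      split_ifs with h
      · rw [h]; exact preimage_le n V
      · exact le_rfl
    refine h1.trans ?_
    split_ifs with h
    · subst h
      intro g hg
      refine (mem_preimage (Γ.succ_le k hg)).2 ?_
      rw [(Piece.mk_eq_zero Γ (g := ⟨g, Γ.succ_le k hg⟩)).2 hg]
      exact V.zero_mem
    · exact Γ.succ_le k
  commutator_mem {k m g h} hg hh := by
    have h1 : ∀ k : ℕ+, (if k = n then Γ.preimage n V else Γ k) ≤ Γ k := fun k => by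
      split_ifs with h
      · rw [h]; exact preimage_le n V
      · exact le_rfl
    have hg := h1 k hg
    have hh := h1 m hh
    split_ifs with e
    · exact hV k m e g hg h hh
    · exact Γ.commutator_mem hg hh

variable (G) in
/-- If a closed restricted subalgebra `S` contains the component of degree one and all classes of
degree less than `n`, then replacing `D_n(G)` by the preimage of `S` gives a restricted central
series, which contains the Zassenhaus series by `zassenhausSeries_le`. -/
theorem isOneGenerated_gradingZ (hG : DiscreteTopology G ∨ IsProP p G) :
    IsOneGenerated p (pieceZ p G) (gradingZ p G) := by
  intro S hS hP hcl h1
  set Γ := zassenhausSeries p G with hΓ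
  let V : ∀ n, AddSubgroup (Γ.Piece n) := fun n => S.toAddSubgroup.comap (Γ.of n)
  have key : ∀ n, Γ n ≤ Γ.preimage n (V n) := by
    intro n
    induction n using PNat.strongInductionOn with
    | _ n ih =>
    by_cases hn : n = 1
    · subst hn
      exact fun g hg => ⟨hg, h1 (Submodule.subset_span ⟨_, rfl⟩)⟩
    have hV : ∀ k m : ℕ+, k + m = n → ∀ g ∈ Γ k, ∀ h ∈ Γ m, ⁅g, h⁆ ∈ Γ.preimage n (V n) := by
      rintro k m rfl g hg h hh
      obtain ⟨_, h2⟩ := ih k (PNat.lt_add_right k m) hg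
      obtain ⟨_, h3⟩ := ih m (PNat.lt_add_left m k) hh
      refine ⟨Γ.commutator_mem hg hh, ?_⟩
      have e := hS _ h2 _ h3
      rw [of_lie_of] at e
      exact e
    have h4 : ((Γ.refine n hn (V n) hV) n : Set G) = Γ.preimage n (V n) :=
      congrArg (fun K : Subgroup G => (K : Set G)) (if_pos rfl)
    have h5 := zassenhausSeries_le hG (Γ := Γ.refine n hn (V n) hV) ?_ (n := n) ?_
    · intro x hx
      have : x ∈ ((Γ.refine n hn (V n) hV) n : Set G) := h5 hx
      rwa [h4] at this
    · intro k g hg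
      have hg' : g ∈ Γ k := by
        have hg : g ∈ (if k = n then Γ.preimage n (V n) else Γ k) := hg
        split_ifs at hg with h
        · rw [h]; exact preimage_le n _ hg
        · exact hg
      show g ^ p ∈ if primePNat p * k = n then Γ.preimage n (V n) else Γ (primePNat p * k)
      split_ifs with h
      · subst h
        have hk : k < primePNat p * k := by
          rw [← PNat.coe_lt_coe, PNat.mul_coe, coe_primePNat]
          exact lt_mul_of_one_lt_left k.pos hp.out.one_lt
        obtain ⟨_, h2⟩ := ih k hk hg'
        have e := hP _ h2
        refine ⟨pow_mem_zassenhausSeries p G hg', ?_⟩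
        have e2 := pPow_of p G k ⟨g, hg'⟩
        show Γ.of _ _ ∈ S
        rw [← e2]
        exact e
      · exact pow_mem_zassenhausSeries p G hg'
    · rw [h4]
      exact isClosed_preimage (isClosed_zassenhausSeries p G n) (hcl n)
  refine eq_top_iff.2 fun x _ => ?_
  induction x using Gr.ind with
  | hof n g => exact (mem_preimage g.2).1 (key n g.2)
  | h0 => exact zero_mem _
  | hadd x y hx hy => exact add_mem (hx trivial) (hy trivial)

end Generation

/-! ### Surjectivity -/

section Surjective

variable (p : ℕ) [hp : Fact p.Prime] (G : Type*) [Group G] [TopologicalSpace G]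

theorem iterate_pPow_cl {i n : ℕ+} {j : ℕ} (hn : (i : ℕ) * p ^ j = n) {g : G}
    (hg : g ∈ zassenhausSeries p G i) : ∃ h : g ^ p ^ j ∈ zassenhausSeries p G n,
      (pPow p (ZMod p))^[j] ((zassenhausSeries p G).cl i g hg) =
        (zassenhausSeries p G).cl n (g ^ p ^ j) h := by
  induction j generalizing n with
  | zero =>
    have : i = n := PNat.coe_injective (by simpa using hn)
    subst this
    exact ⟨by simpa using hg, cl_congr _ rfl (by simp) _ _⟩
  | succ j ih =>
    obtain ⟨m, hm⟩ : ∃ m : ℕ+, (i : ℕ) * p ^ j = m :=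
      ⟨⟨i * p ^ j, Nat.mul_pos i.pos (pow_pos hp.out.pos j)⟩, rfl⟩
    have e : primePNat p * m = n := PNat.coe_injective (by
      rw [← hn, PNat.mul_coe, coe_primePNat, ← hm, pow_succ]; ring)
    subst e
    obtain ⟨h, e⟩ := ih hm
    have h2 := pow_mem_zassenhausSeries p G h
    rw [← pow_mul, ← pow_succ] at h2
    refine ⟨h2, ?_⟩
    rw [Function.iterate_succ_apply', e]
    refine (pPow_of p G m ⟨_, h⟩).trans (cl_congr _ rfl ?_ _ _)
    rw [pow_succ, pow_mul]

variable {G} in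
theorem iterate_pPow_mem_gradingZ {i n : ℕ+} {j : ℕ} (hn : (i : ℕ) * p ^ j = n) {x : GrZ p G}
    (hx : x ∈ gradingZ p G i) : (pPow p (ZMod p))^[j] x ∈ gradingZ p G n := by
  obtain ⟨a, rfl⟩ := (mem_gradingZ p G).1 hx
  induction a using Piece.ind with | _ g
  obtain ⟨h, e⟩ := iterate_pPow_cl p G hn g.2
  exact (mem_gradingZ p G).2 ⟨_, e⟩

variable [IsTopologicalGroup G]

theorem theta_pieceM {n : ℕ+} {g : G} (hg : g ∈ gammaSeries G n) :
    theta p G (pieceM p G n (Piece.mk ⟨g, hg⟩)) =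
      (zassenhausSeries p G).cl n g (gammaSeries_le_zassenhausSeries p G n g hg) := by
  show liftLie (ZMod p) (rho p G) (1 ⊗ₜ (gammaSeries G).of n (Piece.mk ⟨g, hg⟩)) = _
  rw [liftLie_tmul, one_smul]
  exact grMap_of _ _ _ _ n ⟨g, hg⟩

/-- The image of `γ_n(G) / γ_{n+1}(G)` in `D_n(G) / D_{n+1}(G)`. -/
noncomputable def imageM (n : ℕ+) : Submodule (ZMod p) (GrZ p G) :=
  (gradingM p G n).map (theta p G).toLinearMap

theorem mem_imageM {n : ℕ+} {x : GrZ p G} : x ∈ imageM p G n ↔ ∃ (g : G)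
    (hg : g ∈ gammaSeries G n),
      x = (zassenhausSeries p G).cl n g (gammaSeries_le_zassenhausSeries p G n g hg) := by
  constructor
  · rintro ⟨_, hx, rfl⟩
    obtain ⟨a, rfl⟩ := (mem_gradingM p G).1 hx
    induction a using Piece.ind with | _ g
    exact ⟨g, g.2, theta_pieceM p G g.2⟩
  · rintro ⟨g, hg, rfl⟩
    exact ⟨_, (mem_gradingM p G).2 ⟨_, rfl⟩, theta_pieceM p G hg⟩

theorem isLieFamily_imageM : IsLieFamily (imageM p G) := by
  rintro m n _ _ ⟨x, hx, rfl⟩ ⟨y, hy, rfl⟩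
  exact ⟨⁅x, y⁆, isLieFamily_gradingM p G hx hy, LieHom.map_lie (theta p G) x y⟩

theorem imageM_le_gradingZ (n : ℕ+) : imageM p G n ≤ gradingZ p G n := by
  intro x hx
  obtain ⟨g, hg, rfl⟩ := (mem_imageM p G).1 hx
  exact (mem_gradingZ p G).2 ⟨_, rfl⟩

theorem powerSpan_imageM_le (n : ℕ+) : powerSpan p (imageM p G) n ≤ gradingZ p G n := by
  refine Submodule.span_le.2 ?_
  rintro _ ⟨i, j, a, h, ha, rfl⟩
  exact iterate_pPow_mem_gradingZ p h (imageM_le_gradingZ p G i ha)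

theorem of_mem_iSup_powerSpan {n : ℕ+} {a : (zassenhausSeries p G).Piece n} :
    (zassenhausSeries p G).of n a ∈ ⨆ n, powerSpan p (imageM p G) n ↔
      (zassenhausSeries p G).of n a ∈ powerSpan p (imageM p G) n := by
  refine ⟨fun h => ?_, fun h => Submodule.mem_iSup_of_mem n h⟩
  -- the projection to the component in degree `n`
  let π : GrZ p G →+ GrZ p G := ((zassenhausSeries p G).of n).comp
    (DFinsupp.evalAddMonoidHom n :
      (DirectSum ℕ+ fun n => (zassenhausSeries p G).Piece n) →+ (zassenhausSeries p G).Piece n)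
  have hπ : ∀ a, π ((zassenhausSeries p G).of n a) = (zassenhausSeries p G).of n a :=
    fun a => congrArg ((zassenhausSeries p G).of n) (DirectSum.of_eq_same n a)
  have hπ' : ∀ m a, m ≠ n → π ((zassenhausSeries p G).of m a) = 0 := fun m a h =>
    (congrArg ((zassenhausSeries p G).of n) (DirectSum.of_eq_of_ne _ _ _ (Ne.symm h))).trans
      (map_zero _)
  have key : ∀ x ∈ ⨆ n, powerSpan p (imageM p G) n, π x ∈ powerSpan p (imageM p G) n := by
    intro x hx
    induction hx using Submodule.iSup_induction' with
    | zero => rw [map_zero]; exact zero_mem _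
    | add x y _ _ hx hy => rw [map_add]; exact add_mem hx hy
    | mem m x hx =>
      obtain ⟨b, rfl⟩ := (mem_gradingZ p G).1 (powerSpan_imageM_le p G m hx)
      by_cases hmn : m = n
      · subst hmn
        rwa [hπ]
      · rw [hπ' m b hmn]
        exact zero_mem _
  have := key _ h
  rwa [hπ] at this

/-- The elements of `D_n(G)` whose classes are sums of `p ^ j`-th powers, `j < J`, of elements of
the lower central series. -/
def powerSet (n : ℕ+) (J : ℕ) : Set G :=
  {g | ∃ hg : g ∈ zassenhausSeries p G n,
    (zassenhausSeries p G).cl n g hg ∈ powerSpanLT p (imageM p G) n J}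

theorem powerSet_zero (n : ℕ+) : powerSet p G n 0 = zassenhausSeries p G (n + 1) := by
  have h0 : powerSpanLT p (imageM p G) n 0 = ⊥ := by
    rw [powerSpanLT, Submodule.span_eq_bot]
    rintro _ ⟨_, _, _, h, _⟩
    exact absurd h (Nat.not_lt_zero _)
  ext g
  constructor
  · rintro ⟨hg, h⟩
    rw [h0, Submodule.mem_bot] at h
    exact (Piece.mk_eq_zero _ (g := ⟨g, hg⟩)).1 (of_injective p G n (h.trans (map_zero _).symm))
  · intro h
    refine ⟨(zassenhausSeries p G).succ_le n h, ?_⟩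
    rw [h0, Submodule.mem_bot, cl, (Piece.mk_eq_zero _ (g := ⟨g, _⟩)).2 h, map_zero]

theorem powerSet_succ {n i : ℕ+} {J : ℕ} (hi : (i : ℕ) * p ^ J = n) :
    powerSet p G n (J + 1) =
      (fun y => y ^ p ^ J) '' (gammaSeries G i : Set G) * powerSet p G n J := by
  set Γ := zassenhausSeries p G
  ext g
  rw [Set.mem_mul]
  constructor
  · rintro ⟨hg, h⟩
    obtain ⟨a, ha, v, hv, e⟩ :=
      exists_of_mem_powerSpanLT_succ (𝓛 := imageM p G) (isLieFamily_imageM p G) hi h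
    obtain ⟨y, hy, rfl⟩ := (mem_imageM p G).1 ha
    obtain ⟨hy', e'⟩ := iterate_pPow_cl p G hi (gammaSeries_le_zassenhausSeries p G i y hy)
    refine ⟨y ^ p ^ J, ⟨y, hy, rfl⟩, (y ^ p ^ J)⁻¹ * g, ⟨mul_mem (inv_mem hy') hg, ?_⟩,
      mul_inv_cancel_left _ _⟩
    rw [cl_mul _ (inv_mem hy') hg, cl_inv _ hy', e, e', neg_add_cancel_left]
    exact hv
  · rintro ⟨_, ⟨y, hy, rfl⟩, v, ⟨hv, h⟩, rfl⟩
    obtain ⟨hy', e'⟩ := iterate_pPow_cl p G hi (gammaSeries_le_zassenhausSeries p G i y hy)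
    refine ⟨mul_mem hy' hv, ?_⟩
    rw [cl_mul _ hy' hv, ← e']
    refine add_mem (iterate_pPow_mem_powerSpanLT (Nat.lt_succ_self J) hi
      ((mem_imageM p G).2 ⟨y, hy, rfl⟩)) (Submodule.span_mono ?_ h)
    rintro _ ⟨i, j, a, hj, h⟩
    exact ⟨i, j, a, hj.trans (Nat.lt_succ_self J), h⟩

theorem isCompact_powerSet [CompactSpace G] (n : ℕ+) (J : ℕ) : IsCompact (powerSet p G n J) := by
  induction J with
  | zero =>
    rw [powerSet_zero]
    exact (isClosed_zassenhausSeries p G (n + 1)).isCompact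
  | succ J ih =>
    by_cases hi : ∃ i : ℕ+, (i : ℕ) * p ^ J = n
    · obtain ⟨i, hi⟩ := hi
      rw [powerSet_succ p G hi]
      exact ((isClosed_gammaSeries i).isCompact.image (by fun_prop)).mul ih
    · push Not at hi
      rw [powerSet, powerSpanLT_succ_of_forall_ne hi]
      exact ih

variable {p} in
/-- The image of `(gr^M(G) ⊗ 𝔽_p)^[p]` is closed in each degree: in the pro-`p` case its preimage in
`D_n(G)` is a product of finitely many compact sets. -/
theorem isClosed_preimage_iSup_powerSpan (hG : DiscreteTopology G ∨ IsProP p G) (n : ℕ+) :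
    IsClosed (pieceZ p G n ⁻¹'
      ((⨆ n, powerSpan p (imageM p G) n : Submodule _ _) : Set (GrZ p G))) := by
  rcases hG with hG | hG
  · exact isClosed_discrete _
  · have := hG.compactSpace
    have := hG.totallyDisconnectedSpace
    have hq : Topology.IsQuotientMap
        (Piece.mk : zassenhausSeries p G n → (zassenhausSeries p G).Piece n) :=
      isQuotientMap_quot_mk
    rw [← hq.isClosed_preimage]
    convert (isCompact_powerSet p G n n).isClosed.preimage continuous_subtype_val using 1
    ext g
    refine (of_mem_iSup_powerSpan p G).trans ?_
    rw [powerSpan_eq]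
    exact ⟨fun h => ⟨g.2, h⟩, fun ⟨_, h⟩ => h⟩

variable {p} in
theorem iSup_powerSpan_imageM (hG : DiscreteTopology G ∨ IsProP p G) :
    ⨆ n, powerSpan p (imageM p G) n = ⊤ := by
  refine isOneGenerated_gradingZ G hG _
    (fun x hx y hy => iSup_powerSpan_lie (𝓛 := imageM p G) (isLieFamily_imageM p G) hx hy)
    (fun x hx => iSup_powerSpan_pPow (𝓛 := imageM p G) (isLieFamily_imageM p G) hx)
    (isClosed_preimage_iSup_powerSpan G hG) fun x hx => ?_
  obtain ⟨a, rfl⟩ := (mem_gradingZ p G).1 hx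
  induction a using Piece.ind with | _ g
  have hg : (g : G) ∈ gammaSeries G 1 := by rw [(gammaSeries G).one_eq_top]; trivial
  exact Submodule.mem_iSup_of_mem 1 (le_powerSpan 1 ((mem_imageM p G).2 ⟨g, hg, rfl⟩))

theorem thetaHat_ι (x : GrMp p G) :
    thetaHat p G (Restrictification.ι p (ZMod p) _ x) = theta p G x :=
  Restrictification.lift_ι _ _

theorem thetaHat_iterate_pPow (j : ℕ) (x : GrMpRes p G) :
    thetaHat p G ((pPow p (ZMod p))^[j] x) = (pPow p (ZMod p))^[j] (thetaHat p G x) :=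
  Function.Semiconj.iterate_right (f := thetaHat p G) (fun x => (thetaHat p G).map_pPow x) j x

variable {p} in
theorem thetaHat_surjective (hG : DiscreteTopology G ∨ IsProP p G) :
    Function.Surjective (thetaHat p G) := by
  have h : ⨆ n, powerSpan p (imageM p G) n ≤
      LinearMap.range (thetaHat p G).toLieHom.toLinearMap := by
    refine iSup_le fun n => Submodule.span_le.2 ?_
    rintro _ ⟨i, j, _, _, ⟨a, _, rfl⟩, rfl⟩
    refine ⟨(pPow p (ZMod p))^[j] (Restrictification.ι p (ZMod p) _ a), ?_⟩
    refine (thetaHat_iterate_pPow p G j _).trans ?_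
    rw [thetaHat_ι]
    rfl
  intro x
  exact h (iSup_powerSpan_imageM G hG ▸ Submodule.mem_top)

theorem thetaHat_mem_gradingZ {n : ℕ+} {x : GrMpRes p G} (hx : x ∈ gradingMRes p G n) :
    thetaHat p G x ∈ gradingZ p G n := by
  have h : gradingMRes p G n ≤
      (gradingZ p G n).comap (thetaHat p G).toLieHom.toLinearMap := by
    refine Submodule.span_le.2 ?_
    rintro _ ⟨i, j, a, h, ha, rfl⟩
    show thetaHat p G _ ∈ gradingZ p G n
    rw [thetaHat_iterate_pPow, thetaHat_ι]
    exact iterate_pPow_mem_gradingZ p h (imageM_le_gradingZ p G i ⟨a, ha, rfl⟩)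
  exact h hx

end Surjective

/-! ### Naturality -/

section Naturality

variable (p : ℕ) [hp : Fact p.Prime] {G H : Type*} [Group G] [TopologicalSpace G]
  [Group H] [TopologicalSpace H]

theorem grZMap_of (f : G →ₜ* H) (n : ℕ+) (g : zassenhausSeries p G n) :
    grZMap p f ((zassenhausSeries p G).of n (Piece.mk g)) = (zassenhausSeries p H).of n
      (Piece.mk ⟨(f : G →* H) g, map_mem_zassenhausSeries p f n g g.2⟩) :=
  grMap_of _ _ _ _ n g

variable [IsTopologicalGroup G] [IsTopologicalGroup H]

theorem theta_natural (f : G →ₜ* H) (x : GrMp p G) :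
    theta p H (baseChangeLie (ZMod p) (grMMap f) x) = grZMap p f (theta p G x) := by
  induction x using TensorProduct.induction_on with
  | zero =>
    rw [map_zero, map_zero, map_zero]
    exact (map_zero (grZMap p f).toLieHom).symm
  | add x y hx hy => rw [map_add, map_add, map_add, (grZMap p f).map_add, hx, hy]
  | tmul c x =>
    show liftLie (ZMod p) (rho p H) (c ⊗ₜ grMMap f x) =
      grZMap p f (liftLie (ZMod p) (rho p G) (c ⊗ₜ x))
    rw [liftLie_tmul, liftLie_tmul, (grZMap p f).map_smul]
    congr 1
    induction x using Gr.ind with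
    | hof n g =>
      have e1 : grMMap f ((gammaSeries G).of n (Piece.mk g)) = _ := grMap_of _ _ _ _ n g
      have e2 : rho p G ((gammaSeries G).of n (Piece.mk g)) = _ := grMap_of _ _ _ _ n g
      rw [e1, e2]
      exact (grMap_of _ _ _ _ n _).trans
        (grZMap_of p f n ⟨g, gammaSeries_le_zassenhausSeries p G n g g.2⟩).symm
    | h0 =>
      rw [map_zero, map_zero, map_zero]
      exact (map_zero (grZMap p f).toLieHom).symm
    | hadd x y hx hy => rw [map_add, map_add, map_add, (grZMap p f).map_add, hx, hy]

theorem thetaHat_natural (f : G →ₜ* H) (x : GrMpRes p G) :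
    thetaHat p H (grMpResMap p f x) = grZMap p f (thetaHat p G x) := by
  have h : (thetaHat p H).comp (grMpResMap p f) = (grZMap p f).comp (thetaHat p G) :=
    Restrictification.hom_ext fun x => theta_natural p f x
  exact congrArg (fun F : RestrictedLieHom p (ZMod p) (GrMpRes p G) (GrZ p H) => F x) h

end Naturality

end MagnusZassenhaus

theorem theoremA (p : ℕ) [Fact p.Prime] :
    (∀ (G : Type u) [Group G] [TopologicalSpace G] [IsTopologicalGroup G],
      (DiscreteTopology G ∨ IsProP p G) →
        (IsNGraded p (gradingMRes p G) ∧
          IsOneGenerated p (pieceMRes p G) (gradingMRes p G)) ∧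
        (IsNGraded p (gradingZ p G) ∧
          IsOneGenerated p (pieceZ p G) (gradingZ p G)) ∧
        (∀ (n : ℕ+) (g : G) (hg : g ∈ gammaSeries G n),
          theta p G ((1 : ZMod p) ⊗ₜ[ℤ] (gammaSeries G).cl n g hg) =
            (zassenhausSeries p G).cl n g (gammaSeries_le_zassenhausSeries p G n g hg)) ∧
        (∀ Ψ : RestrictedLieHom p (ZMod p) (GrMpRes p G) (GrZ p G),
          (∀ x : GrMp p G, Ψ (Restrictification.ι p (ZMod p) (GrMp p G) x) = theta p G x) ↔
            Ψ = thetaHat p G) ∧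
        (∀ (n : ℕ+) (x : GrMpRes p G), x ∈ gradingMRes p G n → thetaHat p G x ∈ gradingZ p G n) ∧
        Function.Surjective (thetaHat p G)) ∧
    (∀ (G : Type u) [Group G] [TopologicalSpace G] [IsTopologicalGroup G]
      (H : Type v) [Group H] [TopologicalSpace H] [IsTopologicalGroup H] (f : G →ₜ* H)
      (x : GrMpRes p G), thetaHat p H (grMpResMap p f x) = grZMap p f (thetaHat p G x)) := by
  refine ⟨fun G _ _ _ hG => ⟨⟨isNGraded_gradingMRes p G, isOneGenerated_gradingMRes p G⟩,
    ⟨isNGraded_gradingZ p G, isOneGenerated_gradingZ G hG⟩, fun n g hg => theta_pieceM p G hg,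
    fun Ψ => ⟨fun h => Restrictification.hom_ext h, ?_⟩, fun n x => thetaHat_mem_gradingZ p G,
    thetaHat_surjective G hG⟩, fun G _ _ _ H _ _ _ f x => thetaHat_natural p f x⟩
  rintro rfl x
  exact thetaHat_ι p G x
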